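/- Let $M$ be a smooth manifold, let $H$ be a Lie group (not necessarily compact) with Lie algebra $\mathfrak h$, acting smoothly on $M$, and fix a Lebesgue (Haar) measure $dX$ on $\mathfrak h$. Write $X_M$ for the fundamental vector field on $M$ generated by $X\in\mathfrak h$. Let $E\subset TM$ be a smooth distribution (subbundle) whose annihilator $E^0\subset T^*M$ has rank $k$ and is oriented. Assume that $H$ preserves $E$ and the orientation of $E^0$, and that the action is transverse to $E$: $E+\mathfrak h_M=TM$, where $\mathfrak h_M$ is the set of vectors tangent to the orbits. An equivariant differential form on $M$ with generalized coefficients is a continuous linear map $T$ from $C_c^\infty(\mathfrak h)$ to smooth complex differential forms on $M$, $T(\varphi)=\int_{\mathfrak h}T(X)\varphi(X)\,dX$, such that $h^*T(\mathrm{Ad}(h)X)=T(X)$ for all $h\in H$. For an invariant form $\omega$, let $D\omega(X)=d\omega-\iota(X)\omega$, where $\iota(X)$ is contraction with the fundamental vector field. For a smooth oriented frame $\boldsymbol\alpha=(\alpha_1,\dots,\alpha_k)$ of $E^0$ over an open set $U\subset M$, put $f_{\boldsymbol\alpha}(X)=-\boldsymbol\alpha(X_M)$, so that $D\boldsymbol\alpha(X)=d\boldsymbol\alpha+f_{\boldsymbol\alpha}(X)$,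 and define $$\delta_0(D\boldsymbol\alpha(X))=\sum_{I}\frac{\delta_0^{(I)}(f_{\boldsymbol\alpha}(X))}{I!}\,d\boldsymbol\alpha^I ,$$ where, at $x\in U$, the generalized function $\delta_0^{(I)}\circ f_{\boldsymbol\alpha}(x)$ on $\mathfrak h$ is the pull-back of the derivative $\delta_0^{(I)}$ of the Dirac distribution on $\mathbb R^k$ under the linear map $f_{\boldsymbol\alpha}(x):\mathfrak h\to\mathbb R^k$; that is, its pairing with $\varphi\,dX$ is $(-1)^{|I|}\partial^I g(0)$, where $g\,du$ is the push-forward of $\varphi\,dX$ under $f_{\boldsymbol\alpha}(x)$. Let $\theta$ be the canonical $1$-form on $T^*M$, with the sign convention $\theta=-\sum_j p_j\,dq^j$; let $\imath:E^0\to T^*M$ be the inclusion and $q:E^0\to M$ the projection; let $q_*$ be integration over the oriented fibres of $E^0$, normalized by $q_*(q^*\beta\wedge f\,d\xi^1\wedge\cdots\wedge d\xi^k)=\beta\int f\,d\xi$ for the fibre coordinates $\xi$ of an oriented frame. Let $\mathcal J(E,X)=(2\pi i)^{-k}q_*\imath^*e^{iD\theta(X)}$, as an oscillatory integral: $\int_{\mathfrak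 h}\mathcal J(E,X)\varphi(X)\,dX=(2\pi i)^{-k}q_*\imath^*\int_{\mathfrak h}e^{iD\theta(X)}\varphi(X)\,dX$ for $\varphi\in C_c^\infty(\mathfrak h)$. Then: 1. For every oriented frame $\boldsymbol\alpha$ of $E^0$ over an open set $U$ and every $x\in U$, the push-forward under $f_{\boldsymbol\alpha}(x)$ of each $\varphi\,dX$, $\varphi\in C_c^\infty(\mathfrak h)$, has a unique density in $C_c^\infty(\mathbb R^k)$, so that the generalized functions $\delta_0^{(I)}\circ f_{\boldsymbol\alpha}(x)$ are well defined. 2. There is a unique equivariant differential form $\tilde{\mathcal J}(E,X)$ with generalized coefficients on $M$ whose restriction to $U$ is $\alpha_k\wedge\cdots\wedge\alpha_1\wedge\delta_0(D\boldsymbol\alpha(X))$ for every oriented frame $\boldsymbol\alpha$ of $E^0$ over any open set $U\subset M$. 3. The fibre integrals defining $\mathcal J(E,X)$ converge absolutely, and $\mathcal J(E,X)$ is an equivariant differential form with generalized coefficients on $M$. 4. $\tilde{\mathcal J}(E,X)=\mathcal J(E,X)$. -/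

import Mathlib

open Set Filter Topology MeasureTheory Bundle
open scoped TensorProduct Manifold ContDiff Distributions

noncomputable section

/-! ### The graded algebra of complex-valued alternating forms on a real vector space -/

section Algebra

variable {V : Type*} [AddCommGroup V] [Module ℝ V] [TopologicalSpace V]

/-- Inhomogeneous complex-valued alternating forms on `V`, given by their homogeneous components.
(When `V` is finite-dimensional, all but finitely many components vanish.) -/
abbrev GradedForm (V : Type*) [AddCommGroup V] [Module ℝ V] [TopologicalSpace V] : Type _ :=
  (n : ℕ) → V [⋀^Fin n]→L[ℝ] ℂ

/-- The wedge product of a `p`-form and a `q`-form: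
`(a ∧ b)(v) = ∑ sign σ · a(v_{σ(1)}, …, v_{σ(p)}) · b(v_{σ(p+1)}, …, v_{σ(p+q)})`, the sum being
over `(p, q)`-shuffles. -/
def wedge {p q n : ℕ} (h : p + q = n) (a : V [⋀^Fin p]→L[ℝ] ℂ) (b : V [⋀^Fin q]→L[ℝ] ℂ) :
    V [⋀^Fin n]→L[ℝ] ℂ :=
  { ((LinearMap.mul' ℝ ℂ).compAlternatingMap
      (a.toAlternatingMap.domCoprod b.toAlternatingMap)).domDomCongr
        (finSumFinEquiv.trans (finCongr h)) with
    cont := by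
      have key : Continuous fun v : Fin n → V =>
          (LinearMap.mul' ℝ ℂ) ((a.toAlternatingMap.domCoprod b.toAlternatingMap)
            (v ∘ (finSumFinEquiv.trans (finCongr h)))) := by
        simp only [AlternatingMap.domCoprod_apply, sum_apply, map_sum]
        refine continuous_finsetSum _ fun σ _ => ?_
        induction σ using Quotient.inductionOn' with
        | _ σ =>
        rw [AlternatingMap.domCoprod.summand_mk'']
        have h1 : Continuous fun v : Fin n → V =>
            a (fun i => v (finCongr h (finSumFinEquiv (σ (Sum.inl i))))) *
              b (fun i => v (finCongr h (finSumFinEquiv (σ (Sum.inr i))))) :=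
          (a.cont.comp (continuous_pi fun i => continuous_apply _)).mul
            (b.cont.comp (continuous_pi fun i => continuous_apply _))
        refine (h1.const_smul ((Equiv.Perm.sign σ : ℤˣ) : ℤ)).congr fun v => ?_
        exact (map_zsmul (LinearMap.mul' ℝ ℂ) ((Equiv.Perm.sign σ : ℤˣ) : ℤ)
          (a (fun i => v (finCongr h (finSumFinEquiv (σ (Sum.inl i))))) ⊗ₜ[ℝ]
            b (fun i => v (finCongr h (finSumFinEquiv (σ (Sum.inr i))))))).symm
      exact key }

/-- Interior multiplication by a vector: `(ι_X a)(v₁, …, vₙ) = a(X, v₁, …, vₙ)`. -/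
def interior1 {n : ℕ} (X : V) (a : V [⋀^Fin (n + 1)]→L[ℝ] ℂ) : V [⋀^Fin n]→L[ℝ] ℂ :=
  { a.toAlternatingMap.curryLeft X with
    cont := by
      have key : Continuous fun v : Fin n → V => a (Matrix.vecCons X v) :=
        a.cont.comp (continuous_const.matrixVecCons continuous_id)
      exact key }

/-- A real covector, as a complex-valued `1`-form. -/
def covectorForm (a : V →L[ℝ] ℝ) : V [⋀^Fin 1]→L[ℝ] ℂ :=
  ContinuousAlternatingMap.ofSubsingleton ℝ V ℂ (0 : Fin 1) (Complex.ofRealCLM.comp a)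

namespace GradedForm

/-- A homogeneous form, as an inhomogeneous one. -/
def homog (n : ℕ) (a : V [⋀^Fin n]→L[ℝ] ℂ) : GradedForm V := Pi.single n a

/-- The unit `1` of the algebra of forms. -/
def one : GradedForm V := homog 0 (ContinuousAlternatingMap.constOfIsEmpty ℝ V (Fin 0) 1)

/-- The product (wedge product) of inhomogeneous forms. -/
def mul (a b : GradedForm V) : GradedForm V := fun n =>
  ∑ p : Fin (n + 1), wedge (Nat.add_sub_of_le (Nat.le_of_lt_succ p.2)) (a p) (b (n - p))

/-- The product of a list of forms, in the order of the list. -/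
def listProd (l : List (GradedForm V)) : GradedForm V := l.foldr mul one

/-- Powers with respect to the wedge product. -/
def pow (a : GradedForm V) (m : ℕ) : GradedForm V := listProd (List.replicate m a)

/-- The exponential of an inhomogeneous form `a = a₀ + a₊` on a finite-dimensional space, where
`a₀` is the (scalar) degree zero part and `a₊` is nilpotent: `e^a = e^{a₀} ∑_m a₊^m / m!`. -/
def exp (a : GradedForm V) : GradedForm V :=
  Complex.exp (a 0 (fun i => i.elim0)) •
    ∑ m ∈ Finset.range (Module.finrank ℝ V + 1),
      ((m.factorial : ℂ)⁻¹) • pow (Function.update a 0 0) m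

end GradedForm

end Algebra

/-! ### Differential forms on manifolds -/

section Forms

variable {F : Type*} [NormedAddCommGroup F] [NormedSpace ℝ F]
  {B : Type*} [TopologicalSpace B] (I : ModelWithCorners ℝ F B)
  {N : Type*} [TopologicalSpace N] [ChartedSpace B N]

/-- (Not necessarily smooth) complex-valued differential `n`-forms on `N`. -/
abbrev FormField (N : Type*) [TopologicalSpace N] [ChartedSpace B N] (n : ℕ) : Type _ :=
  (x : N) → TangentSpace I x [⋀^Fin n]→L[ℝ] ℂ

/-- (Not necessarily smooth) inhomogeneous complex-valued differential forms on `N`. -/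
abbrev DiffForm (N : Type*) [TopologicalSpace N] [ChartedSpace B N] : Type _ :=
  (x : N) → GradedForm (TangentSpace I x)

/-- The expression of a differential form in the preferred chart around `x₀`. -/
def formInChart {n : ℕ} (η : FormField I N n) (x₀ : N) (y : F) : F [⋀^Fin n]→L[ℝ] ℂ :=
  (η ((extChartAt I x₀).symm y)).compContinuousLinearMap
    (mfderivWithin 𝓘(ℝ, F) I (extChartAt I x₀).symm (range I) y)

/-- A differential form is smooth if its expressions in charts are. -/
def IsSmoothForm {n : ℕ} (η : FormField I N n) : Prop :=
  ∀ x₀ : N, ContDiffOn ℝ ∞ (formInChart I η x₀) (extChartAt I x₀).target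

/-- The exterior derivative of an `n`-form on a manifold, computed in the preferred chart
around each point. -/
def mextDeriv {n : ℕ} (η : FormField I N n) : FormField I N (n + 1) := fun x =>
  (extDerivWithin (formInChart I η x) (range I) (extChartAt I x x)).compContinuousLinearMap
    (mfderiv I 𝓘(ℝ, F) (extChartAt I x) x)

/-- The exterior derivative of an inhomogeneous form. -/
def DiffForm.d (η : DiffForm I N) : DiffForm I N := fun x n =>
  match n with
  | 0 => 0
  | n + 1 => mextDeriv I (fun y => η y n) x

end Forms

/-! ### Lie group actions -/

section Action

variable {EH : Type*} [NormedAddCommGroup EH] [NormedSpace ℝ EH]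
  {H : Type*} [TopologicalSpace H] [ChartedSpace EH H] [Group H]
  {F : Type*} [NormedAddCommGroup F] [NormedSpace ℝ F]
  {B : Type*} [TopologicalSpace B] (I : ModelWithCorners ℝ F B)
  {N : Type*} [TopologicalSpace N] [ChartedSpace B N]

/-- The fundamental vector field `X_N` generated by `X` in the Lie algebra `T₁H` (whose underlying
vector space is the model space `EH`), for an action of `H` on `N` given as a map `H → N → N`:
the derivative at `1` of `h ↦ h · x`, applied to `X`. -/
def fundamentalField (act : H → N → N) (X : EH) (x : N) : TangentSpace I x :=
  (mfderiv 𝓘(ℝ, EH) I (fun h : H => act h x) 1 : EH →L[ℝ] F) X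

/-- The equivariant differential `(Dη)(X) = dη - ι(X_N) η` of a form `η` not depending on `X`. -/
def equivariantD (act : H → N → N) (η : DiffForm I N) (X : EH) : DiffForm I N := fun x n =>
  DiffForm.d I η x n - interior1 (fundamentalField I act X x) (η x (n + 1))

variable (H) in
/-- The adjoint action of `h` on the Lie algebra: the derivative at `1` of `g ↦ h g h⁻¹`. -/
def adjointAction (h : H) : EH →L[ℝ] EH :=
  (mfderiv 𝓘(ℝ, EH) 𝓘(ℝ, EH) (fun g : H => h * g * h⁻¹) 1 : EH →L[ℝ] EH)

end Action

/-! ### Pull-back of derivatives of the Dirac distribution -/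

section Dirac

variable {W : Type*} [MeasurableSpace W] {k : ℕ}

/-- `g` is the push-forward of (the density) `φ` under `f : W → ℝ^k`: a smooth compactly supported
function with `∫ ψ(f(X)) φ(X) dX = ∫ ψ(u) g(u) du` for every continuous `ψ`. -/
structure IsPushforward (μ : Measure W) (f : W → Fin k → ℝ) (φ : W → ℂ)
    (g : (Fin k → ℝ) → ℂ) : Prop where
  contDiff : ContDiff ℝ ∞ g
  hasCompactSupport : HasCompactSupport g
  integral_eq : ∀ ψ : (Fin k → ℝ) → ℂ, Continuous ψ →
    ∫ X, ψ (f X) * φ X ∂μ = ∫ u, ψ u * g u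

open Classical in
/-- The push-forward of `φ` under `f` (and `0` if there is none). -/
def pushforward (μ : Measure W) (f : W → Fin k → ℝ) (φ : W → ℂ) : (Fin k → ℝ) → ℂ :=
  if h : ∃ g, IsPushforward μ f φ g then h.choose else 0

/-- The mixed partial derivative `(∂/∂u₁)^{i₁} ⋯ (∂/∂u_k)^{i_k} g`. -/
def mixedPartial (i : Fin k → ℕ) (g : (Fin k → ℝ) → ℂ) : (Fin k → ℝ) → ℂ :=
  (List.finRange k).foldr
    (fun j G => (fun (G' : (Fin k → ℝ) → ℂ) (u : Fin k → ℝ) =>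
      fderiv ℝ G' u (Pi.single j 1))^[i j] G) g

/-- The pairing `∫ (δ₀^{(i)} ∘ f)(X) φ(X) dX` of the pull-back under `f` of the derivative
`δ₀^{(i)}` of the Dirac distribution on `ℝ^k` with `φ`, i.e. the pairing of `δ₀^{(i)}` with the
push-forward of `φ`. -/
def diracPullback (μ : Measure W) (f : W → Fin k → ℝ) (i : Fin k → ℕ) (φ : W → ℂ) : ℂ :=
  (-1) ^ (∑ j, i j) * mixedPartial i (pushforward μ f φ) 0

end Dirac

/-! ### Distributions, conormal bundles, and the forms `J` -/

section Main

variable {EM : Type*} [NormedAddCommGroup EM] [NormedSpace ℝ EM]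
  {M : Type*} [TopologicalSpace M] [ChartedSpace EM M]

/-- The model with corners of the cotangent bundle. -/
abbrev cotModel (EM : Type*) [NormedAddCommGroup EM] [NormedSpace ℝ EM] :=
  𝓘(ℝ, EM).prod 𝓘(ℝ, EM →L[ℝ] ℝ)

variable (EM M) in
/-- The cotangent bundle `T^*M`, as a manifold. -/
abbrev Cotangent [IsManifold 𝓘(ℝ, EM) 1 M] : Type _ :=
  TotalSpace (EM →L[ℝ] ℝ) (fun x : M => TangentSpace 𝓘(ℝ, EM) x →L[ℝ] ℝ)

/-- The family `E` of subspaces is a smooth distribution (subbundle of `TM`) of rank `r`: it is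
locally spanned by `r` pointwise linearly independent smooth vector fields. -/
def IsSmoothDistribution [IsManifold 𝓘(ℝ, EM) 1 M]
    (E : (x : M) → Submodule ℝ (TangentSpace 𝓘(ℝ, EM) x)) (r : ℕ) : Prop :=
  ∀ x₀ : M, ∃ U : Set M, IsOpen U ∧ x₀ ∈ U ∧
    ∃ V : Fin r → (x : M) → TangentSpace 𝓘(ℝ, EM) x,
      (∀ i, ContMDiffOn 𝓘(ℝ, EM) 𝓘(ℝ, EM).tangent ∞
        (fun x => (⟨x, V i x⟩ : TangentBundle 𝓘(ℝ, EM) M)) U) ∧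
      ∀ x ∈ U, LinearIndependent ℝ (fun i => V i x) ∧
        Submodule.span ℝ (range fun i => V i x) = E x

/-- The fibre `E^0_x` of the annihilator of `E`. -/
def conormal (E : (x : M) → Submodule ℝ (TangentSpace 𝓘(ℝ, EM) x)) (x : M) :
    Submodule ℝ (TangentSpace 𝓘(ℝ, EM) x →L[ℝ] ℝ) where
  carrier := {p | ∀ v ∈ E x, p v = 0}
  add_mem' := fun ha hb v hv => by simp [ha v hv, hb v hv]
  zero_mem' := fun v _ => by simp
  smul_mem' := fun c p hp v hv => by simp [hp v hv]

variable {E : (x : M) → Submodule ℝ (TangentSpace 𝓘(ℝ, EM) x)} {k : ℕ}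

/-- The covectors `b₁, …, b_k` form a positively oriented basis of `E^0_x`. -/
def IsPositive (o : (x : M) → Orientation ℝ (conormal E x) (Fin k)) (x : M)
    (b : Fin k → (TangentSpace 𝓘(ℝ, EM) x →L[ℝ] ℝ)) : Prop :=
  ∃ β : Module.Basis (Fin k) ℝ (conormal E x),
    (∀ j, (β j : TangentSpace 𝓘(ℝ, EM) x →L[ℝ] ℝ) = b j) ∧
      Module.Basis.orientation (R := ℝ) (M := conormal E x) (ι := Fin k) β = o x

/-- `α = (α₁, …, α_k)` is a smooth oriented frame of `E^0` over the open set `U`. -/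
structure IsOrientedFrame [IsManifold 𝓘(ℝ, EM) 1 M]
    (o : (x : M) → Orientation ℝ (conormal E x) (Fin k)) (U : Set M)
    (α : Fin k → (x : M) → (TangentSpace 𝓘(ℝ, EM) x →L[ℝ] ℝ)) : Prop where
  isOpen : IsOpen U
  smooth : ∀ j, ContMDiffOn 𝓘(ℝ, EM) (cotModel EM) ∞
    (fun x => (⟨x, α j x⟩ : Cotangent EM M)) U
  positive : ∀ x ∈ U, IsPositive o x (fun j => α j x)

/-- The orientations `o x` of the fibres `E^0_x` form an orientation of the vector bundle `E^0`:
around every point there is a smooth oriented frame. -/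
def IsBundleOrientation [IsManifold 𝓘(ℝ, EM) 1 M]
    (o : (x : M) → Orientation ℝ (conormal E x) (Fin k)) : Prop :=
  ∀ x₀ : M, ∃ (U : Set M) (α : Fin k → (x : M) → (TangentSpace 𝓘(ℝ, EM) x →L[ℝ] ℝ)),
    x₀ ∈ U ∧ IsOrientedFrame o U α

variable {EH : Type*} [NormedAddCommGroup EH] [NormedSpace ℝ EH]
  (H : Type*) [TopologicalSpace H] [ChartedSpace EH H] [Group H] [MulAction H M]

/-- The derivative `T_x M → T_{hx} M` of the action of `h`. -/
def actionDeriv (h : H) (x : M) :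
    TangentSpace 𝓘(ℝ, EM) x →L[ℝ] TangentSpace 𝓘(ℝ, EM) (h • x) :=
  mfderiv 𝓘(ℝ, EM) 𝓘(ℝ, EM) (fun y : M => h • y) x

/-- The action of `H` preserves `E`. -/
def PreservesDistribution (E : (x : M) → Submodule ℝ (TangentSpace 𝓘(ℝ, EM) x)) : Prop :=
  ∀ (h : H) (x : M), ∀ v ∈ E x, actionDeriv H h x v ∈ E (h • x)

/-- The action of `H` preserves the orientation of `E^0`: pulling back an oriented basis of
`E^0_{hx}` by `h` gives an oriented basis of `E^0_x`. -/
def PreservesOrientation (o : (x : M) → Orientation ℝ (conormal E x) (Fin k)) : Prop :=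
  ∀ (h : H) (x : M) (b : Fin k → (TangentSpace 𝓘(ℝ, EM) (h • x) →L[ℝ] ℝ)),
    IsPositive o (h • x) b → IsPositive o x (fun j => (b j).comp (actionDeriv H h x))

/-- The action of `H` is transverse to `E`: at each point, `E` and the tangent space of the orbit
span the tangent space of `M`. -/
def IsTransverse (EH : Type*) [NormedAddCommGroup EH] [NormedSpace ℝ EH]
    (H : Type*) [TopologicalSpace H] [ChartedSpace EH H] [Group H] [MulAction H M]
    (E : (x : M) → Submodule ℝ (TangentSpace 𝓘(ℝ, EM) x)) : Prop :=
  ∀ (x : M) (v : TangentSpace 𝓘(ℝ, EM) x), ∃ e ∈ E x, ∃ X : EH,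
    v = e + fundamentalField 𝓘(ℝ, EM) (fun (h : H) (y : M) => h • y) X x

/-- `T` is an `H`-equivariant differential form on `M` with generalized coefficients. The map `T`
sends a test function `φ` on the Lie algebra to `∫ T(X) φ(X) dX`. It is a map into smooth forms;
continuity is required pointwise on `M`, which by the closed graph theorem is equivalent to
continuity into the Fréchet space of smooth forms. Equivariance means `h^* T(Ad(h) X) = T(X)`;
the determinant is the Jacobian of the substitution `X ↦ Ad(h) X` in the pairing. -/
structure IsGeneralizedForm
    (T : 𝓓((⊤ : TopologicalSpace.Opens EH), ℂ) →ₗ[ℂ] DiffForm 𝓘(ℝ, EM) M) : Prop where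
  smooth : ∀ φ n, IsSmoothForm 𝓘(ℝ, EM) (fun x => T φ x n)
  continuous : ∀ (x : M) (n : ℕ) (v : Fin n → TangentSpace 𝓘(ℝ, EM) x),
    Continuous fun φ => T φ x n v
  equivariant : ∀ (h : H) (φ ψ : 𝓓((⊤ : TopologicalSpace.Opens EH), ℂ)),
    (∀ X : EH, ψ (adjointAction H h X) = φ X) →
    ∀ (x : M) (n : ℕ),
      (T ψ (h • x) n).compContinuousLinearMap (actionDeriv H h x) =
        |(adjointAction H h : EH →L[ℝ] EH).det| • T φ x n

/-- The map `f_α(x)`, `X ↦ -α(X_M)(x)`, from the Lie algebra to `ℝ^k`. -/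
def momentMap (α : Fin k → (x : M) → (TangentSpace 𝓘(ℝ, EM) x →L[ℝ] ℝ)) (x : M) (X : EH) :
    Fin k → ℝ :=
  fun j => -(α j x (fundamentalField 𝓘(ℝ, EM) (fun (h : H) (y : M) => h • y) X x))

variable [MeasurableSpace EH] (μ : Measure EH)

/-- The form `∫ δ₀(Dα(X)) φ(X) dX` at `x`, given by the (finite) Taylor expansion
`δ₀(dα + f_α(X)) = ∑_I δ₀^{(I)}(f_α(X)) / I! dα^I`. All terms with `|I| > dim M` vanish. -/
def diracForm (α : Fin k → (x : M) → (TangentSpace 𝓘(ℝ, EM) x →L[ℝ] ℝ)) (φ : EH → ℂ)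
    (x : M) : GradedForm (TangentSpace 𝓘(ℝ, EM) x) :=
  ∑ m ∈ Finset.range (Module.finrank ℝ EM + 1),
    ∑ i ∈ Finset.piAntidiag (Finset.univ : Finset (Fin k)) m,
      (diracPullback μ (momentMap H α x) i φ / ((∏ j, (i j).factorial : ℕ) : ℂ)) •
        GradedForm.listProd (List.ofFn fun j =>
          GradedForm.pow (GradedForm.homog 2
            (mextDeriv 𝓘(ℝ, EM) (fun y => covectorForm (α j y)) x)) (i j))

/-- The form `∫ (α_k ∧ ⋯ ∧ α_1 ∧ δ₀(Dα(X))) φ(X) dX` at `x`. -/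
def localForm (α : Fin k → (x : M) → (TangentSpace 𝓘(ℝ, EM) x →L[ℝ] ℝ)) (φ : EH → ℂ)
    (x : M) : GradedForm (TangentSpace 𝓘(ℝ, EM) x) :=
  GradedForm.mul
    (GradedForm.listProd (List.ofFn fun j : Fin k =>
      GradedForm.homog 1 (covectorForm (α j.rev x))))
    (diracForm H μ α φ x)

/-- `T` restricts to `α_k ∧ ⋯ ∧ α_1 ∧ δ₀(Dα(X))` on the domain of each oriented frame `α`. -/
def RestrictsToLocalForms [IsManifold 𝓘(ℝ, EM) 1 M]
    (o : (x : M) → Orientation ℝ (conormal E x) (Fin k))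
    (T : 𝓓((⊤ : TopologicalSpace.Opens EH), ℂ) →ₗ[ℂ] DiffForm 𝓘(ℝ, EM) M) : Prop :=
  ∀ (U : Set M) (α : Fin k → (x : M) → (TangentSpace 𝓘(ℝ, EM) x →L[ℝ] ℝ)),
    IsOrientedFrame o U α → ∀ (φ : 𝓓((⊤ : TopologicalSpace.Opens EH), ℂ)), ∀ x ∈ U,
      T φ x = localForm H μ α φ x

section FibreIntegral

variable [IsManifold 𝓘(ℝ, EM) 1 M]

/-- The canonical `1`-form on `T^*M`, with the sign convention `θ = -∑ p_j dq^j`, i.e.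
`θ_p(w) = -p(dπ(w))`. -/
def canonicalForm : DiffForm (cotModel EM) (Cotangent EM M) := fun p =>
  GradedForm.homog 1 (covectorForm (-(p.2.comp
    (mfderiv (cotModel EM) 𝓘(ℝ, EM) (fun q : Cotangent EM M => q.1) p))))

/-- The lift to `T^*M` of the action on `M`: `h · (x, p) = (h x, p ∘ (d_x h)⁻¹)`. -/
def cotangentAction (h : H) (p : Cotangent EM M) : Cotangent EM M :=
  ⟨h • p.1, p.2.comp (actionDeriv H h p.1).inverse⟩

/-- The pairing `∫ e^{iDθ(X)} φ(X) dX`, at a point `p` of `T^*M`, evaluated on tangent vectors. -/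
def expPairing (φ : EH → ℂ) (p : Cotangent EM M) (n : ℕ)
    (w : Fin n → TangentSpace (cotModel EM) p) : ℂ :=
  ∫ X, φ X * GradedForm.exp
    (Complex.I • equivariantD (cotModel EM) (cotangentAction H) canonicalForm X p) n w ∂μ

/-- The vector `w ∈ T_p(T^*M)` is tangent to the submanifold `E^0`: it is the velocity of a smooth
curve contained in `E^0`. -/
def IsTangentToConormal (E : (x : M) → Submodule ℝ (TangentSpace 𝓘(ℝ, EM) x))
    (p : Cotangent EM M) (w : TangentSpace (cotModel EM) p) : Prop :=
  ∃ γ : ℝ → Cotangent EM M, γ 0 = p ∧ ContMDiffAt 𝓘(ℝ, ℝ) (cotModel EM) ∞ γ 0 ∧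
    (∀ᶠ t in 𝓝 0, (γ t).2 ∈ conormal E (γ t).1) ∧
    (mfderiv 𝓘(ℝ, ℝ) (cotModel EM) γ 0 : ℝ →L[ℝ] EM × (EM →L[ℝ] ℝ)) 1 = w

/-- The vertical vector at `p` in the direction of the covector `b`: the velocity at `t = 0` of
`t ↦ p + t b`. -/
def verticalVector (p : Cotangent EM M) (b : TangentSpace 𝓘(ℝ, EM) p.1 →L[ℝ] ℝ) :
    TangentSpace (cotModel EM) p :=
  (mfderiv 𝓘(ℝ, ℝ) (cotModel EM) (fun t : ℝ => (⟨p.1, p.2 + t • b⟩ : Cotangent EM M)) 0 :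
    ℝ →L[ℝ] EM × (EM →L[ℝ] ℝ)) 1

/-- The value of `q_* ı^* η` at `x` on the tangent vectors `v₁, …, v_n` is `c`, where `η` is a
differential form on `T^*M` (evaluated on tuples of tangent vectors). For an oriented basis `b` of
`E^0_x`, with fibre coordinates `ξ` given by `p(ξ) = ∑ ξ_j b_j`, the fibre integral is
`∫ η_{p(ξ)}(ṽ₁, …, ṽ_n, ∂/∂ξ₁, …, ∂/∂ξ_k) dξ₁ ⋯ dξ_k` (an absolutely convergent integral), where
`ṽ_i` is any lift of `v_i` to a vector tangent to `E^0` at `p(ξ)`. Thus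
`q_*(q^*β ∧ f dξ₁ ∧ ⋯ ∧ dξ_k) = β · ∫ f dξ`. -/
def IsFibreIntegral (o : (x : M) → Orientation ℝ (conormal E x) (Fin k))
    (η : (p : Cotangent EM M) → (m : ℕ) → (Fin m → TangentSpace (cotModel EM) p) → ℂ)
    (x : M) (n : ℕ) (v : Fin n → TangentSpace 𝓘(ℝ, EM) x) (c : ℂ) : Prop :=
  ∀ b : Fin k → (TangentSpace 𝓘(ℝ, EM) x →L[ℝ] ℝ), IsPositive o x b →
    ∀ lift : (ξ : Fin k → ℝ) → Fin n →
        TangentSpace (cotModel EM) (⟨x, ∑ j, ξ j • b j⟩ : Cotangent EM M),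
      (∀ ξ i, IsTangentToConormal E _ (lift ξ i) ∧
        mfderiv (cotModel EM) 𝓘(ℝ, EM) (fun q : Cotangent EM M => q.1) _ (lift ξ i) = v i) →
      Integrable (fun ξ => η ⟨x, ∑ j, ξ j • b j⟩ (n + k)
        (Fin.append (lift ξ) fun j => verticalVector _ (b j))) ∧
      ∫ ξ, η ⟨x, ∑ j, ξ j • b j⟩ (n + k)
        (Fin.append (lift ξ) fun j => verticalVector _ (b j)) = c

/-- `T` is the form `(2πi)^{-k} q_* ı^* e^{iDθ(X)}`, defined as an oscillatory integral: the pairing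
with a test function `φ` is `(2πi)^{-k} q_* ı^* (∫ e^{iDθ(X)} φ(X) dX)`. -/
def IsOscillatoryFibreIntegral (o : (x : M) → Orientation ℝ (conormal E x) (Fin k))
    (T : 𝓓((⊤ : TopologicalSpace.Opens EH), ℂ) →ₗ[ℂ] DiffForm 𝓘(ℝ, EM) M) : Prop :=
  ∀ (φ : 𝓓((⊤ : TopologicalSpace.Opens EH), ℂ)) (x : M) (n : ℕ)
    (v : Fin n → TangentSpace 𝓘(ℝ, EM) x),
    ∃ c : ℂ, IsFibreIntegral o (expPairing H μ φ) x n v c ∧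
      T φ x n v = ((2 * Real.pi * Complex.I) ^ k)⁻¹ * c

end FibreIntegral

end Main

end

/-! Over an oriented frame `α` of `E⁰` the conormal bundle has coordinates `(x, ξ)`, with `p = ∑ ξ_j
α_j`, and the canonical form restricts to `-∑ ξ_j α_j`. Hence `iDθ(X)` restricts to `-i ∑ ξ_j (dα_j
+ f_j(X)) - i ∑ dξ_j ∧ α_j`. Fibre integration keeps the part of its exponential containing every
`dξ_j`. That part contributes `i^k α_k ∧ ⋯ ∧ α_1` times `exp(-i ∑ ξ_j dα_j) exp(-i⟨ξ, f(X)⟩)`.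

Pairing with `φ` turns the last scalar into the Fourier transform `ĝ` of the density `g` of the
push-forward of `φ dX` under `f`. Fourier inversion gives `∫ (-iξ)^I ĝ(ξ) dξ = (2π)^k (-1)^{|I|} ∂^I
g(0)`, absolutely convergent because `ĝ` decays rapidly. Expanding `exp(-i ∑ ξ_j dα_j)` by the
multinomial theorem then yields the Taylor expansion of `δ₀(Dα(X))`, and the constant `(2πi)^k`
cancels the normalization.

Transversality enters only through `momentCLM_surjective`: it makes `f(x)` surjective. Push-forwards
of test functions then have smooth compactly supported densities that vary smoothly with the linear
map (`exists_pushforward_family`), and their derivatives at `0` depend continuously on the test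
function.

The conormal bundle is never given a manifold structure. Its tangent vectors are velocities of
curves, and `IsTangentToConormal.exists_snd_eq` computes their fibre component up to a combination
of the `α_j`, an ambiguity killed by `α_k ∧ ⋯ ∧ α_1`. The algebra is carried by
`GradedForm.expTrunc_append`, the analysis by `integral_moment_angularFourier`, and they meet in
`IsOrientedFrame.isFibreIntegral`.

The fibre integral mentions no frame. The same computation therefore shows that local forms of
different frames agree on overlaps, so gluing and comparison with the oscillatory integral are one
statement. Smoothness and equivariance are checked on the local forms, the latter by pulling a frame
back along the group action. -/

noncomputable section

/-! ### The algebra of inhomogeneous forms: Leibniz rule, associativity, graded commutativity. -/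

namespace GradedForm

/-- A permutation of `n + 1` letters factors uniquely as a permutation fixing `0` after the cycle
bringing position `j` to the front. The index `j` is the place where `X` lands, the cycle has sign
`(-1)^j`, and `e` arranges the other vectors. -/
theorem sum_perm_fin_succ {V : Type*} {n : ℕ} (G : (Fin (n + 1) → V) → ℂ) (X : V) (v : Fin n → V) :
    ∑ σ : Equiv.Perm (Fin (n + 1)), ((Equiv.Perm.sign σ : ℤ) : ℂ) *
        G ((Fin.cons X v : Fin (n + 1) → V) ∘ σ) =
      ∑ j : Fin (n + 1), ∑ e : Equiv.Perm (Fin n),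
        (-1) ^ (j : ℕ) * ((Equiv.Perm.sign e : ℤ) : ℂ) * G (Fin.insertNth j X (v ∘ e)) := by
  rw [← Fintype.sum_prod_type']
  symm
  let D : Equiv.Perm (Fin n) → Equiv.Perm (Fin (n + 1)) := fun e => Equiv.Perm.decomposeFin.symm (0, e)
  have hD0 : ∀ e, D e 0 = 0 := fun e => by simp [D]
  refine Fintype.sum_bijective (fun x : Fin (n + 1) × Equiv.Perm (Fin n) => D x.2 * x.1.cycleRange)
    ?_ _ _ fun x => ?_
  · rw [Fintype.bijective_iff_injective_and_card]
    constructor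
    · rintro ⟨j, e⟩ ⟨j', e'⟩ h
      have hj : j = j' := by
        have h1 := Equiv.congr_fun h j
        simp only [Equiv.Perm.mul_apply, Fin.cycleRange_self, hD0] at h1
        have h2 := (D e').injective (h1.symm.trans (hD0 e').symm |>.symm ▸ rfl : D e' 0 = D e' (j'.cycleRange j))
        have h3 : j'.cycleRange j' = j'.cycleRange j := by rw [Fin.cycleRange_self, ← h2]
        exact (j'.cycleRange.injective h3).symm
      subst hj
      have := mul_right_cancel h
      simpa [D] using this
    · simp [Fintype.card_perm, Nat.factorial_succ]
  · obtain ⟨j, e⟩ := x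
    simp only [Equiv.Perm.sign_mul, Fin.sign_cycleRange]
    have hs : Equiv.Perm.sign (D e) = Equiv.Perm.sign e := by simp [D]
    rw [hs]
    have : (Fin.cons X v : Fin (n + 1) → V) ∘ (D e * j.cycleRange) = Fin.insertNth j X (v ∘ e) := by
      symm
      rw [Fin.insertNth_eq_iff]
      constructor
      · simp [hD0]
      · ext i
        simp [Fin.removeNth, D, Equiv.Perm.decomposeFin]
    rw [this]
    push_cast
    ring

section Ring

variable {V : Type*} [AddCommGroup V] [Module ℝ V] [TopologicalSpace V]

/-- The extension of a finite sequence of vectors by zero. -/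
def extendZero {n : ℕ} (w : Fin n → V) (m : ℕ) : V := if h : m < n then w ⟨m, h⟩ else 0

/-- The product `a(w₁, …, w_p) b(w_{p+1}, …, w_{p+q})`. -/
def splitProd {n : ℕ} (a b : GradedForm V) (p q : ℕ) (w : Fin n → V) : ℂ :=
  a p (fun i => extendZero w i) * b q (fun i => extendZero w (p + i))

/-- Each shuffle class consists of `p! q!` permutations with equal signed contributions, so the
quotient defining `wedge` can be traded for a sum over all permutations. Reading arguments through
`extendZero` indexes them by natural numbers, which avoids casts between the `Fin` types of the
factors. -/
theorem wedge_apply {p q n : ℕ} (h : p + q = n) (a b : GradedForm V) (v : Fin n → V) :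
    wedge h (a p) (b q) v = ((p.factorial * q.factorial : ℕ) : ℂ)⁻¹ *
      ∑ σ : Equiv.Perm (Fin n), ((Equiv.Perm.sign σ : ℤ) : ℂ) * splitProd a b p q (v ∘ σ) := by
  subst h
  have h0 : ((p.factorial * q.factorial : ℕ) : ℂ) ≠ 0 :=
    Nat.cast_ne_zero.2 (Nat.mul_ne_zero p.factorial_ne_zero q.factorial_ne_zero)
  rw [eq_inv_mul_iff_mul_eq₀ h0]
  have key := congrArg (fun f => (LinearMap.mul' ℝ ℂ) (f (v ∘ finSumFinEquiv)))
    (MultilinearMap.domCoprod_alternization_eq (a p).toAlternatingMap (b q).toAlternatingMap)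
  have h1 : wedge rfl (a p) (b q) v = (LinearMap.mul' ℝ ℂ)
      (((a p).toAlternatingMap.domCoprod (b q).toAlternatingMap) (v ∘ finSumFinEquiv)) := rfl
  rw [h1]
  simp only [Fintype.card_fin, AlternatingMap.smul_apply] at key
  rw [map_nsmul, nsmul_eq_mul] at key
  rw [← key, MultilinearMap.alternatization_apply, map_sum]
  refine Fintype.sum_equiv (finSumFinEquiv.permCongr) _ _ fun σ => ?_
  rw [Equiv.Perm.sign_permCongr, Units.smul_def, map_zsmul, zsmul_eq_mul]
  congr 1
  simp only [MultilinearMap.domDomCongr_apply, MultilinearMap.domCoprod_apply,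
    LinearMap.mul'_apply, splitProd]
  congr 1
  · change (a p) _ = (a p) _
    congr 1; ext i
    have hi : (i : ℕ) < p + q := i.2.trans_le (Nat.le_add_right p q)
    have : finSumFinEquiv.symm (⟨i, hi⟩ : Fin (p + q)) = Sum.inl i := by
      rw [Equiv.symm_apply_eq]; rfl
    simp [extendZero, hi, this]
  · change (b q) _ = (b q) _
    congr 1; ext i
    have : finSumFinEquiv.symm (⟨p + i, by omega⟩ : Fin (p + q)) = Sum.inr i := by
      rw [Equiv.symm_apply_eq]; rfl
    simp [extendZero, this]

theorem mul_apply (a b : GradedForm V) (n : ℕ) (v : Fin n → V) :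
    mul a b n v = ∑ x ∈ Finset.HasAntidiagonal.antidiagonal n, ((x.1.factorial * x.2.factorial : ℕ) : ℂ)⁻¹ *
      ∑ σ : Equiv.Perm (Fin n), ((Equiv.Perm.sign σ : ℤ) : ℂ) * splitProd a b x.1 x.2 (v ∘ σ) := by
  rw [Finset.Nat.sum_antidiagonal_eq_sum_range_succ_mk, Finset.sum_range, mul,
    ContinuousAlternatingMap.sum_apply]
  exact Finset.sum_congr rfl fun p _ => wedge_apply _ a b v

/-- Interior multiplication of inhomogeneous forms. -/
def contract (X : V) (a : GradedForm V) : GradedForm V := fun n => interior1 X (a (n + 1))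

/-- The grading involution. -/
def involute (a : GradedForm V) : GradedForm V := fun n => ((-1 : ℂ) ^ n) • a n

theorem contract_apply (X : V) (a : GradedForm V) (n : ℕ) (v : Fin n → V) :
    contract X a n v = a (n + 1) (Fin.cons X v) := rfl

theorem involute_apply (a : GradedForm V) (n : ℕ) (v : Fin n → V) :
    involute a n v = (-1) ^ n * a n v := rfl

theorem ext_apply {a b : GradedForm V} (h : ∀ n v, a n v = b n v) : a = b :=
  funext fun n => ContinuousAlternatingMap.ext (h n)

omit [Module ℝ V] [TopologicalSpace V] in
theorem extendZero_insertNth {n : ℕ} (j : Fin (n + 1)) (X : V) (u : Fin n → V) (m : ℕ) :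
    extendZero (Fin.insertNth j X u : Fin (n + 1) → V) m =
      if m < j then extendZero u m else if m = j then X else extendZero u (m - 1) := by
  unfold extendZero
  by_cases hm : m < n + 1
  · rw [dif_pos hm]
    rcases lt_trichotomy m j with h | h | h
    · rw [if_pos h, dif_pos (by omega)]
      have : (⟨m, hm⟩ : Fin (n + 1)) = j.succAbove ⟨m, by omega⟩ := by
        rw [Fin.succAbove_of_castSucc_lt _ _ (by simpa [Fin.lt_def] using h)]; rfl
      rw [this, Fin.insertNth_apply_succAbove]
    · have : (⟨m, hm⟩ : Fin (n + 1)) = j := Fin.ext h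
      rw [if_neg (by omega), if_pos h, this, Fin.insertNth_apply_same]
    · rw [if_neg (by omega), if_neg (by omega), dif_pos (by omega)]
      have : (⟨m, hm⟩ : Fin (n + 1)) = j.succAbove ⟨m - 1, by omega⟩ := by
        rw [Fin.succAbove_of_le_castSucc _ _ (by simp [Fin.le_def]; omega)]
        ext; simp; omega
      rw [this, Fin.insertNth_apply_succAbove]
  · rw [dif_neg hm, if_neg (by omega), if_neg (by omega), dif_neg (by omega)]

omit [Module ℝ V] [TopologicalSpace V] in
theorem extendZero_insertNth_fin {n p s : ℕ} (j : Fin (n + 1)) (hs : s ≤ j)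
    (hj : (j : ℕ) - s < p + 1) (X : V) (u : Fin n → V) :
    (fun i : Fin (p + 1) => extendZero (Fin.insertNth j X u : Fin (n + 1) → V) (s + i)) =
      Fin.insertNth (⟨j - s, hj⟩ : Fin (p + 1)) X (fun i : Fin p => extendZero u (s + i)) := by
  rw [Fin.eq_insertNth_iff]
  refine ⟨?_, funext fun i => ?_⟩
  · rw [extendZero_insertNth, if_neg (by simp; omega), if_pos (by simp; omega)]
  · simp only [Fin.removeNth]
    rw [extendZero_insertNth]
    rcases lt_or_ge (i : ℕ) (j - s) with hi | hi
    · rw [Fin.succAbove_of_castSucc_lt _ _ (by simpa [Fin.lt_def] using hi)]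
      rw [if_pos (by simp; omega)]
      rfl
    · rw [Fin.succAbove_of_le_castSucc _ _ (by simpa [Fin.le_def] using hi)]
      rw [if_neg (by simp; omega), if_neg (by simp; omega)]
      congr 1

theorem splitProd_insertNth_left {n p q : ℕ} (h : p + 1 + q = n + 1) (a b : GradedForm V)
    (j : Fin (n + 1)) (hj : (j : ℕ) < p + 1) (X : V) (u : Fin n → V) :
    splitProd a b (p + 1) q (Fin.insertNth j X u : Fin (n + 1) → V) =
      (-1) ^ (j : ℕ) * splitProd (contract X a) b p q u := by
  have h1 := extendZero_insertNth_fin (s := 0) (p := p) j (Nat.zero_le _) hj X u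
  have h2 : (fun i : Fin q => extendZero (Fin.insertNth j X u : Fin (n + 1) → V) (p + 1 + i)) =
      (fun i : Fin q => extendZero u (p + i)) := by
    funext i
    rw [extendZero_insertNth, if_neg (by omega), if_neg (by omega)]
    congr 1; omega
  simp only [Nat.sub_zero, zero_add] at h1
  rw [splitProd, h1, h2, splitProd]
  have := (a (p + 1)).toAlternatingMap.map_insertNth ⟨j, hj⟩ X (fun i : Fin p => extendZero u i)
  change a (p + 1) _ = _ at this
  rw [this, contract_apply, zsmul_eq_mul, mul_assoc]
  push_cast
  rfl

theorem splitProd_insertNth_right {n p q : ℕ} (h : p + (q + 1) = n + 1) (a b : GradedForm V)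
    (j : Fin (n + 1)) (hj : p ≤ (j : ℕ)) (X : V) (u : Fin n → V) :
    splitProd a b p (q + 1) (Fin.insertNth j X u : Fin (n + 1) → V) =
      (-1) ^ (j - p : ℕ) * splitProd a (contract X b) p q u := by
  have hj' : (j : ℕ) - p < q + 1 := by omega
  have h1 := extendZero_insertNth_fin (s := p) (p := q) j hj hj' X u
  have h2 : (fun i : Fin p => extendZero (Fin.insertNth j X u : Fin (n + 1) → V) i) =
      (fun i : Fin p => extendZero u i) := by
    funext i
    rw [extendZero_insertNth, if_pos (by omega)]
  rw [splitProd, h1, h2, splitProd]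
  have := (b (q + 1)).toAlternatingMap.map_insertNth ⟨j - p, hj'⟩ X
    (fun i : Fin q => extendZero u (p + i))
  change b (q + 1) _ = _ at this
  rw [this, contract_apply, zsmul_eq_mul]
  push_cast
  rw [mul_left_comm]
  rfl

/-- Split by the position `j` of `X`. For `j < p` it enters `a`, and moving it to the front cancels
the sign `(-1)^j`. Otherwise it enters `b` at place `j - p`, and `(-1)^p` survives. There are `p`
and `q` such positions. The truncated `p - 1` and `q - 1` are harmless, since the coefficient
vanishes when the subtraction truncates. -/
theorem sum_perm_splitProd_cons {n p q : ℕ} (h : p + q = n + 1) (a b : GradedForm V) (X : V)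
    (v : Fin n → V) :
    ∑ σ : Equiv.Perm (Fin (n + 1)), ((Equiv.Perm.sign σ : ℤ) : ℂ) *
        splitProd a b p q ((Fin.cons X v : Fin (n + 1) → V) ∘ σ) =
      p * ∑ e : Equiv.Perm (Fin n), ((Equiv.Perm.sign e : ℤ) : ℂ) *
        splitProd (contract X a) b (p - 1) q (v ∘ e) +
      (-1) ^ p * q * ∑ e : Equiv.Perm (Fin n), ((Equiv.Perm.sign e : ℤ) : ℂ) *
        splitProd a (contract X b) p (q - 1) (v ∘ e) := by
  rw [sum_perm_fin_succ]
  have key : ∀ j : Fin (n + 1), ∑ e : Equiv.Perm (Fin n),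
      (-1) ^ (j : ℕ) * ((Equiv.Perm.sign e : ℤ) : ℂ) *
        splitProd a b p q (Fin.insertNth j X (v ∘ e) : Fin (n + 1) → V) =
      if (j : ℕ) < p then ∑ e : Equiv.Perm (Fin n), ((Equiv.Perm.sign e : ℤ) : ℂ) *
        splitProd (contract X a) b (p - 1) q (v ∘ e)
      else (-1) ^ p * ∑ e : Equiv.Perm (Fin n), ((Equiv.Perm.sign e : ℤ) : ℂ) *
        splitProd a (contract X b) p (q - 1) (v ∘ e) := by
    intro j
    split_ifs with hj
    · obtain ⟨p, rfl⟩ : ∃ p', p = p' + 1 := ⟨p - 1, by omega⟩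
      refine Finset.sum_congr rfl fun e _ => ?_
      rw [splitProd_insertNth_left h a b j hj]
      have : ((-1 : ℂ) ^ (j : ℕ)) * (-1) ^ (j : ℕ) = 1 := by rw [← mul_pow]; simp
      simp only [Nat.add_sub_cancel]
      linear_combination (((Equiv.Perm.sign e : ℤ) : ℂ) *
        splitProd (contract X a) b p q (v ∘ e)) * this
    · obtain ⟨q, rfl⟩ : ∃ q', q = q' + 1 := ⟨q - 1, by omega⟩
      rw [Finset.mul_sum]
      refine Finset.sum_congr rfl fun e _ => ?_
      rw [splitProd_insertNth_right h a b j (not_lt.1 hj)]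
      have : ((-1 : ℂ) ^ (j : ℕ)) * (-1) ^ (j - p : ℕ) = (-1) ^ p := by
        obtain ⟨d, hd⟩ := Nat.exists_eq_add_of_le (not_lt.1 hj)
        rw [hd, Nat.add_sub_cancel_left, pow_add, mul_assoc, ← mul_pow]; simp
      simp only [Nat.add_sub_cancel]
      linear_combination (((Equiv.Perm.sign e : ℤ) : ℂ) *
        splitProd a (contract X b) p q (v ∘ e)) * this
  rw [Finset.sum_congr rfl fun j _ => key j, Fin.sum_univ_eq_sum_range (fun j => if j < p then _ else _),
    ← h, Finset.sum_range_add, Finset.sum_congr rfl fun j hj => if_pos (Finset.mem_range.1 hj),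
    Finset.sum_congr rfl fun j _ => if_neg (by omega : ¬ p + j < p)]
  simp
  ring

/-- The graded Leibniz rule: the counts `p` and `q` of `sum_perm_splitProd_cons` lower one factorial
in `1/(p! q!)`, after which the sum over bidegrees is reindexed. The algebraic identities below are
deduced from this rule by induction on the degree. -/
theorem contract_mul (X : V) (a b : GradedForm V) :
    contract X (mul a b) = mul (contract X a) b + mul (involute a) (contract X b) := by
  refine ext_apply fun n v => ?_
  rw [contract_apply, mul_apply]
  change _ = mul (contract X a) b n v + mul (involute a) (contract X b) n v
  rw [mul_apply, mul_apply]
  have h1 : ∀ x ∈ Finset.HasAntidiagonal.antidiagonal (n + 1),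
      ((x.1.factorial * x.2.factorial : ℕ) : ℂ)⁻¹ *
      ∑ σ : Equiv.Perm (Fin (n + 1)), ((Equiv.Perm.sign σ : ℤ) : ℂ) *
        splitProd a b x.1 x.2 ((Fin.cons X v : Fin (n + 1) → V) ∘ σ) =
      ((x.1.factorial * x.2.factorial : ℕ) : ℂ)⁻¹ *
        (x.1 * ∑ e : Equiv.Perm (Fin n), ((Equiv.Perm.sign e : ℤ) : ℂ) *
        splitProd (contract X a) b (x.1 - 1) x.2 (v ∘ e)) +
      ((x.1.factorial * x.2.factorial : ℕ) : ℂ)⁻¹ *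
        ((-1) ^ x.1 * x.2 * ∑ e : Equiv.Perm (Fin n), ((Equiv.Perm.sign e : ℤ) : ℂ) *
        splitProd a (contract X b) x.1 (x.2 - 1) (v ∘ e)) := fun x hx => by
    rw [sum_perm_splitProd_cons (by simpa using hx), mul_add]
  rw [Finset.sum_congr rfl h1, Finset.sum_add_distrib]
  congr 1
  · rw [Finset.Nat.sum_antidiagonal_succ]
    simp only [Nat.cast_zero, zero_mul, mul_zero, zero_add]
    refine Finset.sum_congr rfl fun x _ => ?_
    rw [← mul_assoc]
    congr 1
    have := Nat.cast_ne_zero (R := ℂ).2 x.1.factorial_ne_zero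
    have := Nat.cast_ne_zero (R := ℂ).2 x.2.factorial_ne_zero
    have : (x.1 : ℂ) + 1 ≠ 0 := by exact_mod_cast x.1.succ_ne_zero
    simp only [Nat.factorial_succ]
    push_cast
    field_simp
  · rw [Finset.Nat.sum_antidiagonal_succ']
    simp only [Nat.cast_zero, zero_mul, mul_zero, zero_add]
    refine Finset.sum_congr rfl fun x _ => ?_
    have hs : ∀ w : Fin n → V, splitProd (involute a) (contract X b) x.1 x.2 w =
        (-1) ^ x.1 * splitProd a (contract X b) x.1 x.2 w := fun w => by
      rw [splitProd, splitProd, involute_apply, mul_assoc]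
    simp only [hs, Finset.mul_sum, Nat.add_sub_cancel]
    refine Finset.sum_congr rfl fun e _ => ?_
    have := Nat.cast_ne_zero (R := ℂ).2 x.1.factorial_ne_zero
    have := Nat.cast_ne_zero (R := ℂ).2 x.2.factorial_ne_zero
    have : (x.2 : ℂ) + 1 ≠ 0 := by exact_mod_cast x.2.succ_ne_zero
    simp only [Nat.factorial_succ]
    push_cast
    field_simp

theorem mul_zero_apply (a b : GradedForm V) (v : Fin 0 → V) : mul a b 0 v = a 0 v * b 0 v := by
  rw [mul_apply]
  simp only [Finset.Nat.antidiagonal_zero, Finset.sum_singleton, Fintype.sum_unique, splitProd]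
  rw [Subsingleton.elim (fun i : Fin 0 => _) v, Subsingleton.elim (fun i : Fin 0 => _) v]
  simp

/-- The inductive principle for identities between forms: with the Leibniz rule, an identity in
degree `n + 1` reduces to identities of the same kind in degree `n` for the contracted factors. -/
theorem eq_of_contract {a b : GradedForm V} {n : ℕ}
    (h : ∀ X, contract X a n = contract X b n) : a (n + 1) = b (n + 1) := by
  ext v
  have := DFunLike.congr_fun (h (v 0)) (Fin.tail v)
  rwa [contract_apply, contract_apply, Fin.cons_self_tail] at this

theorem splitProd_add_left {n : ℕ} (a a' b : GradedForm V) (p q : ℕ) (w : Fin n → V) :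
    splitProd (a + a') b p q w = splitProd a b p q w + splitProd a' b p q w :=
  add_mul _ _ _

theorem splitProd_add_right {n : ℕ} (a b b' : GradedForm V) (p q : ℕ) (w : Fin n → V) :
    splitProd a (b + b') p q w = splitProd a b p q w + splitProd a b' p q w :=
  mul_add _ _ _

theorem splitProd_smul_left {n : ℕ} (c : ℂ) (a b : GradedForm V) (p q : ℕ) (w : Fin n → V) :
    splitProd (c • a) b p q w = c * splitProd a b p q w :=
  mul_assoc _ _ _

theorem splitProd_smul_right {n : ℕ} (c : ℂ) (a b : GradedForm V) (p q : ℕ) (w : Fin n → V) :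
    splitProd a (c • b) p q w = c * splitProd a b p q w :=
  mul_left_comm _ _ _

theorem mul_add_left (a a' b : GradedForm V) : mul (a + a') b = mul a b + mul a' b := by
  refine ext_apply fun n v => ?_
  change _ = mul a b n v + mul a' b n v
  simp only [mul_apply, splitProd_add_left, mul_add, Finset.sum_add_distrib]

theorem mul_add_right (a b b' : GradedForm V) : mul a (b + b') = mul a b + mul a b' := by
  refine ext_apply fun n v => ?_
  change _ = mul a b n v + mul a b' n v
  simp only [mul_apply, splitProd_add_right, mul_add, Finset.sum_add_distrib]

theorem mul_smul_left (c : ℂ) (a b : GradedForm V) : mul (c • a) b = c • mul a b := by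
  refine ext_apply fun n v => ?_
  change _ = c * mul a b n v
  simp only [mul_apply, splitProd_smul_left, Finset.mul_sum]
  refine Finset.sum_congr rfl fun _ _ => Finset.sum_congr rfl fun _ _ => by ring

theorem mul_smul_right (c : ℂ) (a b : GradedForm V) : mul a (c • b) = c • mul a b := by
  refine ext_apply fun n v => ?_
  change _ = c * mul a b n v
  simp only [mul_apply, splitProd_smul_right, Finset.mul_sum]
  refine Finset.sum_congr rfl fun _ _ => Finset.sum_congr rfl fun _ _ => by ring

theorem mul_zero_left (b : GradedForm V) : mul 0 b = 0 := by
  refine ext_apply fun n v => ?_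
  have h : ∀ p q (w : Fin n → V), splitProd 0 b p q w = 0 := fun _ _ _ => zero_mul _
  simp [mul_apply, h]

theorem mul_zero_right (a : GradedForm V) : mul a 0 = 0 := by
  refine ext_apply fun n v => ?_
  have h : ∀ p q (w : Fin n → V), splitProd a 0 p q w = 0 := fun _ _ _ => mul_zero _
  simp [mul_apply, h]

theorem involute_mul (a b : GradedForm V) :
    involute (mul a b) = mul (involute a) (involute b) := by
  refine ext_apply fun n v => ?_
  rw [involute_apply, mul_apply, mul_apply, Finset.mul_sum]
  refine Finset.sum_congr rfl fun x hx => ?_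
  have hn : x.1 + x.2 = n := by simpa using hx
  have hs : ∀ w : Fin n → V, splitProd (involute a) (involute b) x.1 x.2 w =
      (-1) ^ n * splitProd a b x.1 x.2 w := fun w => by
    have hp : (-1 : ℂ) ^ n = (-1) ^ x.1 * (-1) ^ x.2 := by rw [← hn, pow_add]
    rw [splitProd, splitProd, involute_apply, involute_apply, hp]; ring
  simp only [hs, Finset.mul_sum]
  refine Finset.sum_congr rfl fun _ _ => by ring

theorem involute_add (a b : GradedForm V) : involute (a + b) = involute a + involute b :=
  ext_apply fun n v => mul_add _ (a n v) (b n v)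

/-- The grading involution, as a linear map. -/
def involuteLinear : GradedForm V →ₗ[ℂ] GradedForm V where
  toFun := involute
  map_add' := involute_add
  map_smul' c a := ext_apply fun n v => mul_left_comm _ c (a n v)

theorem involute_involute (a : GradedForm V) : involute (involute a) = a :=
  ext_apply fun n v => by rw [involute_apply, involute_apply, ← mul_assoc, ← mul_pow]; simp

theorem contract_add (X : V) (a b : GradedForm V) :
    contract X (a + b) = contract X a + contract X b := rfl

theorem contract_involute (X : V) (a : GradedForm V) :
    contract X (involute a) = -involute (contract X a) := by
  refine ext_apply fun n v => ?_
  change _ = -(involute (contract X a) n v)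
  rw [contract_apply, involute_apply, involute_apply, contract_apply, pow_succ]; ring

theorem mul_assoc_form (a b c : GradedForm V) : mul (mul a b) c = mul a (mul b c) := by
  funext n
  induction n generalizing a b c with
  | zero => ext v; simp only [mul_zero_apply]; ring
  | succ n ih =>
    refine eq_of_contract fun X => ?_
    simp only [contract_mul, involute_mul, mul_add_left, mul_add_right, Pi.add_apply, ih]
    rw [add_assoc]

theorem one_mul_form (a : GradedForm V) : mul one a = a := by
  funext n
  induction n generalizing a with
  | zero =>
    ext v
    rw [mul_zero_apply]
    change 1 * _ = _
    rw [one_mul]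
  | succ n ih =>
    refine eq_of_contract fun X => ?_
    have h1 : contract X (one : GradedForm V) = 0 := rfl
    have h2 : involute (one : GradedForm V) = one := by
      refine ext_apply fun n v => ?_
      rw [involute_apply]
      cases n with
      | zero => simp
      | succ n => change _ * (0 : ℂ) = 0; simp
    rw [contract_mul, h1, h2, mul_zero_left, zero_add, ih]

theorem mul_one_form (a : GradedForm V) : mul a one = a := by
  funext n
  induction n generalizing a with
  | zero =>
    ext v
    rw [mul_zero_apply]
    change _ * 1 = _
    rw [mul_one]
  | succ n ih =>
    refine eq_of_contract fun X => ?_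
    have h1 : contract X (one : GradedForm V) = 0 := rfl
    rw [contract_mul, h1, mul_zero_right, add_zero, ih]

instance instRing : Ring (GradedForm V) where
  __ := (inferInstance : AddCommGroup (GradedForm V))
  mul := mul
  one := one
  left_distrib := mul_add_right
  right_distrib := mul_add_left
  zero_mul := mul_zero_left
  mul_zero := mul_zero_right
  mul_assoc := mul_assoc_form
  one_mul := one_mul_form
  mul_one := mul_one_form

instance instAlgebra : Algebra ℂ (GradedForm V) := Algebra.ofModule mul_smul_left mul_smul_right

theorem mul_eq (a b : GradedForm V) : mul a b = a * b := rfl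

theorem one_eq : (one : GradedForm V) = 1 := rfl

theorem listProd_eq (l : List (GradedForm V)) : listProd l = l.prod := rfl

theorem pow_eq (a : GradedForm V) (m : ℕ) : pow a m = a ^ m := by
  rw [pow, listProd_eq, List.prod_replicate]

/-- Even forms are central, and odd ones commute up to the grading involution. The two cases are
proved together because contracting `a` exchanges its parity. -/
theorem involute_comm_aux (n : ℕ) (a b : GradedForm V) :
    (involute a = a → (a * b) n = (b * a) n) ∧
      (involute a = -a → (a * b) n = (involute b * a) n) := by
  induction n generalizing a b with
  | zero =>
    have hi : involute b 0 = b 0 := by ext v; rw [involute_apply]; simp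
    refine ⟨fun _ => ?_, fun _ => ?_⟩ <;> ext v <;>
      simp only [← mul_eq, mul_zero_apply, hi, mul_comm]
  | succ n ih =>
    have hodd : ∀ X, involute a = a → involute (contract X a) = -contract X a := fun X h => by
      rw [← neg_eq_iff_eq_neg, ← contract_involute, h]
    have heven : ∀ X, involute a = -a → involute (contract X a) = contract X a := fun X h => by
      rw [← neg_inj, ← contract_involute, h]; rfl
    refine ⟨fun h => eq_of_contract fun X => ?_, fun h => eq_of_contract fun X => ?_⟩
    · rw [← mul_eq, ← mul_eq, contract_mul, contract_mul, h]
      simp only [mul_eq, Pi.add_apply]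
      rw [(ih _ _).2 (hodd X h), (ih _ _).1 h, add_comm]
    · rw [← mul_eq, ← mul_eq, contract_mul, contract_mul, h, involute_involute, contract_involute]
      simp only [mul_eq, Pi.add_apply]
      rw [(ih _ _).1 (heven X h), neg_mul, Pi.neg_apply, (ih _ _).2 h, neg_mul, Pi.neg_apply,
        add_comm]

theorem commute_of_even {a : GradedForm V} (h : involute a = a) (b : GradedForm V) :
    Commute a b := funext fun n => (involute_comm_aux n a b).1 h

theorem mul_eq_involute_mul {a : GradedForm V} (h : involute a = -a) (b : GradedForm V) :
    a * b = involute b * a := funext fun n => (involute_comm_aux n a b).2 h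

theorem homog_of_ne {m n : ℕ} (h : n ≠ m) (a : V [⋀^Fin m]→L[ℝ] ℂ) : homog m a n = 0 :=
  Pi.single_eq_of_ne (M := fun n => V [⋀^Fin n]→L[ℝ] ℂ) h a

theorem homog_self {m : ℕ} (a : V [⋀^Fin m]→L[ℝ] ℂ) : homog m a m = a :=
  Pi.single_eq_same (M := fun n => V [⋀^Fin n]→L[ℝ] ℂ) m a

theorem involute_homog_even {m : ℕ} (hm : Even m) (a : V [⋀^Fin m]→L[ℝ] ℂ) :
    involute (homog m a) = homog m a := by
  refine ext_apply fun n v => ?_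
  rw [involute_apply]
  by_cases h : n = m
  · subst h; rw [hm.neg_one_pow, one_mul]
  · rw [homog_of_ne h]; simp

theorem involute_homog_odd {m : ℕ} (hm : Odd m) (a : V [⋀^Fin m]→L[ℝ] ℂ) :
    involute (homog m a) = -homog m a := by
  refine ext_apply fun n v => ?_
  rw [involute_apply]
  change _ = -(homog m a n v)
  by_cases h : n = m
  · subst h; rw [hm.neg_one_pow, neg_one_mul]
  · rw [homog_of_ne h]; simp

/-- Contraction in the last argument. -/
def contractRight (X : V) : GradedForm V →ₗ[ℂ] GradedForm V where
  toFun a := involute (contract X a)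
  map_add' a b := by rw [contract_add, involute_add]
  map_smul' c a := ext_apply fun n v => mul_left_comm _ c (contract X a n v)

/-- Contraction in the last slot puts the sign of the Leibniz rule on the second factor, where it
disappears if that factor is even. It is the convenient contraction here because the fibre vectors
stand after the lifted ones in the fibre integral. -/
theorem contractRight_mul (X : V) (a b : GradedForm V) :
    contractRight X (a * b) = contractRight X a * involute b + a * contractRight X b := by
  change involute (contract X (mul a b)) = _
  rw [contract_mul, involute_add, involute_mul, involute_mul, involute_involute]
  rfl

/-- Moving `X` from the first to the last place across `n` arguments costs `(-1)^n`, which is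
exactly what the grading involution supplies. -/
theorem contractRight_apply (X : V) (a : GradedForm V) (n : ℕ) (v : Fin n → V) :
    contractRight X a n v = a (n + 1) (Fin.snoc v X : Fin (n + 1) → V) := by
  change involute (contract X a) n v = _
  rw [involute_apply, contract_apply]
  have := (a (n + 1)).toAlternatingMap.map_insertNth (Fin.last n) X v
  rw [Fin.insertNth_last'] at this
  change a (n + 1) _ = _ at this
  rw [this, zsmul_eq_mul]
  push_cast
  rfl

end Ring
end GradedForm

/-! ### Pull-back, nilpotence, and exponentials of forms. -/

namespace GradedForm

section Pullback

variable {V W : Type*} [AddCommGroup V] [Module ℝ V] [TopologicalSpace V]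
  [AddCommGroup W] [Module ℝ W] [TopologicalSpace W]

theorem mul_pullback (T : W →L[ℝ] V) (a b : GradedForm V) :
    (fun n => ((a * b) n).compContinuousLinearMap T : GradedForm W) =
      (fun n => (a n).compContinuousLinearMap T : GradedForm W) *
        (fun n => (b n).compContinuousLinearMap T : GradedForm W) := by
  refine ext_apply fun n v => ?_
  change mul a b n (T ∘ v) = mul _ _ n v
  have hz : ∀ (w : Fin n → W) (m : ℕ), extendZero (T ∘ w) m = T (extendZero w m) := fun w m => by
    unfold extendZero; split_ifs <;> simp
  simp only [mul_apply]
  refine Finset.sum_congr rfl fun x _ => ?_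
  congr 1
  refine Finset.sum_congr rfl fun σ _ => ?_
  congr 1
  simp only [splitProd, Function.comp_assoc, hz]
  rfl

/-- Pull-back of inhomogeneous forms under a linear map. -/
def pullback (T : W →L[ℝ] V) : GradedForm V →ₐ[ℂ] GradedForm W :=
  AlgHom.ofLinearMap
    { toFun := fun a n => (a n).compContinuousLinearMap T
      map_add' := fun _ _ => rfl
      map_smul' := fun _ _ => rfl }
    (by
      refine ext_apply fun n v => ?_
      change one n _ = one n v
      cases n with
      | zero => rfl
      | succ n => rfl)
    (mul_pullback T)

theorem pullback_apply (T : W →L[ℝ] V) (a : GradedForm V) (n : ℕ) :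
    pullback T a n = (a n).compContinuousLinearMap T := rfl

theorem pullback_homog (T : W →L[ℝ] V) (m : ℕ) (a : V [⋀^Fin m]→L[ℝ] ℂ) :
    pullback T (homog m a) = homog m (a.compContinuousLinearMap T) := by
  funext n
  rw [pullback_apply]
  by_cases h : n = m
  · subst h; rw [homog_self, homog_self]
  · rw [homog_of_ne h, homog_of_ne h]; rfl

theorem pullback_involute (T : W →L[ℝ] V) (a : GradedForm V) :
    pullback T (involute a) = involute (pullback T a) := rfl

end Pullback

section Order

variable {V : Type*} [AddCommGroup V] [Module ℝ V] [TopologicalSpace V]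

theorem mul_eq_zero_of_lt {a b : GradedForm V} {r s : ℕ} (ha : ∀ m < r, a m = 0)
    (hb : ∀ m < s, b m = 0) : ∀ m < r + s, (a * b) m = 0 := fun m hm => by
  ext v
  rw [← mul_eq, mul_apply]
  refine Finset.sum_eq_zero fun x hx => ?_
  have hx : x.1 + x.2 = m := by simpa using hx
  have : ∀ w : Fin m → V, splitProd a b x.1 x.2 w = 0 := fun w => by
    unfold splitProd
    rcases lt_or_ge x.1 r with h | h
    · rw [ha _ h]; simp
    · rw [hb _ (by omega : x.2 < s)]; simp
  simp [this]

theorem pow_eq_zero_of_lt {a : GradedForm V} (ha : a 0 = 0) (m : ℕ) :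
    ∀ r < m, (a ^ m) r = 0 := by
  induction m with
  | zero => exact fun r hr => absurd hr (Nat.not_lt_zero r)
  | succ m ih =>
    rw [pow_succ]
    exact mul_eq_zero_of_lt ih (s := 1) fun r hr => by rwa [Nat.lt_one_iff.1 hr]

theorem eq_zero_of_finrank_lt [Module.Finite ℝ V] {n : ℕ} (h : Module.finrank ℝ V < n)
    (a : V [⋀^Fin n]→L[ℝ] ℂ) : a = 0 := by
  ext v
  refine a.toAlternatingMap.map_linearDependent v fun hv => ?_
  have := hv.fintype_card_le_finrank
  rw [Fintype.card_fin] at this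
  omega

/-- Without a degree zero part, the `m`-th power starts in degree `m`, above the dimension.
Truncated exponentials of such forms therefore do not depend on the truncation order once it reaches
the dimension. -/
theorem pow_eq_zero_of_finrank_lt [Module.Finite ℝ V] {a : GradedForm V} (ha : a 0 = 0) {m : ℕ}
    (h : Module.finrank ℝ V < m) : a ^ m = 0 := by
  funext r
  rcases lt_or_ge r m with hr | hr
  · exact pow_eq_zero_of_lt ha m r hr
  · exact eq_zero_of_finrank_lt (h.trans_le hr) _

end Order

section Exp

variable {V : Type*} [AddCommGroup V] [Module ℝ V] [TopologicalSpace V]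

/-- The truncated exponential series. -/
def expTrunc (N : ℕ) (a : GradedForm V) : GradedForm V :=
  ∑ m ∈ Finset.range (N + 1), ((m.factorial : ℂ)⁻¹) • a ^ m

theorem contractRight_pow_succ {a : GradedForm V} (ha : involute a = a) (X : V) (m : ℕ) :
    contractRight X (a ^ (m + 1)) = ((m : ℂ) + 1) • (contractRight X a * a ^ m) := by
  induction m with
  | zero => simp
  | succ m ih =>
    rw [pow_succ, contractRight_mul, ih, ha, smul_mul_assoc, mul_assoc, ← pow_succ,
      ((commute_of_even ha (contractRight X a)).pow_left (m + 1)).eq]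
    push_cast
    rw [add_smul ((m : ℂ) + 1) 1, one_smul]

/-- The chain rule for the exponential: an even `a` commutes with its contraction, so contracting
`a^{m+1}/(m+1)!` gives the contraction of `a` times `a^m/m!`. The truncation order drops by one. -/
theorem contractRight_expTrunc {a : GradedForm V} (ha : involute a = a) (X : V) (N : ℕ) :
    contractRight X (expTrunc (N + 1) a) = contractRight X a * expTrunc N a := by
  have h1 : contractRight X (1 : GradedForm V) = 0 := by
    rw [← one_eq]
    change involute (0 : GradedForm V) = 0
    refine ext_apply fun n v => mul_zero _
  rw [expTrunc, expTrunc, Finset.sum_range_succ', map_add, map_sum, Finset.mul_sum]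
  simp only [map_smul, pow_zero, h1, smul_zero, add_zero]
  refine Finset.sum_congr rfl fun m _ => ?_
  rw [contractRight_pow_succ ha, smul_smul, mul_smul_comm]
  congr 1
  have := Nat.cast_ne_zero (R := ℂ).2 m.factorial_ne_zero
  have : (m : ℂ) + 1 ≠ 0 := by exact_mod_cast m.succ_ne_zero
  rw [Nat.factorial_succ]
  push_cast
  field_simp

/-- The vectors `w` are removed from the last place one at a time. Each removal differentiates the
exponential and leaves a factor `contractRight (w j) a`, which later contractions do not see since
double contractions of `a` vanish. The last vector goes first, whence the reversed order of the
product. The form `P` collects the factors already produced. -/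
theorem mul_expTrunc_append {a : GradedForm V} (ha : involute a = a) {n k : ℕ} (v : Fin n → V)
    (w : Fin k → V) (hw : ∀ i j, contractRight (w i) (contractRight (w j) a) = 0) (N : ℕ)
    (P : GradedForm V) (hP : ∀ i, contractRight (w i) P = 0) :
    (P * expTrunc (N + k) a) (n + k) (Fin.append v w) =
      (P * (List.ofFn fun j => contractRight (w j.rev) a).prod * expTrunc N a) n v := by
  induction k generalizing P with
  | zero =>
    have : Fin.append v w = v := by
      ext i; simpa using Fin.append_left v w i
    rw [this]; simp
  | succ k ih =>
    have hs : (Fin.append v w : Fin (n + (k + 1)) → V) =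
        Fin.snoc (α := fun _ => V) (Fin.append v (Fin.init w)) (w (Fin.last k)) := by
      have := Fin.append_snoc v (Fin.init w) (w (Fin.last k))
      rw [Fin.snoc_init_self] at this
      exact this
    have h1 : (P * expTrunc (N + (k + 1)) a) (n + (k + 1)) (Fin.append v w) =
      contractRight (w (Fin.last k)) (P * expTrunc (N + k + 1) a) (n + k)
        (Fin.append v (Fin.init w)) := by
      rw [contractRight_apply, ← hs]; rfl
    rw [h1, contractRight_mul, hP, zero_mul, zero_add, contractRight_expTrunc ha, ← mul_assoc,
      ih (Fin.init w) (fun i j => hw i.castSucc j.castSucc), List.ofFn_succ, List.prod_cons]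
    · simp only [Fin.rev_zero, Fin.rev_succ, mul_assoc]
      rfl
    · intro i
      rw [contractRight_mul]
      change contractRight (w i.castSucc) P * _ + P * contractRight (w i.castSucc) _ = 0
      rw [hP, hw]; simp

theorem mul_self_of_odd {b : GradedForm V} (hb : involute b = -b) : b * b = 0 := by
  have h := mul_eq_involute_mul hb b
  rw [hb, neg_mul] at h
  have h2 : (2 : ℂ) • (b * b) = 0 := by
    rw [two_smul]; nth_rewrite 1 [h]; exact neg_add_cancel _
  exact (smul_eq_zero.1 h2).resolve_left two_ne_zero

theorem mul_prod_eq_zero {b : GradedForm V} {l : List (GradedForm V)}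
    (hl : ∀ c ∈ l, involute c = -c) (hb : b ∈ l) : b * l.prod = 0 := by
  induction l with
  | nil => simp at hb
  | cons c l ih =>
    rw [List.prod_cons, ← mul_assoc]
    by_cases h : b = c
    · subst h
      rw [mul_self_of_odd (hl b hb), zero_mul]
    · have hb' : b ∈ l := by simpa [h] using hb
      rw [mul_eq_involute_mul (hl b hb), hl c (by simp), mul_assoc,
        ih (fun c hc => hl c (by simp [hc])) hb', mul_zero]

/-- Each `c j * B j` is even and is killed by the product of all the odd `B j`, so after
multiplication by that product `a` may be replaced by `η`. This is why the choice of lifts to the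
conormal bundle does not matter. -/
theorem prod_mul_expTrunc {k : ℕ} (B c : Fin k → GradedForm V)
    (hB : ∀ j, involute (B j) = -B j) (hc : ∀ j, involute (c j) = -c j) {a η : GradedForm V}
    (hη : involute η = η) (ha : a = η + ∑ j, c j * B j) (N : ℕ) :
    (List.ofFn fun j : Fin k => B j.rev).prod * expTrunc N a =
      (List.ofFn fun j : Fin k => B j.rev).prod * expTrunc N η := by
  set P := (List.ofFn fun j : Fin k => B j.rev).prod with hP
  have h0 : P * ∑ j, c j * B j = 0 := by
    rw [Finset.mul_sum]
    refine Finset.sum_eq_zero fun j _ => ?_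
    have he : involute (c j * B j) = c j * B j := by
      rw [← mul_eq, involute_mul, hc, hB, mul_eq, neg_mul_neg, mul_eq]
    rw [← (commute_of_even he P).eq, mul_assoc, mul_prod_eq_zero, mul_zero]
    · intro x hx
      obtain ⟨i, rfl⟩ := List.mem_ofFn.1 hx
      exact hB _
    · exact List.mem_ofFn.2 ⟨j.rev, by simp⟩
  have h1 : P * a = η * P := by
    rw [ha, mul_add, h0, add_zero, (commute_of_even hη P).eq]
  have h2 : ∀ m, P * a ^ m = P * η ^ m := fun m => by
    induction m with
    | zero => simp
    | succ m ih => rw [pow_succ', ← mul_assoc, h1, mul_assoc, ih, ← mul_assoc,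
        (commute_of_even hη P).eq, mul_assoc, ← pow_succ']
  simp only [expTrunc, Finset.mul_sum, mul_smul_comm, h2]

theorem _root_.List.prod_ofFn_smul {A : Type*} [Ring A] [Algebra ℂ A] {k : ℕ} (t : ℂ)
    (f : Fin k → A) : (List.ofFn fun j => t • f j).prod = t ^ k • (List.ofFn f).prod := by
  induction k with
  | zero => simp
  | succ k ih =>
    rw [List.ofFn_succ, List.prod_cons, List.ofFn_succ, List.prod_cons, ih (fun j => f j.succ),
      smul_mul_smul_comm, pow_succ']

theorem _root_.inv_factorial_smul_sum_pow {A : Type*} [CommRing A] [Algebra ℂ A] {k : ℕ}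
    (z : Fin k → ℂ) (D : Fin k → A) (m : ℕ) :
    ((m.factorial : ℂ)⁻¹) • (∑ j, z j • D j) ^ m =
      ∑ i ∈ Finset.piAntidiag (Finset.univ : Finset (Fin k)) m,
        ((∏ j, z j ^ i j) / ((∏ j, (i j).factorial : ℕ) : ℂ)) • ∏ j, D j ^ i j := by
  rw [Finset.sum_pow_eq_sum_piAntidiag, Finset.smul_sum]
  refine Finset.sum_congr rfl fun i hi => ?_
  have hm : ∑ j, i j = m := (Finset.mem_piAntidiag.1 hi).1
  have h1 := Nat.multinomial_spec Finset.univ i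
  rw [hm] at h1
  have h2 : (((∏ j, (i j).factorial : ℕ) : ℂ)) * (Nat.multinomial Finset.univ i : ℂ) = m.factorial := by
    exact_mod_cast h1
  have h3 : (((∏ j, (i j).factorial : ℕ) : ℂ)) ≠ 0 :=
    Nat.cast_ne_zero.2 (Finset.prod_ne_zero_iff.2 fun j _ => (i j).factorial_ne_zero)
  have h4 := Nat.cast_ne_zero (R := ℂ).2 m.factorial_ne_zero
  simp only [smul_pow]
  rw [Finset.prod_smul, ← nsmul_eq_mul, ← Nat.cast_smul_eq_nsmul ℂ, smul_smul, smul_smul]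
  congr 1
  rw [← h2] at h4 ⊢
  have h5 := right_ne_zero_of_mul h4
  field_simp

/-- Even forms lie in the center, a commutative ring, where the multinomial theorem applies; the
multinomial coefficient divided by `m!` leaves `1 / ∏ (i j)!`. -/
theorem expTrunc_sum_smul {k : ℕ} (z : Fin k → ℂ) (D : Fin k → GradedForm V)
    (hD : ∀ j, involute (D j) = D j) (N : ℕ) :
    expTrunc N (∑ j, z j • D j) = ∑ m ∈ Finset.range (N + 1),
      ∑ i ∈ Finset.piAntidiag (Finset.univ : Finset (Fin k)) m,
        ((∏ j, z j ^ i j) / ((∏ j, (i j).factorial : ℕ) : ℂ)) •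
          (List.ofFn fun j => D j ^ i j).prod := by
  have hc : ∀ j, D j ∈ Subalgebra.center ℂ (GradedForm V) := fun j =>
    Subalgebra.mem_center_iff.2 fun b => (commute_of_even (hD j) b).eq.symm
  let D' : Fin k → Subalgebra.center ℂ (GradedForm V) := fun j => ⟨D j, hc j⟩
  refine Finset.sum_congr rfl fun m _ => ?_
  have := congrArg (Subalgebra.center ℂ (GradedForm V)).val (inv_factorial_smul_sum_pow z D' m)
  have hp : ∀ i : Fin k → ℕ, (Subalgebra.center ℂ (GradedForm V)).val (∏ j, D' j ^ i j) =
      (List.ofFn fun j => D j ^ i j).prod := fun i => by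
    rw [← List.prod_ofFn, map_list_prod, List.map_ofFn]; rfl
  simp only [map_smul, map_pow, map_sum, hp] at this
  exact this

end Exp

/-! ### Evaluating an exponential on fibre vectors. -/

section Main

variable {V W U : Type*} [AddCommGroup V] [Module ℝ V] [TopologicalSpace V]
  [AddCommGroup W] [Module ℝ W] [TopologicalSpace W]
  [AddCommGroup U] [Module ℝ U] [TopologicalSpace U] [Module.Finite ℝ U]

/-- The algebra of fibre integration. Here `V` models the tangent space of the cotangent bundle, `U`
that of the base, and `W` parametrizes the lifts through `T` with base part `S`. Contracting `a`
with fibre vectors produces the `β j`. On lifts, `a` is the base form `∑ z j D j` up to multiples of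
the `β j`, which their product annihilates. -/
theorem expTrunc_append {k n : ℕ} {a : GradedForm V} (ha : involute a = a) (w : Fin k → V)
    (hw : ∀ i j, contractRight (w i) (contractRight (w j) a) = 0) (T : W →L[ℝ] V) (S : W →L[ℝ] U)
    (β : Fin k → U [⋀^Fin 1]→L[ℝ] ℂ) (D : Fin k → U [⋀^Fin 2]→L[ℝ] ℂ) (c : Fin k → GradedForm W)
    (hc : ∀ j, involute (c j) = -c j) (z : Fin k → ℂ) (t : ℂ)
    (h1 : ∀ j, pullback T (contractRight (w j) a) = t • pullback S (homog 1 (β j)))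
    (h2 : pullback T a = ∑ j, z j • pullback S (homog 2 (D j)) +
      ∑ j, c j * pullback S (homog 1 (β j)))
    {N : ℕ} (hN : Module.finrank ℝ U ≤ N) (e : Fin n → W) :
    expTrunc (N + k) a (n + k) (Fin.append (fun i => T (e i)) w) =
      t ^ k * ((List.ofFn fun j : Fin k => homog 1 (β j.rev)).prod *
        ∑ m ∈ Finset.range (Module.finrank ℝ U + 1),
          ∑ i ∈ Finset.piAntidiag (Finset.univ : Finset (Fin k)) m,
          ((∏ j, z j ^ i j) / ((∏ j, (i j).factorial : ℕ) : ℂ)) •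
            (List.ofFn fun j => homog 2 (D j) ^ i j).prod) n (fun i => S (e i)) := by
  have hone : ∀ X : V, contractRight X (1 : GradedForm V) = 0 := fun X => by
    rw [← one_eq]
    change involute (0 : GradedForm V) = 0
    exact ext_apply fun n v => mul_zero _
  have e1 := mul_expTrunc_append ha (fun i => T (e i)) w hw N 1 (fun i => hone _)
  rw [one_mul, one_mul] at e1
  rw [e1]
  set Q := (List.ofFn fun j => contractRight (w j.rev) a).prod * expTrunc N a with hQ
  change pullback T Q n e = _
  have e2 : pullback T Q = t ^ k • ((List.ofFn fun j : Fin k =>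
      pullback S (homog 1 (β j.rev))).prod * expTrunc N (pullback T a)) := by
    have : pullback T (expTrunc N a) = expTrunc N (pullback T a) := by
      simp only [expTrunc, map_sum, map_smul, map_pow]
    rw [hQ, map_mul, this, map_list_prod, List.map_ofFn]
    simp only [Function.comp_def, h1]
    rw [← smul_mul_assoc, List.prod_ofFn_smul]
  have hB : ∀ j, involute (pullback S (homog 1 (β j))) = -pullback S (homog 1 (β j)) := fun j => by
    rw [← pullback_involute, involute_homog_odd odd_one, map_neg]
  have hD : ∀ j, involute (pullback S (homog 2 (D j))) = pullback S (homog 2 (D j)) := fun j => by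
    rw [← pullback_involute, involute_homog_even even_two]
  have hη : involute (∑ j, z j • homog 2 (D j)) = ∑ j, z j • homog 2 (D j) := by
    have hl : ∀ j, involuteLinear (homog 2 (D j)) = homog 2 (D j) := fun j =>
      involute_homog_even even_two _
    change involuteLinear _ = _
    simp only [map_sum, map_smul, hl]
  have hSη : ∑ j, z j • pullback S (homog 2 (D j)) = pullback S (∑ j, z j • homog 2 (D j)) := by
    simp only [map_sum, map_smul]
  rw [e2, h2, prod_mul_expTrunc (fun j => pullback S (homog 1 (β j))) c hB hc
    (η := ∑ j, z j • pullback S (homog 2 (D j))) (by rw [hSη, ← pullback_involute, hη]) rfl, hSη]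
  have e3 : (List.ofFn fun j : Fin k => pullback S (homog 1 (β j.rev))).prod *
      expTrunc N (pullback S (∑ j, z j • homog 2 (D j))) =
      pullback S ((List.ofFn fun j : Fin k => homog 1 (β j.rev)).prod *
        expTrunc N (∑ j, z j • homog 2 (D j))) := by
    have : pullback S (expTrunc N (∑ j, z j • homog 2 (D j))) =
        expTrunc N (pullback S (∑ j, z j • homog 2 (D j))) := by
      simp only [expTrunc, map_sum, map_smul, map_pow]
    rw [map_mul, this, map_list_prod, List.map_ofFn]
    rfl
  -- The form `∑ z j D j` has no degree zero part, so its powers beyond the dimension of `U` vanish.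
  have e4 : expTrunc N (∑ j, z j • homog 2 (D j)) =
      expTrunc (Module.finrank ℝ U) (∑ j, z j • homog 2 (D j)) := by
    symm
    refine Finset.sum_subset (Finset.range_subset_range.2 (by omega)) fun m _ hm => ?_
    rw [pow_eq_zero_of_finrank_lt, smul_zero]
    · rw [Finset.sum_apply]
      refine Finset.sum_eq_zero fun j _ => ?_
      rw [Pi.smul_apply, homog_of_ne (by norm_num)]
      ext v
      exact mul_zero _
    · simpa using hm
  rw [e3, e4, expTrunc_sum_smul z (fun j => homog 2 (D j)) fun j => involute_homog_even even_two _]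
  rfl

end Main

end GradedForm

/-! ### Push-forward densities and mixed partial derivatives. -/

section PushforwardBasics

theorem integral_comp_of_det_ne_zero {G : Type*} [NormedAddCommGroup G] [NormedSpace ℝ G]
    [FiniteDimensional ℝ G] [MeasurableSpace G] [BorelSpace G] (μ : Measure G)
    [μ.IsAddHaarMeasure] (A : G →L[ℝ] G) (hA : A.det ≠ 0) (F : G → ℂ) :
    ∫ x, F (A x) ∂μ = |A.det|⁻¹ • ∫ x, F x ∂μ := by
  let e : G ≃L[ℝ] G := A.toContinuousLinearEquivOfDetNeZero hA
  have h1 : ∫ x, F (A x) ∂μ = ∫ x, F x ∂(μ.map A) :=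
    (e.toHomeomorph.toMeasurableEquiv.measurableEmbedding.integral_map F).symm
  have h2 := Measure.map_linearMap_addHaar_eq_smul_addHaar μ
    (f := (A : G →ₗ[ℝ] G)) hA
  rw [h1]
  change ∫ x, F x ∂(μ.map (A : G →ₗ[ℝ] G)) = _
  rw [h2, integral_smul_measure, ENNReal.toReal_ofReal (abs_nonneg _), abs_inv]

variable {k : ℕ}

theorem eq_of_integral_smul_eq {g h : (Fin k → ℝ) → ℂ} (hg : Continuous g) (hh : Continuous h)
    (H : ∀ ψ : (Fin k → ℝ) → ℝ, ContDiff ℝ ∞ ψ → HasCompactSupport ψ →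
      ∫ u, ψ u • g u = ∫ u, ψ u • h u) : g = h := by
  have := ae_eq_of_integral_contDiff_smul_eq (μ := volume) hg.locallyIntegrable
    hh.locallyIntegrable H
  exact (Continuous.ae_eq_iff_eq volume hg hh).1 this

variable {W : Type*} [MeasurableSpace W] {μ : Measure W} {f : W → Fin k → ℝ} {φ : W → ℂ}

theorem IsPushforward.unique {g h : (Fin k → ℝ) → ℂ} (hg : IsPushforward μ f φ g)
    (hh : IsPushforward μ f φ h) : g = h :=
  eq_of_integral_smul_eq hg.contDiff.continuous hh.contDiff.continuous fun ψ hψ _ => by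
    have hc : Continuous fun u => (ψ u : ℂ) := Complex.continuous_ofReal.comp hψ.continuous
    simp only [Complex.real_smul]
    rw [← hg.integral_eq _ hc, ← hh.integral_eq _ hc]

theorem IsPushforward.pushforward_eq {g : (Fin k → ℝ) → ℂ} (hg : IsPushforward μ f φ g) :
    pushforward μ f φ = g := by
  have h : ∃ g, IsPushforward μ f φ g := ⟨g, hg⟩
  rw [pushforward, dif_pos h]
  exact h.choose_spec.unique hg

/-- The partial derivative in the direction of a standard basis vector. -/
def partialDeriv (j : Fin k) (G : (Fin k → ℝ) → ℂ) (u : Fin k → ℝ) : ℂ :=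
  fderiv ℝ G u (Pi.single j 1)

/-- An induction principle for the nested iterates defining `mixedPartial`. The index `Z` lets
several functions be differentiated simultaneously (say `g`, `h` and `g + h`). The parameter `b`
records a parallel operation `d j` on other data, such as differentiating a test function or
multiplying by a Fourier variable. -/
theorem mixedPartial_induction {Z β : Type*} (i : Fin k → ℕ) (d : Fin k → β → β)
    (P : (Z → (Fin k → ℝ) → ℂ) → β → Prop)
    (hP : ∀ j G b, P G b → P (fun z => partialDeriv j (G z)) (d j b))
    {G : Z → (Fin k → ℝ) → ℂ} {b : β} (h : P G b) :
    P (fun z => mixedPartial i (G z))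
      ((List.finRange k).foldr (fun j b => (d j)^[i j] b) b) := by
  unfold mixedPartial
  induction List.finRange k with
  | nil => exact h
  | cons j l ih =>
    simp only [List.foldr_cons]
    have key : ∀ (m : ℕ) (G : Z → (Fin k → ℝ) → ℂ) (b : β), P G b →
        P (fun z => (partialDeriv j)^[m] (G z)) ((d j)^[m] b) := by
      intro m
      induction m with
      | zero => exact fun _ _ h => h
      | succ m ihm =>
        intro G b h
        simp only [Function.iterate_succ, Function.comp_apply]
        exact ihm _ _ (hP j G b h)
    exact key _ _ _ ih

theorem contDiff_partialDeriv {G : (Fin k → ℝ) → ℂ} (hG : ContDiff ℝ ∞ G) (j : Fin k) :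
    ContDiff ℝ ∞ (partialDeriv j G) :=
  (hG.fderiv_right (by simp)).clm_apply contDiff_const

theorem mixedPartial_smul (i : Fin k → ℕ) (c : ℂ) {g : (Fin k → ℝ) → ℂ} (hg : ContDiff ℝ ∞ g) :
    mixedPartial i (c • g) = c • mixedPartial i g := by
  have := mixedPartial_induction (Z := Bool) (β := Unit) i (fun _ b => b)
    (fun G _ => ContDiff ℝ ∞ (G true) ∧ G false = c • G true) (fun j G _ h =>
      ⟨contDiff_partialDeriv h.1 j, by
        dsimp only
        rw [h.2]; ext u
        have hd : DifferentiableAt ℝ (G true) u := h.1.contDiffAt.differentiableAt (by simp)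
        simp [partialDeriv, fderiv_const_smul hd]⟩)
    (G := fun b => if b then g else c • g) (b := ()) ⟨by simpa using hg, by simp⟩
  simpa using this.2

theorem mixedPartial_add (i : Fin k → ℕ) {g h : (Fin k → ℝ) → ℂ} (hg : ContDiff ℝ ∞ g)
    (hh : ContDiff ℝ ∞ h) : mixedPartial i (g + h) = mixedPartial i g + mixedPartial i h := by
  have := mixedPartial_induction (Z := Fin 3) (β := Unit) i (fun _ b => b)
    (fun G _ => ContDiff ℝ ∞ (G 0) ∧ ContDiff ℝ ∞ (G 1) ∧ G 2 = G 0 + G 1) (fun j G _ h =>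
      ⟨contDiff_partialDeriv h.1 j, contDiff_partialDeriv h.2.1 j, by
        dsimp only
        rw [h.2.2]; ext u
        have hd : DifferentiableAt ℝ (G 0) u := h.1.contDiffAt.differentiableAt (by simp)
        have hd' : DifferentiableAt ℝ (G 1) u := h.2.1.contDiffAt.differentiableAt (by simp)
        simp [partialDeriv, fderiv_add hd hd']⟩)
    (G := ![g, h, g + h]) (b := ()) ⟨by simpa using hg, by simpa using hh, by simp⟩
  simpa using this.2.2

theorem IsPushforward.diracPullback_eq {g : (Fin k → ℝ) → ℂ} (hg : IsPushforward μ f φ g)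
    (i : Fin k → ℕ) : diracPullback μ f i φ = (-1) ^ (∑ j, i j) * mixedPartial i g 0 := by
  rw [diracPullback, hg.pushforward_eq]

end PushforwardBasics

/-! ### The density of a push-forward under a linear map, relative to a splitting. -/

section PushforwardLinear

variable {k : ℕ} {G Z : Type*} [NormedAddCommGroup G] [NormedSpace ℝ G]
  [NormedAddCommGroup Z] [NormedSpace ℝ Z]

/-- The restriction to `ℝ^k` of a linear map on `ℝ^k × Z ≃ G`. -/
def horizontalPart (e : ((Fin k → ℝ) × Z) ≃L[ℝ] G) (L : G →L[ℝ] (Fin k → ℝ)) :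
    (Fin k → ℝ) →L[ℝ] (Fin k → ℝ) :=
  (L.comp (e : ((Fin k → ℝ) × Z) →L[ℝ] G)).comp (ContinuousLinearMap.inl ℝ (Fin k → ℝ) Z)

/-- The point of `L⁻¹(u)` with second coordinate `w`. -/
def fibrePoint (e : ((Fin k → ℝ) × Z) ≃L[ℝ] G) (L : G →L[ℝ] (Fin k → ℝ)) (u : Fin k → ℝ) (w : Z) :
    G :=
  e ((horizontalPart e L).inverse (u - L (e (0, w))), w)

/-- The density of the push-forward of `φ` under the linear map `L`. -/
def pushDensity [MeasurableSpace Z] (ν : Measure Z) (e : ((Fin k → ℝ) × Z) ≃L[ℝ] G)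
    (φ : G → ℂ) (L : G →L[ℝ] (Fin k → ℝ)) (u : Fin k → ℝ) : ℂ :=
  |(horizontalPart e L).det|⁻¹ • ∫ w, φ (fibrePoint e L u w) ∂ν

theorem contDiff_det : ContDiff ℝ ∞ fun A : (Fin k → ℝ) →L[ℝ] (Fin k → ℝ) => A.det := by
  have : (fun A : (Fin k → ℝ) →L[ℝ] (Fin k → ℝ) => A.det) = fun A =>
      ∑ σ : Equiv.Perm (Fin k), ((Equiv.Perm.sign σ : ℤ) : ℝ) *
        ∏ j, A (Pi.single j 1) (σ j) := by
    funext A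
    rw [ContinuousLinearMap.det, ← LinearMap.det_toMatrix', Matrix.det_apply']
    simp [LinearMap.toMatrix'_apply]
  rw [this]
  refine ContDiff.sum fun σ _ => contDiff_const.mul (contDiff_prod fun j _ => ?_)
  exact (contDiff_apply ℝ ℝ (σ j)).comp (contDiff_id.clm_apply contDiff_const)

theorem contDiff_horizontalPart (e : ((Fin k → ℝ) × Z) ≃L[ℝ] G) :
    ContDiff ℝ ∞ (horizontalPart e) :=
  (contDiff_id.clm_comp contDiff_const).clm_comp contDiff_const

theorem isOpen_det_horizontalPart (e : ((Fin k → ℝ) × Z) ≃L[ℝ] G) :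
    IsOpen {L | (horizontalPart e L).det ≠ 0} :=
  isOpen_ne_fun (contDiff_det.continuous.comp (contDiff_horizontalPart e).continuous)
    continuous_const

theorem apply_fibrePoint (e : ((Fin k → ℝ) × Z) ≃L[ℝ] G) {L : G →L[ℝ] (Fin k → ℝ)}
    (hL : (horizontalPart e L).det ≠ 0) (u : Fin k → ℝ) (w : Z) : L (fibrePoint e L u w) = u := by
  have hinv : (horizontalPart e L).IsInvertible :=
    ⟨(horizontalPart e L).toContinuousLinearEquivOfDetNeZero hL, by ext; simp⟩
  have h1 : ∀ v, L (e (v, w)) = horizontalPart e L v + L (e (0, w)) := fun v => by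
    change _ = L (e (v, 0)) + _
    rw [← map_add, ← map_add]; simp
  rw [fibrePoint, h1, hinv.self_apply_inverse]
  simp

theorem contDiffOn_fibrePoint (e : ((Fin k → ℝ) × Z) ≃L[ℝ] G) :
    ContDiffOn ℝ ∞ (fun q : ((G →L[ℝ] (Fin k → ℝ)) × (Fin k → ℝ)) × Z =>
      fibrePoint e q.1.1 q.1.2 q.2) (({L | (horizontalPart e L).det ≠ 0} ×ˢ univ) ×ˢ univ) := by
  have h1 : ContDiffOn ℝ ∞ (fun q : ((G →L[ℝ] (Fin k → ℝ)) × (Fin k → ℝ)) × Z =>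
      (horizontalPart e q.1.1).inverse) (({L | (horizontalPart e L).det ≠ 0} ×ˢ univ) ×ˢ univ) := by
    intro q hq
    have hinv : (horizontalPart e q.1.1).IsInvertible :=
      ⟨(horizontalPart e q.1.1).toContinuousLinearEquivOfDetNeZero hq.1.1, by ext; simp⟩
    exact (hinv.contDiffAt_map_inverse.comp q
      ((contDiff_horizontalPart e).comp (contDiff_fst.comp contDiff_fst)).contDiffAt).contDiffWithinAt
  have h2 : ContDiff ℝ ∞ (fun q : ((G →L[ℝ] (Fin k → ℝ)) × (Fin k → ℝ)) × Z =>
      q.1.2 - q.1.1 (e (0, q.2))) :=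
    (contDiff_snd.comp contDiff_fst).sub ((contDiff_fst.comp contDiff_fst).clm_apply
      (e.contDiff.comp (contDiff_const.prodMk contDiff_snd)))
  exact e.contDiff.comp_contDiffOn ((h1.clm_apply h2.contDiffOn).prodMk contDiff_snd.contDiffOn)

variable [MeasurableSpace Z] [BorelSpace Z] [FiniteDimensional ℝ Z] (ν : Measure Z)
  [ν.IsAddHaarMeasure]

/-- Smoothness of the fibre integral in its parameters comes from writing it as a convolution with
the constant function `1`, evaluated at `0`. The parametric convolution theorem applies because the
integrand, as a function of `w`, is supported in a compact set independent of the parameters. -/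
theorem contDiffOn_pushDensity (e : ((Fin k → ℝ) × Z) ≃L[ℝ] G) {φ : G → ℂ}
    (hφ : ContDiff ℝ ∞ φ) (hc : HasCompactSupport φ) :
    ContDiffOn ℝ ∞ (fun q : (G →L[ℝ] (Fin k → ℝ)) × (Fin k → ℝ) => pushDensity ν e φ q.1 q.2)
      ({L | (horizontalPart e L).det ≠ 0} ×ˢ univ) := by
  have ho : IsOpen ({L : G →L[ℝ] (Fin k → ℝ) | (horizontalPart e L).det ≠ 0} ×ˢ
      (univ : Set (Fin k → ℝ))) := (isOpen_det_horizontalPart e).prod isOpen_univ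
  have hdet : ContDiffOn ℝ ∞ (fun q : (G →L[ℝ] (Fin k → ℝ)) × (Fin k → ℝ) =>
      |(horizontalPart e q.1).det|⁻¹) ({L | (horizontalPart e L).det ≠ 0} ×ˢ univ) := by
    have h1 : ContDiffOn ℝ ∞ (fun q : (G →L[ℝ] (Fin k → ℝ)) × (Fin k → ℝ) =>
      (horizontalPart e q.1).det) ({L | (horizontalPart e L).det ≠ 0} ×ˢ univ) :=
      (contDiff_det.comp ((contDiff_horizontalPart e).comp contDiff_fst)).contDiffOn
    refine ContDiffOn.inv (fun q hq => ?_) fun q hq => abs_ne_zero.2 hq.1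
    exact (h1 q hq).abs hq.1
  refine hdet.smul ?_
  -- The sign of `w` compensates the `0 - w` of the convolution at `0`.
  let g : (G →L[ℝ] (Fin k → ℝ)) × (Fin k → ℝ) → Z → ℂ := fun q w => φ (fibrePoint e q.1 q.2 (-w))
  let K : Set Z := (fun x => -(e.symm x).2) '' tsupport φ
  have hK : IsCompact K := hc.isCompact.image
    (continuous_snd.comp e.symm.continuous).neg
  have hg0 : ∀ q w, q ∈ ({L : G →L[ℝ] (Fin k → ℝ) | (horizontalPart e L).det ≠ 0} ×ˢ
      (univ : Set (Fin k → ℝ))) → w ∉ K → g q w = 0 := by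
    intro q w _ hw
    by_contra hne
    exact hw ⟨_, subset_tsupport φ hne, by simp [fibrePoint]⟩
  have hgs : ContDiffOn ℝ ∞ (Function.uncurry g)
      (({L : G →L[ℝ] (Fin k → ℝ) | (horizontalPart e L).det ≠ 0} ×ˢ
      (univ : Set (Fin k → ℝ))) ×ˢ univ) := by
    refine hφ.comp_contDiffOn ((contDiffOn_fibrePoint e).comp (contDiff_fst.prodMk
      contDiff_snd.neg).contDiffOn ?_)
    exact fun q hq => ⟨hq.1, mem_univ _⟩
  have h1 : LocallyIntegrable (fun _ : Z => (1 : ℝ)) ν := locallyIntegrable_const 1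
  have := contDiffOn_convolution_right_with_param_comp (n := ⊤) (μ := ν)
    (ContinuousLinearMap.lsmul ℝ ℝ) (contDiffOn_const (c := (0 : Z))) ho hK hg0 h1 hgs
  refine this.congr fun q _ => ?_
  simp [convolution, g]

/-- Fubini, with an affine change of variables for each fixed `w`: `u ↦ L (e (u, w))` has linear
part `horizontalPart e L`, whose determinant is the Jacobian. A second exchange of integrals puts
`u` outside. -/
theorem isPushforward_pushDensity (e : ((Fin k → ℝ) × Z) ≃L[ℝ] G) {φ : G → ℂ}
    (hφ : ContDiff ℝ ∞ φ) (hc : HasCompactSupport φ) {L : G →L[ℝ] (Fin k → ℝ)}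
    (hL : (horizontalPart e L).det ≠ 0) [MeasurableSpace G] [BorelSpace G] :
    IsPushforward (((volume : Measure (Fin k → ℝ)).prod ν).map e) L φ (pushDensity ν e φ L) where
  contDiff := by
    have h := (contDiffOn_pushDensity ν e hφ hc).comp (contDiff_const (c := L).prodMk
      contDiff_id).contDiffOn (s := univ) fun u _ => ⟨hL, mem_univ _⟩
    exact contDiffOn_univ.1 h
  hasCompactSupport := by
    refine HasCompactSupport.intro (hc.isCompact.image L.continuous) fun u hu => ?_
    have : ∀ w, φ (fibrePoint e L u w) = 0 := fun w => by
      by_contra hne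
      exact hu ⟨_, subset_tsupport φ hne, apply_fibrePoint e hL u w⟩
    simp [pushDensity, this]
  integral_eq := by
    intro ψ hψ
    set A := horizontalPart e L with hA
    have hinv : A.IsInvertible := ⟨A.toContinuousLinearEquivOfDetNeZero hL, by ext; simp⟩
    have hcont : Continuous fun q : (Fin k → ℝ) × Z => ψ (L (e q)) * φ (e q) :=
      (hψ.comp (L.continuous.comp e.continuous)).mul (hφ.continuous.comp e.continuous)
    have hsupp : HasCompactSupport fun q : (Fin k → ℝ) × Z => ψ (L (e q)) * φ (e q) :=
      (hc.comp_homeomorph e.toHomeomorph).mul_left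
    have hm : ∫ X, ψ (L X) * φ X ∂(((volume : Measure (Fin k → ℝ)).prod ν).map e) =
        ∫ q, ψ (L (e q)) * φ (e q) ∂((volume : Measure (Fin k → ℝ)).prod ν) :=
      e.toHomeomorph.measurableEmbedding.integral_map _
    rw [hm, integral_prod_symm _ (hcont.integrable_of_hasCompactSupport hsupp)]
    have hfib : ∀ u w, fibrePoint e L (L (e (u, w))) w = e (u, w) := fun u w => by
      have h1 : L (e (u, w)) - L (e (0, w)) = A u := by
        change _ = L (e (u, 0))
        rw [← map_sub, ← map_sub]; simp
      rw [fibrePoint, h1, ← hA, hinv.inverse_apply_self]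
    have hin : ∀ w, ∫ u, ψ (L (e (u, w))) * φ (e (u, w)) =
        |A.det|⁻¹ • ∫ u, ψ u * φ (fibrePoint e L u w) := fun w => by
      rw [← integral_add_right_eq_self (fun u => ψ u * φ (fibrePoint e L u w)) (L (e (0, w))),
        ← integral_comp_of_det_ne_zero volume A hL]
      refine integral_congr_ae (Eventually.of_forall fun u => ?_)
      have h1 : A u + L (e (0, w)) = L (e (u, w)) := by
        change L (e (u, 0)) + _ = _
        rw [← map_add, ← map_add]; simp
      simp only [h1, hfib]
    simp only [hin]
    rw [integral_smul]
    have hfc : Continuous fun q : Z × (Fin k → ℝ) => fibrePoint e L q.2 q.1 :=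
      e.continuous.comp ((A.inverse.continuous.comp (continuous_snd.sub (L.continuous.comp
        (e.continuous.comp (continuous_const.prodMk continuous_fst))))).prodMk continuous_fst)
    rw [integral_integral_swap_of_hasCompactSupport
      (f := fun w u => ψ u * φ (fibrePoint e L u w))
      ((hψ.comp continuous_snd).mul (hφ.continuous.comp hfc)), ← integral_smul]
    · refine integral_congr_ae (Eventually.of_forall fun u => ?_)
      simp only [pushDensity]
      rw [integral_const_mul, mul_smul_comm]
    · refine HasCompactSupport.intro (K := ((fun x => (e.symm x).2) '' tsupport φ) ×ˢ
        (L '' tsupport φ)) ((hc.isCompact.image (continuous_snd.comp e.symm.continuous)).prod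
          (hc.isCompact.image L.continuous)) fun q hq => ?_
      have : φ (fibrePoint e L q.2 q.1) = 0 := by
        by_contra hne
        exact hq ⟨⟨_, subset_tsupport φ hne, by simp [fibrePoint]⟩,
          ⟨_, subset_tsupport φ hne, apply_fibrePoint e hL _ _⟩⟩
      simp [Function.uncurry, this]

end PushforwardLinear

/-! ### Dirac pull-backs under surjective maps: smooth dependence, continuity, change of variables.
-/

section PushforwardSurjective

variable {k : ℕ} {G : Type*} [NormedAddCommGroup G] [NormedSpace ℝ G] [FiniteDimensional ℝ G]

/-- The splitting of `G` as the sum of `ℝ^k` and the kernel of a surjective map. -/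
theorem exists_splitting {L : G →L[ℝ] (Fin k → ℝ)} (hL : Function.Surjective L) :
    ∃ e : ((Fin k → ℝ) × LinearMap.ker (L : G →ₗ[ℝ] (Fin k → ℝ))) ≃L[ℝ] G,
      ∀ q, L (e q) = q.1 := by
  obtain ⟨s, hs⟩ := (L : G →ₗ[ℝ] (Fin k → ℝ)).exists_rightInverse_of_surjective
    (LinearMap.range_eq_top.2 hL)
  have hs' : ∀ u, L (s u) = u := fun u => LinearMap.congr_fun hs u
  let e : ((Fin k → ℝ) × LinearMap.ker (L : G →ₗ[ℝ] (Fin k → ℝ))) ≃ₗ[ℝ] G :=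
    { toFun := fun q => s q.1 + q.2
      map_add' := fun q q' => by simp; abel
      map_smul' := fun c q => by simp
      invFun := fun x => (L x, ⟨x - s (L x), by simp [hs']⟩)
      left_inv := fun q => by
        have h2 : L (q.2 : G) = 0 := q.2.2
        ext <;> simp [hs', h2]
      right_inv := fun x => by simp }
  refine ⟨e.toContinuousLinearEquiv, fun q => ?_⟩
  have h2 : L (q.2 : G) = 0 := q.2.2
  change L (s q.1 + q.2) = q.1
  rw [map_add, hs', h2, add_zero]

variable [MeasurableSpace G] [BorelSpace G] (μ : Measure G) [μ.IsAddHaarMeasure]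

/-- Near a surjective linear map, the push-forwards of a test function have a density that is
jointly smooth; the value of the density at the given map is an integral over its kernel. -/
theorem exists_pushforward_family {L₀ : G →L[ℝ] (Fin k → ℝ)} (hL₀ : Function.Surjective L₀) :
    ∃ S : Set (G →L[ℝ] (Fin k → ℝ)), IsOpen S ∧ L₀ ∈ S ∧
      ∃ (g : (G → ℂ) → (G →L[ℝ] (Fin k → ℝ)) → (Fin k → ℝ) → ℂ) (ν : Measure G)
        (_ : IsLocallyFiniteMeasure ν),
        (∀ φ, ContDiff ℝ ∞ φ → HasCompactSupport φ →
          ContDiffOn ℝ ∞ (fun q : (G →L[ℝ] (Fin k → ℝ)) × (Fin k → ℝ) => g φ q.1 q.2)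
            (S ×ˢ univ) ∧
          (∀ L ∈ S, IsPushforward μ L φ (g φ L)) ∧ g φ L₀ 0 = ∫ x, φ x ∂ν) := by
  obtain ⟨e, he⟩ := exists_splitting hL₀
  let Z := LinearMap.ker (L₀ : G →ₗ[ℝ] (Fin k → ℝ))
  let ν₀ : Measure Z := Measure.addHaar
  have hmap : (((volume : Measure (Fin k → ℝ)).prod ν₀).map e).IsAddHaarMeasure :=
    e.isAddHaarMeasure_map _
  -- By uniqueness of Haar measure, `μ` is a multiple of the product measure transported by the
  -- splitting.
  obtain ⟨c, hc⟩ : ∃ c : NNReal, μ = c • (((volume : Measure (Fin k → ℝ)).prod ν₀).map e) :=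
    ⟨_, Measure.isAddLeftInvariant_eq_smul μ _⟩
  -- At `L₀` itself the splitting makes the horizontal part the identity, so the density at `0` is a
  -- plain integral over the kernel.
  have hA : horizontalPart e L₀ = ContinuousLinearMap.id ℝ _ := by
    ext1 u
    exact he _
  have hcl : IsClosedEmbedding fun w : Z => e (0, w) :=
    LinearMap.isClosedEmbedding_of_injective (𝕜 := ℝ)
      (f := (e : ((Fin k → ℝ) × Z) →ₗ[ℝ] G) ∘ₗ LinearMap.inr ℝ (Fin k → ℝ) Z) <| by
        rw [LinearMap.ker_eq_bot]
        intro w w' h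
        have := e.injective h
        simpa using this
  -- The kernel measure, moved to `G` along a closed embedding, stays finite on compacts;
  -- integration against it is then a continuous functional of test functions.
  have hfin : IsFiniteMeasureOnCompacts (ν₀.map fun w => e (0, w)) := ⟨fun K hK => by
    rw [hcl.measurableEmbedding.map_apply]
    exact (hcl.isCompact_preimage hK).measure_lt_top⟩
  refine ⟨_, isOpen_det_horizontalPart e, ?_, fun φ L u => (c : ℝ) • pushDensity ν₀ e φ L u,
    c • ν₀.map (fun w => e (0, w)), ?_, fun φ hφ hφc => ⟨?_, fun L hL => ?_, ?_⟩⟩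
  · simp [hA, ContinuousLinearMap.det]
  · infer_instance
  · exact (contDiffOn_pushDensity ν₀ e hφ hφc).const_smul _
  · have h := isPushforward_pushDensity ν₀ e hφ hφc hL
    refine ⟨h.contDiff.const_smul _, h.hasCompactSupport.comp_left (g := fun z => (c : ℝ) • z)
      (by simp), fun ψ hψ => ?_⟩
    rw [hc, integral_smul_nnreal_measure, h.integral_eq ψ hψ]
    simp only [mul_smul_comm]
    rw [integral_smul]
    rfl
  · rw [integral_smul_nnreal_measure, hcl.measurableEmbedding.integral_map]
    simp [pushDensity, hA, fibrePoint, he, ContinuousLinearMap.det]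
    rfl

theorem exists_isPushforward {L : G →L[ℝ] (Fin k → ℝ)} (hL : Function.Surjective L) {φ : G → ℂ}
    (hφ : ContDiff ℝ ∞ φ) (hc : HasCompactSupport φ) : ∃ g, IsPushforward μ L φ g := by
  obtain ⟨S, -, hLS, g, _, _, h⟩ := exists_pushforward_family μ hL
  exact ⟨_, (h φ hφ hc).2.1 L hLS⟩

/-- The density is smooth in `(L, u)` jointly, so it can be differentiated in `u` and then
restricted to `u = 0` without losing smoothness in `L`. -/
theorem contDiffAt_diracPullback {L₀ : G →L[ℝ] (Fin k → ℝ)} (hL₀ : Function.Surjective L₀)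
    (i : Fin k → ℕ) {φ : G → ℂ} (hφ : ContDiff ℝ ∞ φ) (hc : HasCompactSupport φ) :
    ContDiffAt ℝ ∞ (fun L : G →L[ℝ] (Fin k → ℝ) => diracPullback μ L i φ) L₀ := by
  obtain ⟨S, hS, hLS, g, _, _, h⟩ := exists_pushforward_family μ hL₀
  obtain ⟨h1, h2, -⟩ := h φ hφ hc
  have h3 := mixedPartial_induction (β := Unit) i (fun _ b => b)
    (fun (F : (G →L[ℝ] (Fin k → ℝ)) → (Fin k → ℝ) → ℂ) _ =>
      ContDiffOn ℝ ∞ (fun q : (G →L[ℝ] (Fin k → ℝ)) × (Fin k → ℝ) => F q.1 q.2) (S ×ˢ univ))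
    (fun j F _ hF => by
      have ho : IsOpen (S ×ˢ (univ : Set (Fin k → ℝ))) := hS.prod isOpen_univ
      have h4 := (hF.fderiv_of_isOpen ho (m := ∞) (by simp)).clm_apply
        (contDiffOn_const (c := ((0 : G →L[ℝ] (Fin k → ℝ)), (Pi.single j (1 : ℝ) : Fin k → ℝ))))
      refine h4.congr fun q hq => ?_
      have hd : DifferentiableAt ℝ (fun q : (G →L[ℝ] (Fin k → ℝ)) × (Fin k → ℝ) => F q.1 q.2) q :=
        (hF.contDiffAt (ho.mem_nhds hq)).differentiableAt (by simp)
      have h5 : HasFDerivAt (F q.1) _ q.2 :=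
        HasFDerivAt.comp (g := fun q : (G →L[ℝ] (Fin k → ℝ)) × (Fin k → ℝ) => F q.1 q.2)
          (f := fun v => (q.1, v)) q.2 hd.hasFDerivAt (hasFDerivAt_prodMk_right q.1 q.2)
      change fderiv ℝ (F q.1) q.2 (Pi.single j 1) = _
      rw [h5.fderiv]
      simp)
    (b := ()) h1
  have h6 : ContDiffOn ℝ ∞ (fun L : G →L[ℝ] (Fin k → ℝ) =>
      (-1 : ℂ) ^ (∑ j, i j) * mixedPartial i (g φ L) 0) S :=
    contDiffOn_const.mul (h3.comp (contDiff_id.prodMk contDiff_const).contDiffOn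
      fun L hL => ⟨hL, mem_univ _⟩)
  exact (h6.congr fun L hL => (h2 L hL).diracPullback_eq i).contDiffAt (hS.mem_nhds hLS)

-- Integration by parts upstairs and downstairs: since `L X` is the `j`-th basis vector, the
-- derivative of `ψ ∘ L` along `X` is `(∂_j ψ) ∘ L`. The density of the push-forward of the
-- differentiated function and `∂_j g` thus have the same integral against every test function `ψ`.
variable {μ} in
theorem IsPushforward.partialDeriv {L : G →L[ℝ] (Fin k → ℝ)} (hL : Function.Surjective L)
    {φ : G → ℂ} (hφ : ContDiff ℝ ∞ φ) (hc : HasCompactSupport φ) {g : (Fin k → ℝ) → ℂ}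
    (hg : IsPushforward μ L φ g) {j : Fin k} {X : G} (hX : L X = Pi.single j 1) :
    IsPushforward μ L (fun Y => fderiv ℝ φ Y X) (partialDeriv j g) := by
  have hφ' : ContDiff ℝ ∞ fun Y => fderiv ℝ φ Y X :=
    (hφ.fderiv_right (by simp)).clm_apply contDiff_const
  have hc' : HasCompactSupport fun Y => fderiv ℝ φ Y X := hc.fderiv_apply (𝕜 := ℝ) X
  have hgc : HasCompactSupport (_root_.partialDeriv j g) :=
    hg.hasCompactSupport.fderiv_apply (𝕜 := ℝ) _
  obtain ⟨h, hh⟩ := exists_isPushforward μ hL hφ' hc'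
  suffices h = _root_.partialDeriv j g by rwa [← this]
  refine eq_of_integral_smul_eq hh.contDiff.continuous
    (contDiff_partialDeriv hg.contDiff j).continuous fun ψ hψ hψc => ?_
  have hψ' : ContDiff ℝ ∞ fun u => (ψ u : ℂ) := Complex.ofRealCLM.contDiff.comp hψ
  have hdψ : ContDiff ℝ ∞ fun u => fderiv ℝ (fun u => (ψ u : ℂ)) u (Pi.single j 1) :=
    (hψ'.fderiv_right (by simp)).clm_apply contDiff_const
  simp only [Complex.real_smul]
  rw [← hh.integral_eq _ hψ'.continuous]
  have hψL : ContDiff ℝ ∞ fun Y => (ψ (L Y) : ℂ) := hψ'.comp L.contDiff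
  have hd : ∀ Y, fderiv ℝ (fun Y => (ψ (L Y) : ℂ)) Y X =
      fderiv ℝ (fun u => (ψ u : ℂ)) (L Y) (Pi.single j 1) := fun Y => by
    have := (hψ'.contDiffAt.differentiableAt (by simp)).hasFDerivAt.comp Y
      (L.hasFDerivAt (x := Y))
    rw [show (fun Y => (ψ (L Y) : ℂ)) = (fun u => (ψ u : ℂ)) ∘ L from rfl, this.fderiv]
    simp [hX]
  rw [integral_mul_fderiv_eq_neg_fderiv_mul_of_integrable]
  · simp only [hd]
    rw [hg.integral_eq (fun u => fderiv ℝ (fun u => (ψ u : ℂ)) u (Pi.single j 1)) hdψ.continuous]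
    symm
    refine integral_mul_fderiv_eq_neg_fderiv_mul_of_integrable ?_ ?_ ?_
      (fun u _ => hψ'.contDiffAt.differentiableAt (by simp))
      (fun u _ => hg.contDiff.contDiffAt.differentiableAt (by simp))
    · exact (hdψ.continuous.mul hg.contDiff.continuous).integrable_of_hasCompactSupport
        hg.hasCompactSupport.mul_left
    · exact (hψ'.continuous.mul (contDiff_partialDeriv hg.contDiff j).continuous
        ).integrable_of_hasCompactSupport hgc.mul_left
    · exact (hψ'.continuous.mul hg.contDiff.continuous).integrable_of_hasCompactSupport
        hg.hasCompactSupport.mul_left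
  · simp only [hd]
    exact ((hdψ.continuous.comp L.continuous).mul hφ.continuous).integrable_of_hasCompactSupport
      hc.mul_left
  · exact (hψL.continuous.mul hφ'.continuous).integrable_of_hasCompactSupport hc'.mul_left
  · exact (hψL.continuous.mul hφ.continuous).integrable_of_hasCompactSupport hc.mul_left
  · exact fun Y _ => hψL.contDiffAt.differentiableAt (by simp)
  · exact fun Y _ => hφ.contDiffAt.differentiableAt (by simp)

/-- The derivatives of the density are moved onto the test function, along vectors `X j` mapped by
`L` to the standard basis. The pairing becomes, up to sign, the integral over the kernel of `L` of
an iterated derivative of `φ`, a composite of continuous operations. -/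
theorem continuous_diracPullback {L : G →L[ℝ] (Fin k → ℝ)} (hL : Function.Surjective L)
    (i : Fin k → ℕ) :
    Continuous fun φ : 𝓓((⊤ : TopologicalSpace.Opens G), ℂ) => diracPullback μ L i φ := by
  obtain ⟨S, -, hLS, g, ν, hν, h⟩ := exists_pushforward_family μ hL
  choose X hX using fun j : Fin k => hL (Pi.single j 1)
  let d : Fin k → 𝓓((⊤ : TopologicalSpace.Opens G), ℂ) → 𝓓((⊤ : TopologicalSpace.Opens G), ℂ) :=
    fun j => TestFunction.lineDerivCLM ℂ (X j)
  have hd : ∀ j φ Y, d j φ Y = fderiv ℝ φ Y (X j) := fun j φ Y => by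
    change TestFunction.lineDerivCLM ℂ (X j) φ Y = _
    rw [TestFunction.lineDerivCLM_apply_of_le (by simp),
      (φ.contDiff.contDiffAt.differentiableAt (by simp)).lineDeriv_eq_fderiv]
  have key : ∀ φ : 𝓓((⊤ : TopologicalSpace.Opens G), ℂ), diracPullback μ L i φ =
      (-1) ^ (∑ j, i j) *
        ∫ x, ((List.finRange k).foldr (fun j b => (d j)^[i j] b) φ) x ∂ν := fun φ => by
    have hφ : ∀ φ : 𝓓((⊤ : TopologicalSpace.Opens G), ℂ), IsPushforward μ L φ (g φ L) :=
      fun φ => (h φ φ.contDiff φ.hasCompactSupport).2.1 L hLS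
    have h1 := mixedPartial_induction i d
      (fun (F : Unit → (Fin k → ℝ) → ℂ) (φ : 𝓓((⊤ : TopologicalSpace.Opens G), ℂ)) =>
        IsPushforward μ L φ (F ())) (fun j F φ hF => by
          have := hF.partialDeriv hL φ.contDiff φ.hasCompactSupport (hX j)
          rwa [← show (⇑(d j φ) : G → ℂ) = _ from funext (hd j φ)] at this)
      (G := fun _ => g φ L) (hφ φ)
    rw [(hφ φ).diracPullback_eq, show mixedPartial i (g φ L) = _ from h1.unique (hφ _),
      (h _ (TestFunction.contDiff _) (TestFunction.hasCompactSupport _)).2.2]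
  simp only [key]
  refine continuous_const.mul ?_
  have hint : Continuous fun φ : 𝓓((⊤ : TopologicalSpace.Opens G), ℂ) => ∫ x, φ x ∂ν := by
    have h1 := (TestFunction.integralAgainstBilinCLM (n := ⊤) (Ω := (⊤ : TopologicalSpace.Opens G))
      (ContinuousLinearMap.mul ℂ ℂ) ν (fun _ => (1 : ℂ))).continuous
    refine h1.congr fun φ => ?_
    rw [TestFunction.integralAgainstBilinCLM_eq_integral
      ((locallyIntegrable_const (1 : ℂ)).locallyIntegrableOn _)]
    simp
  refine hint.comp ?_
  induction List.finRange k with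
  | nil => exact continuous_id
  | cons j l ih =>
    simp only [List.foldr_cons]
    exact ((TestFunction.lineDerivCLM ℂ (X j)).continuous.iterate (i j)).comp ih

variable {μ} in
theorem diracPullback_add {L : G →L[ℝ] (Fin k → ℝ)} (hL : Function.Surjective L) (i : Fin k → ℕ)
    {φ φ' : G → ℂ} (hφ : ContDiff ℝ ∞ φ) (hc : HasCompactSupport φ) (hφ' : ContDiff ℝ ∞ φ')
    (hc' : HasCompactSupport φ') :
    diracPullback μ L i (φ + φ') = diracPullback μ L i φ + diracPullback μ L i φ' := by
  obtain ⟨g, hg⟩ := exists_isPushforward μ hL hφ hc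
  obtain ⟨g', hg'⟩ := exists_isPushforward μ hL hφ' hc'
  have hs : IsPushforward μ L (φ + φ') (g + g') := by
    refine ⟨hg.contDiff.add hg'.contDiff, hg.hasCompactSupport.add hg'.hasCompactSupport,
      fun ψ hψ => ?_⟩
    have hψL : Continuous fun Y => ψ (L Y) := hψ.comp L.continuous
    simp only [Pi.add_apply, mul_add]
    rw [integral_add, integral_add, hg.integral_eq ψ hψ, hg'.integral_eq ψ hψ]
    · exact (hψ.mul hg.contDiff.continuous).integrable_of_hasCompactSupport
        hg.hasCompactSupport.mul_left
    · exact (hψ.mul hg'.contDiff.continuous).integrable_of_hasCompactSupport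
        hg'.hasCompactSupport.mul_left
    · exact (hψL.mul hφ.continuous).integrable_of_hasCompactSupport hc.mul_left
    · exact (hψL.mul hφ'.continuous).integrable_of_hasCompactSupport hc'.mul_left
  rw [hs.diracPullback_eq, hg.diracPullback_eq, hg'.diracPullback_eq,
    mixedPartial_add i hg.contDiff hg'.contDiff, Pi.add_apply, mul_add]

variable {μ} in
theorem diracPullback_smul {L : G →L[ℝ] (Fin k → ℝ)} (hL : Function.Surjective L) (i : Fin k → ℕ)
    (c : ℂ) {φ : G → ℂ} (hφ : ContDiff ℝ ∞ φ) (hc : HasCompactSupport φ) :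
    diracPullback μ L i (c • φ) = c * diracPullback μ L i φ := by
  obtain ⟨g, hg⟩ := exists_isPushforward μ hL hφ hc
  have hs : IsPushforward μ L (c • φ) (c • g) := by
    refine ⟨hg.contDiff.const_smul c, hg.hasCompactSupport.smul_left (f := fun _ => c),
      fun ψ hψ => ?_⟩
    simp only [Pi.smul_apply, mul_smul_comm]
    rw [integral_smul, integral_smul, hg.integral_eq ψ hψ]
  rw [hs.diracPullback_eq, hg.diracPullback_eq, mixedPartial_smul i c hg.contDiff, Pi.smul_apply,
    smul_eq_mul, mul_left_comm]

-- By the substitution `X ↦ A X`, the push-forward of `ψ` under `L` is `|det A|` times that of `φ =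
-- ψ ∘ A` under `L ∘ A`. This is the Jacobian in the definition of equivariance.
variable {μ} in
theorem diracPullback_comp {L L' : G →L[ℝ] (Fin k → ℝ)} (hL' : Function.Surjective L')
    {A : G →L[ℝ] G} (hA : A.det ≠ 0) (hLL' : L.comp A = L') (i : Fin k → ℕ) {φ ψ : G → ℂ}
    (hφ : ContDiff ℝ ∞ φ) (hc : HasCompactSupport φ) (hψ : ∀ X, ψ (A X) = φ X) :
    diracPullback μ L i ψ = |A.det| * diracPullback μ L' i φ := by
  obtain ⟨g, hg⟩ := exists_isPushforward μ hL' hφ hc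
  have hs : IsPushforward μ L ψ (((|A.det| : ℝ) : ℂ) • g) := by
    refine ⟨hg.contDiff.const_smul ((|A.det| : ℝ) : ℂ), hg.hasCompactSupport.smul_left (f := fun _ => ((|A.det| : ℝ) : ℂ)),
      fun F hF => ?_⟩
    have h1 := integral_comp_of_det_ne_zero μ A hA (fun X => F (L X) * ψ X)
    have h2 : ∀ X, F (L (A X)) * ψ (A X) = F (L' X) * φ X := fun X => by
      rw [hψ, ← hLL']; rfl
    simp only [h2] at h1
    rw [hg.integral_eq F hF, eq_inv_smul_iff₀ (abs_ne_zero.2 hA)] at h1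
    simp only [Pi.smul_apply, mul_smul_comm]
    rw [integral_smul, ← h1, Complex.real_smul, smul_eq_mul]
  rw [hs.diracPullback_eq, hg.diracPullback_eq, mixedPartial_smul i _ hg.contDiff, Pi.smul_apply,
    smul_eq_mul, mul_left_comm]

end PushforwardSurjective

/-! ### Fourier inversion and moments. -/

section FourierMoments

variable {k : ℕ}

/-- The Fourier transform of `g` with the kernel `e^{-i⟨ξ, u⟩}`. -/
def angularFourier (g : (Fin k → ℝ) → ℂ) (ξ : Fin k → ℝ) : ℂ :=
  ∫ u, Complex.exp (-Complex.I * ((∑ j, ξ j * u j : ℝ) : ℂ)) * g u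

theorem contDiff_character (ξ : Fin k → ℝ) : ContDiff ℝ ∞ fun u : Fin k → ℝ =>
    Complex.exp (-Complex.I * ((∑ j, ξ j * u j : ℝ) : ℂ)) := by
  refine ContDiff.cexp (contDiff_const.mul (Complex.ofRealCLM.contDiff.comp ?_))
  exact ContDiff.sum (s := Finset.univ) (f := fun j (u : Fin k → ℝ) => ξ j * u j)
    fun j _ => contDiff_const.mul (contDiff_apply ℝ ℝ j)

theorem fderiv_character (ξ u : Fin k → ℝ) (j : Fin k) :
    fderiv ℝ (fun u : Fin k → ℝ => Complex.exp (-Complex.I * ((∑ j, ξ j * u j : ℝ) : ℂ))) u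
      (Pi.single j 1) =
      -(Complex.I * ξ j) * Complex.exp (-Complex.I * ((∑ j, ξ j * u j : ℝ) : ℂ)) := by
  have hd := (contDiff_character ξ).differentiable (by simp) u
  have h1 : HasDerivAt (fun t : ℝ => u + t • (Pi.single j 1 : Fin k → ℝ)) (Pi.single j 1) 0 := by
    simpa using! ((hasDerivAt_id (0 : ℝ)).smul_const (Pi.single j (1 : ℝ) : Fin k → ℝ)).const_add u
  have hd0 := hd.hasFDerivAt
  rw [show u = u + (0 : ℝ) • (Pi.single j 1 : Fin k → ℝ) by rw [zero_smul, add_zero]] at hd0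
  have h2 := hd0.comp_hasDerivAt 0 h1
  have h3 : ∀ t : ℝ, (∑ l, ξ l * (u + t • (Pi.single j 1 : Fin k → ℝ)) l) =
      (∑ l, ξ l * u l) + t * ξ j := fun t => by
    simp [mul_add, Finset.sum_add_distrib, Pi.single_apply, mul_comm]
  have h4 : HasDerivAt (fun t : ℝ => Complex.exp (-Complex.I *
      ((∑ l, ξ l * (u + t • (Pi.single j 1 : Fin k → ℝ)) l : ℝ) : ℂ)))
      (Complex.exp (-Complex.I * ((∑ l, ξ l * u l : ℝ) : ℂ)) * (-(Complex.I * ξ j))) 0 := by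
    simp only [h3]
    have h5 : HasDerivAt (fun t : ℝ => -Complex.I * (((∑ l, ξ l * u l) + t * ξ j : ℝ) : ℂ))
        (-(Complex.I * ξ j)) 0 := by
      have := (((hasDerivAt_id (0 : ℝ)).mul_const (ξ j)).const_add
        (∑ l, ξ l * u l)).ofReal_comp.const_mul (-Complex.I)
      simpa using this
    simpa using h5.cexp
  rw [zero_smul, add_zero] at h2
  rw [mul_comm]
  exact h2.unique h4

theorem angularFourier_partialDeriv {g : (Fin k → ℝ) → ℂ} (hg : ContDiff ℝ ∞ g)
    (hc : HasCompactSupport g) (j : Fin k) (ξ : Fin k → ℝ) :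
    angularFourier (partialDeriv j g) ξ = Complex.I * ξ j * angularFourier g ξ := by
  have hcd : HasCompactSupport (partialDeriv j g) := hc.fderiv_apply (𝕜 := ℝ) _
  have hchar := contDiff_character ξ
  have hdchar : Continuous fun u : Fin k → ℝ => fderiv ℝ (fun u : Fin k → ℝ =>
      Complex.exp (-Complex.I * ((∑ j, ξ j * u j : ℝ) : ℂ))) u (Pi.single j 1) :=
    ((hchar.fderiv_right (m := ∞) (by simp)).clm_apply contDiff_const).continuous
  unfold angularFourier partialDeriv
  rw [integral_mul_fderiv_eq_neg_fderiv_mul_of_integrable]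
  · simp only [fderiv_character, mul_assoc (-(Complex.I * (ξ j : ℂ)))]
    rw [integral_const_mul, neg_mul, neg_neg]
  · exact (hdchar.mul hg.continuous).integrable_of_hasCompactSupport hc.mul_left
  · exact (hchar.continuous.mul (contDiff_partialDeriv hg j).continuous
      ).integrable_of_hasCompactSupport hcd.mul_left
  · exact (hchar.continuous.mul hg.continuous).integrable_of_hasCompactSupport hc.mul_left
  · exact fun u _ => hchar.contDiffAt.differentiableAt (by simp)
  · exact fun u _ => hg.contDiffAt.differentiableAt (by simp)

/-- Inversion for Schwartz functions on Euclidean space, in the normalization `e^{-2πi⟨v, w⟩}`,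
evaluated at `0`. Rescaling the frequency by `2π` to the kernel `e^{-i⟨ξ, u⟩}` gives the factor
`(2π)^k`. -/
theorem angularFourier_inversion {g : (Fin k → ℝ) → ℂ} (hg : ContDiff ℝ ∞ g)
    (hc : HasCompactSupport g) :
    Integrable (angularFourier g) ∧ ∫ ξ, angularFourier g ξ = (2 * Real.pi : ℂ) ^ k * g 0 := by
  let e := EuclideanSpace.equiv (Fin k) ℝ
  have hmp := PiLp.volume_preserving_ofLp (Fin k)
  have hg' : ContDiff ℝ ∞ (g ∘ e) := hg.comp e.contDiff
  have hc' : HasCompactSupport (g ∘ e) := hc.comp_homeomorph e.toHomeomorph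
  let f : SchwartzMap (EuclideanSpace ℝ (Fin k)) ℂ := hc'.toSchwartzMap hg'
  have hF : ∀ w : EuclideanSpace ℝ (Fin k), FourierTransform.fourier (f : EuclideanSpace ℝ (Fin k) → ℂ) w =
      angularFourier g ((2 * Real.pi) • e w) := fun w => by
    rw [Real.fourier_eq', angularFourier, ← hmp.integral_comp e.toHomeomorph.measurableEmbedding]
    refine integral_congr_ae (Eventually.of_forall fun v => ?_)
    change _ • g (e v) = _ * g (e v)
    rw [smul_eq_mul]
    congr 2
    rw [PiLp.inner_apply]
    change _ = -Complex.I * ((∑ j, ((2 * Real.pi) • e w) j * e v j : ℝ) : ℂ)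
    have h1 : (∑ j, ((2 * Real.pi) • e w) j * e v j : ℝ) = 2 * Real.pi * ∑ j, w j * v j := by
      rw [Finset.mul_sum]
      refine Finset.sum_congr rfl fun j _ => ?_
      change 2 * Real.pi * w j * v j = _
      ring
    have h2 : (∑ j, inner ℝ (v j) (w j) : ℝ) = ∑ j, w j * v j :=
      Finset.sum_congr rfl fun j _ => by simp
    rw [h1, h2]
    push_cast
    ring
  have hpi : (2 * Real.pi : ℝ) ≠ 0 := by positivity
  have hint : Integrable (fun w : EuclideanSpace ℝ (Fin k) =>
      angularFourier g ((2 * Real.pi) • e w)) := by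
    have h1 := (FourierTransform.fourier f : SchwartzMap (EuclideanSpace ℝ (Fin k)) ℂ).integrable (μ := volume)
    exact h1.congr (Eventually.of_forall fun w => by
      rw [SchwartzMap.fourier_coe]; exact hF w)
  have hval : ∫ w : EuclideanSpace ℝ (Fin k), angularFourier g ((2 * Real.pi) • e w) = g 0 := by
    have h1 := congrArg (fun F : SchwartzMap (EuclideanSpace ℝ (Fin k)) ℂ => F 0)
      (show FourierTransformInv.fourierInv
        (FourierTransform.fourier f : SchwartzMap (EuclideanSpace ℝ (Fin k)) ℂ) = f from
          FourierTransform.fourierInv_fourier_eq f)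
    have h2 : f 0 = g 0 := by
      change g (e 0) = _
      rw [map_zero]
    simp only [h2] at h1
    rw [SchwartzMap.fourierInv_coe, Real.fourierInv_eq', SchwartzMap.fourier_coe] at h1
    simp only [hF] at h1
    simpa using h1
  have hint' : Integrable (fun ξ : Fin k → ℝ => angularFourier g ((2 * Real.pi) • ξ)) :=
    (hmp.integrable_comp_emb e.toHomeomorph.measurableEmbedding).1 hint
  refine ⟨(integrable_comp_smul_iff volume _ hpi).1 hint', ?_⟩
  have h3 := Measure.integral_comp_smul (volume : Measure (Fin k → ℝ)) (angularFourier g)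
    (2 * Real.pi)
  rw [← hmp.integral_comp e.toHomeomorph.measurableEmbedding] at h3
  have h4 : ∫ w : EuclideanSpace ℝ (Fin k), angularFourier g ((2 * Real.pi) • w.ofLp) = g 0 := hval
  rw [h4, Module.finrank_fin_fun, abs_of_nonneg (by positivity),
    eq_inv_smul_iff₀ (pow_ne_zero _ hpi)] at h3
  rw [← h3, Complex.real_smul]
  push_cast
  rfl

theorem foldr_mul_eq_prod (i : Fin k → ℕ) (c : Fin k → (Fin k → ℝ) → ℂ) :
    (List.finRange k).foldr (fun j b => (fun (b : (Fin k → ℝ) → ℂ) ξ => c j ξ * b ξ)^[i j] b)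
      (fun _ => 1) = fun ξ => ∏ j, c j ξ ^ i j := by
  have hit : ∀ (j : Fin k) (m : ℕ) (b : (Fin k → ℝ) → ℂ),
      (fun (b : (Fin k → ℝ) → ℂ) ξ => c j ξ * b ξ)^[m] b = fun ξ => c j ξ ^ m * b ξ := by
    intro j m
    induction m with
    | zero => intro b; simp
    | succ m ih => intro b; rw [Function.iterate_succ, Function.comp_apply, ih]; ext ξ; ring
  have : ∀ l : List (Fin k), l.foldr (fun j b => (fun (b : (Fin k → ℝ) → ℂ) ξ => c j ξ * b ξ)^[i j] b)
      (fun _ => 1) = fun ξ => (l.map fun j => c j ξ ^ i j).prod := by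
    intro l
    induction l with
    | nil => simp
    | cons j l ih => rw [List.foldr_cons, ih, hit]; simp
  rw [this]
  ext ξ
  rw [← List.ofFn_eq_map, List.prod_ofFn]

/-- The product of `(iξ)^i` and the transform of `g` is the transform of the mixed partial of `g`.
Replacing `i` by `-i` costs `(-1)^{|i|}`, and inversion evaluates the integral: the moments of the
transform are the pairings with derivatives of the Dirac distribution. -/
theorem integral_moment_angularFourier {g : (Fin k → ℝ) → ℂ} (hg : ContDiff ℝ ∞ g)
    (hc : HasCompactSupport g) (i : Fin k → ℕ) :
    Integrable (fun ξ : Fin k → ℝ => (∏ j, (-Complex.I * ξ j) ^ i j) * angularFourier g ξ) ∧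
      ∫ ξ : Fin k → ℝ, (∏ j, (-Complex.I * ξ j) ^ i j) * angularFourier g ξ =
        (2 * Real.pi : ℂ) ^ k * ((-1) ^ (∑ j, i j) * mixedPartial i g 0) := by
  have h := mixedPartial_induction i (fun j (b : (Fin k → ℝ) → ℂ) ξ => Complex.I * ξ j * b ξ)
    (fun (G : Unit → (Fin k → ℝ) → ℂ) b => ContDiff ℝ ∞ (G ()) ∧ HasCompactSupport (G ()) ∧
      ∀ ξ, angularFourier (G ()) ξ = b ξ * angularFourier g ξ)
    (fun j G b ⟨h1, h2, h3⟩ => ⟨contDiff_partialDeriv h1 j, h2.fderiv_apply (𝕜 := ℝ) _, fun ξ => by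
      rw [angularFourier_partialDeriv h1 h2, h3, mul_assoc, mul_assoc, mul_assoc]⟩)
    (G := fun _ => g) (b := fun _ => 1) ⟨hg, hc, by simp⟩
  rw [foldr_mul_eq_prod i fun j ξ => Complex.I * ξ j] at h
  obtain ⟨h1, h2, h3⟩ := h
  obtain ⟨h4, h5⟩ := angularFourier_inversion h1 h2
  have h6 : ∀ ξ : Fin k → ℝ, (∏ j, (-Complex.I * ξ j) ^ i j) * angularFourier g ξ =
      (-1) ^ (∑ j, i j) * angularFourier (mixedPartial i g) ξ := fun ξ => by
    rw [h3, ← mul_assoc, ← Finset.prod_pow_eq_pow_sum, ← Finset.prod_mul_distrib]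
    congr 1
    refine Finset.prod_congr rfl fun j _ => ?_
    rw [← mul_pow]; ring
  simp only [h6]
  refine ⟨h4.const_mul _, ?_⟩
  rw [integral_const_mul]
  refine (congrArg _ h5).trans ?_
  ring

end FourierMoments

/-! ### Forms in charts. -/

section FiniteDimensionalForms

variable {F : Type*} [NormedAddCommGroup F] [NormedSpace ℝ F] [FiniteDimensional ℝ F]

instance finiteDimensional_alternating (n : ℕ) : FiniteDimensional ℝ (F [⋀^Fin n]→L[ℝ] ℂ) :=
  FiniteDimensional.of_injective
    (ContinuousMultilinearMap.toMultilinearMapLinear ∘ₗ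
      ContinuousAlternatingMap.toContinuousMultilinearMapLinear :
      (F [⋀^Fin n]→L[ℝ] ℂ) →ₗ[ℝ] MultilinearMap ℝ (fun _ : Fin n => F) ℂ)
    (fun a b h => by
      ext v
      exact congrArg (fun f : MultilinearMap ℝ (fun _ : Fin n => F) ℂ => f v) h)

end FiniteDimensionalForms

section CoordForm

variable {EM : Type*} [NormedAddCommGroup EM] [NormedSpace ℝ EM]
  {M : Type*} [TopologicalSpace M] [ChartedSpace EM M]

/-- The expression of a `1`-form in the preferred chart around `x₀`. -/
def coordForm (α : (x : M) → (TangentSpace 𝓘(ℝ, EM) x →L[ℝ] ℝ)) (x₀ : M) (y : EM) : EM →L[ℝ] ℝ :=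
  (α ((extChartAt 𝓘(ℝ, EM) x₀).symm y)).comp
    (mfderivWithin 𝓘(ℝ, EM) 𝓘(ℝ, EM) (extChartAt 𝓘(ℝ, EM) x₀).symm (range 𝓘(ℝ, EM)) y)

theorem formInChart_covectorForm (α : (x : M) → (TangentSpace 𝓘(ℝ, EM) x →L[ℝ] ℝ)) (x₀ : M) :
    formInChart 𝓘(ℝ, EM) (fun x => covectorForm (α x)) x₀ =
      fun y => covectorForm (coordForm α x₀ y) := rfl

variable [IsManifold 𝓘(ℝ, EM) ∞ M]

/-- The link between smoothness of a section of the cotangent bundle and smoothness of its chart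
expression: the bundle coordinate is the composition with the derivative of the inverse chart, as in
`formInChart`. -/
theorem cotangent_trivializationAt_snd (x₀ : M) (p : Cotangent EM M)
    (hp : p.1 ∈ (chartAt EM x₀).source) :
    (trivializationAt (EM →L[ℝ] ℝ) (fun x : M => TangentSpace 𝓘(ℝ, EM) x →L[ℝ] ℝ) x₀ p).2 =
      p.2.comp (mfderivWithin 𝓘(ℝ, EM) 𝓘(ℝ, EM) (extChartAt 𝓘(ℝ, EM) x₀).symm (range 𝓘(ℝ, EM))
        (extChartAt 𝓘(ℝ, EM) x₀ p.1)) := by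
  rw [hom_trivializationAt_apply]
  change ContinuousLinearMap.inCoordinates _ _ _ _ _ _ _ _ _ = _
  rw [ContinuousLinearMap.inCoordinates, TangentBundle.symmL_trivializationAt hp]
  ext v
  simp
  rfl

theorem contDiffAt_coordForm {α : (x : M) → (TangentSpace 𝓘(ℝ, EM) x →L[ℝ] ℝ)} {U : Set M}
    (hU : IsOpen U)
    (hα : ContMDiffOn 𝓘(ℝ, EM) (cotModel EM) ∞ (fun x => (⟨x, α x⟩ : Cotangent EM M)) U)
    (x₀ : M) {y : EM} (hy : y ∈ (extChartAt 𝓘(ℝ, EM) x₀).target)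
    (hyU : (extChartAt 𝓘(ℝ, EM) x₀).symm y ∈ U) :
    ContDiffAt ℝ ∞ (coordForm α x₀) y := by
  have hs : (extChartAt 𝓘(ℝ, EM) x₀).symm y ∈ (chartAt EM x₀).source := by
    simpa using (extChartAt 𝓘(ℝ, EM) x₀).map_target hy
  have h1 := hα.contMDiffAt (hU.mem_nhds hyU)
  rw [Bundle.Trivialization.contMDiffAt_section_iff
    (trivializationAt (EM →L[ℝ] ℝ) (fun x : M => TangentSpace 𝓘(ℝ, EM) x →L[ℝ] ℝ) x₀)
    (by simpa [hom_trivializationAt_baseSet] using! hs)] at h1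
  have h2 : ContMDiffAt 𝓘(ℝ, EM) 𝓘(ℝ, EM) ∞ (extChartAt 𝓘(ℝ, EM) x₀).symm y :=
    (contMDiffOn_extChartAt_symm x₀).contMDiffAt ((isOpen_extChartAt_target x₀).mem_nhds hy)
  have h3 := (h1.comp y h2).contDiffAt
  refine h3.congr_of_eventuallyEq ?_
  filter_upwards [(isOpen_extChartAt_target x₀).mem_nhds hy] with z hz
  have hs : (extChartAt 𝓘(ℝ, EM) x₀).symm z ∈ (chartAt EM x₀).source := by
    simpa using (extChartAt 𝓘(ℝ, EM) x₀).map_target hz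
  simp only [Function.comp_apply]
  rw [cotangent_trivializationAt_snd x₀ _ hs, (extChartAt 𝓘(ℝ, EM) x₀).right_inv hz]
  rfl

end CoordForm

/-! ### Naturality of the exterior derivative. -/

section Naturality

variable {EM : Type*} [NormedAddCommGroup EM] [NormedSpace ℝ EM]
  {M : Type*} [TopologicalSpace M] [ChartedSpace EM M]
  {G : Type*} [NormedAddCommGroup G] [NormedSpace ℝ G]

/-- Tangent spaces at propositionally equal points are distinct types. Treating derivatives as maps
into the model space lets base point and derivative be replaced together, without transport. -/
theorem FormField.comp_congr {n : ℕ} (η : FormField 𝓘(ℝ, EM) M n) {x x' : M} (h : x = x')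
    {L L' : G →L[ℝ] EM} (hL : L = L') :
    (η x).compContinuousLinearMap L = (η x').compContinuousLinearMap L' := by
  subst h hL; rfl

theorem formInChart_eq {n : ℕ} (η : FormField 𝓘(ℝ, EM) M n) (x₀ : M) (y : EM) :
    formInChart 𝓘(ℝ, EM) η x₀ y = (η ((extChartAt 𝓘(ℝ, EM) x₀).symm y)).compContinuousLinearMap
      (mfderiv 𝓘(ℝ, EM) 𝓘(ℝ, EM) (extChartAt 𝓘(ℝ, EM) x₀).symm y) := by
  unfold formInChart
  simp only [ModelWithCorners.range_eq_univ, mfderivWithin_univ]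
  rfl

variable [IsManifold 𝓘(ℝ, EM) ∞ M]

/-- The exterior derivative commutes with pull-back under a smooth map from a vector space. -/
theorem extDeriv_pullback_manifold {n : ℕ} (η : FormField 𝓘(ℝ, EM) M n) {Ψ : G → M} {y : G}
    (hΨ : ContMDiffAt 𝓘(ℝ, G) 𝓘(ℝ, EM) ∞ Ψ y)
    (hη : DifferentiableAt ℝ (formInChart 𝓘(ℝ, EM) η (Ψ y)) (extChartAt 𝓘(ℝ, EM) (Ψ y) (Ψ y))) :
    extDeriv (fun z => (η (Ψ z)).compContinuousLinearMap
        (mfderiv 𝓘(ℝ, G) 𝓘(ℝ, EM) Ψ z)) y =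
      (mextDeriv 𝓘(ℝ, EM) η (Ψ y)).compContinuousLinearMap (mfderiv 𝓘(ℝ, G) 𝓘(ℝ, EM) Ψ y) := by
  have hΨ' : ∀ᶠ z in 𝓝 y, MDifferentiableAt 𝓘(ℝ, G) 𝓘(ℝ, EM) Ψ z := by
    have : ContMDiffAt 𝓘(ℝ, G) 𝓘(ℝ, EM) 1 Ψ y := hΨ.of_le (by simp)
    filter_upwards [(contMDiffAt_iff_contMDiffAt_nhds (by simp)).1 this] with z hz
    exact hz.mdifferentiableAt one_ne_zero
  have hs : ∀ᶠ z in 𝓝 y, Ψ z ∈ (extChartAt 𝓘(ℝ, EM) (Ψ y)).source :=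
    hΨ.continuousAt.preimage_mem_nhds (extChartAt_source_mem_nhds (Ψ y))
  set f : G → EM := fun z => extChartAt 𝓘(ℝ, EM) (Ψ y) (Ψ z) with hf
  have hfd : ContDiffAt ℝ ∞ f y :=
    ((contMDiffAt_extChartAt (x := Ψ y)).comp y hΨ).contDiffAt
  have hfz : ∀ z, MDifferentiableAt 𝓘(ℝ, G) 𝓘(ℝ, EM) Ψ z →
      Ψ z ∈ (extChartAt 𝓘(ℝ, EM) (Ψ y)).source → fderiv ℝ f z =
        ((mfderiv 𝓘(ℝ, EM) 𝓘(ℝ, EM) (extChartAt 𝓘(ℝ, EM) (Ψ y)) (Ψ z)).comp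
          (mfderiv 𝓘(ℝ, G) 𝓘(ℝ, EM) Ψ z) : G →L[ℝ] EM) := by
    intro z hz hzs
    rw [← mfderiv_eq_fderiv]
    exact mfderiv_comp z (mdifferentiableAt_extChartAt (by simpa using hzs)) hz
  -- Near `y`, pulling back along `Ψ` is pulling back the chart expression of `η` along the chart
  -- reading `f` of `Ψ`; the statement for vector spaces then applies.
  have key : (fun z => (η (Ψ z)).compContinuousLinearMap (mfderiv 𝓘(ℝ, G) 𝓘(ℝ, EM) Ψ z)) =ᶠ[𝓝 y]
      fun z => (formInChart 𝓘(ℝ, EM) η (Ψ y) (f z)).compContinuousLinearMap (fderiv ℝ f z) := by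
    filter_upwards [hΨ', hs] with z hz hzs
    rw [formInChart_eq, hfz z hz hzs]
    have e1 : (extChartAt 𝓘(ℝ, EM) (Ψ y)).symm (f z) = Ψ z :=
      (extChartAt 𝓘(ℝ, EM) (Ψ y)).left_inv hzs
    have e2 := mfderivWithin_extChartAt_symm_comp_mfderiv_extChartAt' (I := 𝓘(ℝ, EM)) hzs
    simp only [ModelWithCorners.range_eq_univ, mfderivWithin_univ] at e2
    refine (FormField.comp_congr η e1.symm (?_ : _ =
      ((mfderiv 𝓘(ℝ, EM) 𝓘(ℝ, EM) (extChartAt 𝓘(ℝ, EM) (Ψ y)).symm (f z)).comp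
      ((mfderiv 𝓘(ℝ, EM) 𝓘(ℝ, EM) (extChartAt 𝓘(ℝ, EM) (Ψ y)) (Ψ z)).comp
          (mfderiv 𝓘(ℝ, G) 𝓘(ℝ, EM) Ψ z)) : G →L[ℝ] EM)))
    ext v
    exact (DFunLike.congr_fun e2 (mfderiv 𝓘(ℝ, G) 𝓘(ℝ, EM) Ψ z v)).symm
  have h1 := extDeriv_pullback (𝕜 := ℝ) (f := f) (x := y)
    (show DifferentiableAt ℝ (formInChart 𝓘(ℝ, EM) η (Ψ y)) (f y) from hη) hfd
    (by rw [minSmoothness_of_isRCLikeNormedField]; exact WithTop.coe_le_coe.2 le_top)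
  rw [key.extDeriv_eq]
  refine h1.trans ?_
  rw [hfz y hΨ'.self_of_nhds hs.self_of_nhds]
  unfold mextDeriv
  simp only [ModelWithCorners.range_eq_univ, extDerivWithin_univ]
  rfl

/-- `mextDeriv` uses a different preferred chart at each point. Naturality, applied to the inverse
of one fixed chart, shows that a single chart computes it throughout its domain. -/
theorem formInChart_mextDeriv {n : ℕ} (η : FormField 𝓘(ℝ, EM) M n) (x₀ : M) {y : EM}
    (hy : y ∈ (extChartAt 𝓘(ℝ, EM) x₀).target)
    (hη : DifferentiableAt ℝ (formInChart 𝓘(ℝ, EM) η ((extChartAt 𝓘(ℝ, EM) x₀).symm y))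
      (extChartAt 𝓘(ℝ, EM) ((extChartAt 𝓘(ℝ, EM) x₀).symm y) ((extChartAt 𝓘(ℝ, EM) x₀).symm y))) :
    formInChart 𝓘(ℝ, EM) (mextDeriv 𝓘(ℝ, EM) η) x₀ y =
      extDeriv (formInChart 𝓘(ℝ, EM) η x₀) y := by
  have h2 : ContMDiffAt 𝓘(ℝ, EM) 𝓘(ℝ, EM) ∞ (extChartAt 𝓘(ℝ, EM) x₀).symm y :=
    (contMDiffOn_extChartAt_symm x₀).contMDiffAt ((isOpen_extChartAt_target x₀).mem_nhds hy)
  have := extDeriv_pullback_manifold η h2 hη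
  rw [formInChart_eq, ← this]
  congr 1
  ext1 z
  exact (formInChart_eq η x₀ z).symm

end Naturality

/-! ### Smooth families of alternating forms. -/

section Smoothness

variable {F : Type*} [NormedAddCommGroup F] [NormedSpace ℝ F]
  {V : Type*} [NormedAddCommGroup V] [NormedSpace ℝ V]

/-- An alternating form is recovered linearly from its finitely many values on basis vectors, so
smoothness of all evaluations suffices. -/
theorem contDiffAt_alternating_of_apply [FiniteDimensional ℝ V] {n : ℕ} {f : F → V [⋀^Fin n]→L[ℝ] ℂ} {y : F}
    (h : ∀ v, ContDiffAt ℝ ∞ (fun z => f z v) y) : ContDiffAt ℝ ∞ f y := by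
  let b := Module.finBasis ℝ V
  let Λ : (V [⋀^Fin n]→L[ℝ] ℂ) →ₗ[ℝ] ((Fin n → Fin (Module.finrank ℝ V)) → ℂ) :=
    { toFun := fun a s => a fun i => b (s i)
      map_add' := fun _ _ => rfl
      map_smul' := fun _ _ => rfl }
  have hinj : Function.Injective Λ := by
    intro a a' haa
    apply ContinuousAlternatingMap.toAlternatingMap_injective
    apply AlternatingMap.coe_multilinearMap_injective
    exact Module.Basis.ext_multilinear (fun _ => b) fun s => congrFun haa s
  obtain ⟨Λ', hΛ'⟩ := LinearMap.exists_leftInverse_of_injective Λ (LinearMap.ker_eq_bot.2 hinj)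
  have h1 : f = fun z => (LinearMap.toContinuousLinearMap Λ') (Λ (f z)) := by
    ext1 z
    exact (LinearMap.congr_fun hΛ' (f z)).symm
  rw [h1]
  refine (LinearMap.toContinuousLinearMap Λ').contDiff.contDiffAt.comp y ?_
  exact contDiffAt_pi.2 fun s => h _

theorem ContDiffAt.alternating_apply [FiniteDimensional ℝ V] {n : ℕ} {f : F → V [⋀^Fin n]→L[ℝ] ℂ} {y : F}
    (h : ContDiffAt ℝ ∞ f y) (v : Fin n → V) : ContDiffAt ℝ ∞ (fun z => f z v) y := by
  let Λ : (V [⋀^Fin n]→L[ℝ] ℂ) →ₗ[ℝ] ℂ :=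
    { toFun := fun a => a v
      map_add' := fun _ _ => rfl
      map_smul' := fun _ _ => rfl }
  exact (LinearMap.toContinuousLinearMap Λ).contDiff.contDiffAt.comp y h

/-- Smoothness of a family of inhomogeneous forms at a point. -/
def ContDiffAtForm (f : F → GradedForm V) (y : F) : Prop :=
  ∀ n v, ContDiffAt ℝ ∞ (fun z => f z n v) y

namespace ContDiffAtForm

open GradedForm

variable {f g : F → GradedForm V} {y : F}

theorem mul (hf : ContDiffAtForm f y) (hg : ContDiffAtForm g y) :
    ContDiffAtForm (fun z => f z * g z) y := by
  intro n v
  simp only [← mul_eq, mul_apply]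
  refine ContDiffAt.sum fun x _ => contDiffAt_const.mul (ContDiffAt.sum fun σ _ =>
    contDiffAt_const.mul ((hf _ _).mul (hg _ _)))

theorem const (a : GradedForm V) : ContDiffAtForm (fun _ : F => a) y :=
  fun _ _ => contDiffAt_const

theorem smul {c : F → ℂ} (hc : ContDiffAt ℝ ∞ c y) (hf : ContDiffAtForm f y) :
    ContDiffAtForm (fun z => c z • f z) y :=
  fun n v => hc.mul (hf n v)

theorem sum {ι : Type*} {s : Finset ι} {f : ι → F → GradedForm V}
    (h : ∀ i ∈ s, ContDiffAtForm (f i) y) : ContDiffAtForm (fun z => ∑ i ∈ s, f i z) y := by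
  intro n v
  have : (fun z => (∑ i ∈ s, f i z) n v) = fun z => ∑ i ∈ s, f i z n v := by
    ext1 z
    rw [Finset.sum_apply, ContinuousAlternatingMap.sum_apply]
  rw [this]
  exact ContDiffAt.sum fun i hi => h i hi n v

theorem pow (hf : ContDiffAtForm f y) (m : ℕ) : ContDiffAtForm (fun z => f z ^ m) y := by
  induction m with
  | zero => simpa using const 1
  | succ m ih => simpa [pow_succ] using ih.mul hf

theorem prod_ofFn {k : ℕ} {f : Fin k → F → GradedForm V} (h : ∀ j, ContDiffAtForm (f j) y) :
    ContDiffAtForm (fun z => (List.ofFn fun j => f j z).prod) y := by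
  induction k with
  | zero => simpa using const 1
  | succ k ih =>
    simp only [List.ofFn_succ, List.prod_cons]
    exact (h 0).mul (ih fun j => h j.succ)

theorem homog [FiniteDimensional ℝ V] {m : ℕ} {a : F → V [⋀^Fin m]→L[ℝ] ℂ} (ha : ContDiffAt ℝ ∞ a y) :
    ContDiffAtForm (fun z => homog m (a z)) y := by
  intro n v
  by_cases h : n = m
  · subst h
    simpa only [homog_self] using ha.alternating_apply v
  · simp only [homog_of_ne h]
    exact contDiffAt_const

end ContDiffAtForm

theorem ContDiffAt.covectorForm [FiniteDimensional ℝ V] {a : F → V →L[ℝ] ℝ} {y : F} (ha : ContDiffAt ℝ ∞ a y) :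
    ContDiffAt ℝ ∞ (fun z => covectorForm (a z)) y :=
  contDiffAt_alternating_of_apply fun _ =>
    Complex.ofRealCLM.contDiff.contDiffAt.comp y (ha.clm_apply contDiffAt_const)

theorem ContDiffAt.extDeriv [FiniteDimensional ℝ V] {n : ℕ} {η : V → V [⋀^Fin n]→L[ℝ] ℂ} {y : V}
    (h : ContDiffAt ℝ ∞ η y) : ContDiffAt ℝ ∞ (extDeriv η) y := by
  have h1 : ContDiffAt ℝ ∞ (fderiv ℝ η) y := h.fderiv_right (m := ∞) (by simp)
  refine contDiffAt_alternating_of_apply fun v => ?_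
  simp only [_root_.extDeriv, ContinuousAlternatingMap.alternatizeUncurryFin_apply]
  refine ContDiffAt.sum fun i _ => ContDiffAt.const_smul _ ?_
  exact (h1.clm_apply contDiffAt_const).alternating_apply _

end Smoothness

/-! ### Smoothness of fundamental vector fields. -/

section Action

variable {EM : Type*} [NormedAddCommGroup EM] [NormedSpace ℝ EM]
  {M : Type*} [TopologicalSpace M] [ChartedSpace EM M]
  {EH : Type*} [NormedAddCommGroup EH] [NormedSpace ℝ EH]
  {H : Type*} [TopologicalSpace H] [ChartedSpace EH H] [Group H] [MulAction H M]

theorem contMDiff_const_act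
    (hact : ContMDiff (𝓘(ℝ, EH).prod 𝓘(ℝ, EM)) 𝓘(ℝ, EM) ∞ (fun p : H × M => p.1 • p.2)) (h : H) :
    ContMDiff 𝓘(ℝ, EM) 𝓘(ℝ, EM) ∞ (fun x : M => h • x) :=
  hact.comp (contMDiff_const.prodMk contMDiff_id)

theorem contMDiff_act_const
    (hact : ContMDiff (𝓘(ℝ, EH).prod 𝓘(ℝ, EM)) 𝓘(ℝ, EM) ∞ (fun p : H × M => p.1 • p.2)) (x : M) :
    ContMDiff 𝓘(ℝ, EH) 𝓘(ℝ, EM) ∞ (fun h : H => h • x) :=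
  hact.comp (contMDiff_id.prodMk contMDiff_const)

variable [IsManifold 𝓘(ℝ, EM) ∞ M] [LieGroup 𝓘(ℝ, EH) ∞ H]

/-- The fundamental vector fields depend smoothly on the point, in the preferred chart around
`x₀`. -/
theorem exists_contDiffAt_fundamentalField
    (hact : ContMDiff (𝓘(ℝ, EH).prod 𝓘(ℝ, EM)) 𝓘(ℝ, EM) ∞ (fun p : H × M => p.1 • p.2))
    (x₀ : M) {y : EM} (hy : y ∈ (extChartAt 𝓘(ℝ, EM) x₀).target) :
    ∃ V : EM → EH →L[ℝ] EM, ContDiffAt ℝ ∞ V y ∧ ∀ᶠ z in 𝓝 y, ∀ X : EH,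
      (mfderiv 𝓘(ℝ, EM) 𝓘(ℝ, EM) (extChartAt 𝓘(ℝ, EM) x₀).symm z (V z X) : EM) =
        fundamentalField 𝓘(ℝ, EM) (fun (h : H) (x : M) => h • x) X
          ((extChartAt 𝓘(ℝ, EM) x₀).symm z) := by
  set e := extChartAt 𝓘(ℝ, EM) x₀ with he
  set c := extChartAt 𝓘(ℝ, EH) (1 : H) with hc
  set u₁ : EH := c 1 with hu₁
  have hc1 : c.symm u₁ = 1 := c.left_inv (mem_extChartAt_source _)
  have hu₁t : u₁ ∈ c.target := mem_extChartAt_target _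
  -- The action read in charts of both `H` and `M`; its partial derivative in the group variable at
  -- the identity is the fundamental field in coordinates.
  let W : EM → EH → EM := fun z u => e (c.symm u • e.symm z)
  have hc2 : ContMDiffAt 𝓘(ℝ, EH) 𝓘(ℝ, EH) ∞ c.symm u₁ :=
    (contMDiffOn_extChartAt_symm (1 : H)).contMDiffAt ((isOpen_extChartAt_target _).mem_nhds hu₁t)
  have hsrc : ∀ z ∈ e.target, (c.symm u₁ • e.symm z : M) ∈ (chartAt EM x₀).source := by
    intro z hz
    rw [hc1, one_smul]
    simpa [he] using e.map_target hz
  have hW : ContDiffAt ℝ ∞ (Function.uncurry W) (y, u₁) := by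
    have h1 : ContMDiffAt 𝓘(ℝ, EM × EH) 𝓘(ℝ, EM) ∞
        (fun p : EM × EH => (c.symm p.2 • e.symm p.1 : M)) (y, u₁) := by
      have hy2 : ContMDiffAt 𝓘(ℝ, EM) 𝓘(ℝ, EM) ∞ e.symm y :=
        (contMDiffOn_extChartAt_symm x₀).contMDiffAt ((isOpen_extChartAt_target x₀).mem_nhds hy)
      have h2 : ContMDiffAt 𝓘(ℝ, EM × EH) 𝓘(ℝ, EM) ∞ (fun p : EM × EH => e.symm p.1) (y, u₁) :=
        hy2.comp (y, u₁) contDiff_fst.contMDiff.contMDiffAt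
      have h3 : ContMDiffAt 𝓘(ℝ, EM × EH) 𝓘(ℝ, EH) ∞ (fun p : EM × EH => c.symm p.2) (y, u₁) :=
        hc2.comp (y, u₁) contDiff_snd.contMDiff.contMDiffAt
      exact hact.contMDiffAt.comp (y, u₁) (h3.prodMk h2)
    exact ((contMDiffAt_extChartAt' (hsrc y hy)).comp (y, u₁) h1).contDiffAt
  refine ⟨fun z => fderiv ℝ (W z) u₁, ?_, ?_⟩
  · exact ContDiffAt.fderiv hW contDiffAt_const (by simp)
  · filter_upwards [(isOpen_extChartAt_target x₀).mem_nhds hy] with z hz X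
    have hd1 : MDifferentiableAt 𝓘(ℝ, EH) 𝓘(ℝ, EM) (fun h : H => (h • e.symm z : M))
        (c.symm u₁) :=
      (contMDiff_act_const hact (e.symm z)).contMDiffAt.mdifferentiableAt (by simp)
    have hd2 : MDifferentiableAt 𝓘(ℝ, EH) 𝓘(ℝ, EH) c.symm u₁ :=
      hc2.mdifferentiableAt (by simp)
    have hd3 : DifferentiableAt ℝ (W z) u₁ := by
      have hWz : ContMDiffAt 𝓘(ℝ, EH) 𝓘(ℝ, EM) ∞ (fun u => (c.symm u • e.symm z : M)) u₁ :=
        ((contMDiff_act_const hact (e.symm z)).contMDiffAt.comp u₁ hc2)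
      exact ((contMDiffAt_extChartAt' (hsrc z hz)).comp u₁ hWz).contDiffAt.differentiableAt (by simp)
    have hWz : W z u₁ = z := by
      change e (c.symm u₁ • e.symm z) = z
      rw [hc1, one_smul, e.right_inv hz]
    have hd4 : MDifferentiableAt 𝓘(ℝ, EM) 𝓘(ℝ, EM) e.symm (W z u₁) := by
      rw [hWz]
      exact ((contMDiffOn_extChartAt_symm (n := ∞) x₀).contMDiffAt
        ((isOpen_extChartAt_target x₀).mem_nhds hz)).mdifferentiableAt (by simp)
    have h1 := mfderiv_comp u₁ hd1 hd2
    have h2 := mfderiv_comp u₁ hd4 hd3.mdifferentiableAt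
    have h3 : (e.symm ∘ W z) =ᶠ[𝓝 u₁] ((fun h : H => (h • e.symm z : M)) ∘ c.symm) := by
      have : ContinuousAt (fun u => (c.symm u • e.symm z : M)) u₁ :=
        ((contMDiff_act_const hact (e.symm z)).contMDiffAt.comp u₁ hc2).continuousAt
      filter_upwards [this.preimage_mem_nhds ((chartAt EM x₀).open_source.mem_nhds (hsrc z hz))]
        with u hu
      exact e.left_inv (by simpa [he] using hu)
    have h4 : (mfderiv 𝓘(ℝ, EH) 𝓘(ℝ, EM) (e.symm ∘ W z) u₁ : EH →L[ℝ] EM) =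
      mfderiv 𝓘(ℝ, EH) 𝓘(ℝ, EM) ((fun h : H => (h • e.symm z : M)) ∘ c.symm) u₁ := h3.mfderiv_eq
    have h5 : (mfderiv 𝓘(ℝ, EM) 𝓘(ℝ, EM) e.symm (W z u₁) : EM →L[ℝ] EM) =
        mfderiv 𝓘(ℝ, EM) 𝓘(ℝ, EM) e.symm z := by
      have : ∀ z', z' = z → (mfderiv 𝓘(ℝ, EM) 𝓘(ℝ, EM) e.symm z' : EM →L[ℝ] EM) =
          mfderiv 𝓘(ℝ, EM) 𝓘(ℝ, EM) e.symm z := by rintro _ rfl; rfl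
      exact this _ hWz
    have h6 : (mfderiv 𝓘(ℝ, EH) 𝓘(ℝ, EM) (fun h : H => (h • e.symm z : M)) (c.symm u₁) :
        EH →L[ℝ] EM) = mfderiv 𝓘(ℝ, EH) 𝓘(ℝ, EM) (fun h : H => (h • e.symm z : M)) 1 := by
      have : ∀ h', h' = 1 → (mfderiv 𝓘(ℝ, EH) 𝓘(ℝ, EM) (fun h : H => (h • e.symm z : M)) h' :
          EH →L[ℝ] EM) = mfderiv 𝓘(ℝ, EH) 𝓘(ℝ, EM) (fun h : H => (h • e.symm z : M)) 1 := by
        rintro _ rfl; rfl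
      exact this _ hc1
    have h7 : (mfderiv 𝓘(ℝ, EH) 𝓘(ℝ, EH) c.symm u₁ : EH →L[ℝ] EH) =
        ContinuousLinearMap.id ℝ EH := by
      have := mfderivWithin_range_extChartAt_symm (I := 𝓘(ℝ, EH)) (x := (1 : H))
      simp only [ModelWithCorners.range_eq_univ, mfderivWithin_univ] at this
      exact this
    have h8 : ((mfderiv 𝓘(ℝ, EM) 𝓘(ℝ, EM) e.symm (W z u₁) : EM →L[ℝ] EM)).comp
        (mfderiv 𝓘(ℝ, EH) 𝓘(ℝ, EM) (W z) u₁ : EH →L[ℝ] EM) =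
      (mfderiv 𝓘(ℝ, EH) 𝓘(ℝ, EM) (fun h : H => (h • e.symm z : M)) (c.symm u₁) :
        EH →L[ℝ] EM).comp (mfderiv 𝓘(ℝ, EH) 𝓘(ℝ, EH) c.symm u₁ : EH →L[ℝ] EH) :=
      h2.symm.trans (h4.trans h1)
    rw [h5, h6, h7] at h8
    have h9 := DFunLike.congr_fun h8 X
    rw [mfderiv_eq_fderiv] at h9
    exact h9

end Action

/-! ### The moment map: surjectivity and smooth dependence on the point. -/

theorem Submodule.eq_zero_of_sum_basis {k : ℕ} {V : Type*} [AddCommGroup V] [Module ℝ V]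
    {S : Submodule ℝ V} (β : Module.Basis (Fin k) ℝ S) {b : Fin k → V} (hb : ∀ j, (β j : V) = b j) (g : Fin k → ℝ) (hg : ∑ j, g j • b j = 0) (j : Fin k) :
    g j = 0 := by
  refine Fintype.linearIndependent_iff.1 β.linearIndependent g ?_ j
  apply Subtype.ext
  rw [AddSubmonoidClass.coe_finsetSum, ZeroMemClass.coe_zero, ← hg]
  exact (Finset.sum_congr rfl fun j _ => by rw [← hb j]; rfl)

section Moment

variable {EM : Type*} [NormedAddCommGroup EM] [NormedSpace ℝ EM]
  {M : Type*} [TopologicalSpace M] [ChartedSpace EM M]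
  {EH : Type*} [NormedAddCommGroup EH] [NormedSpace ℝ EH]
  (H : Type*) [TopologicalSpace H] [ChartedSpace EH H] [Group H] [MulAction H M] {k : ℕ}

/-- The moment map at `x`, as a continuous linear map. -/
def momentCLM (α : Fin k → (x : M) → (TangentSpace 𝓘(ℝ, EM) x →L[ℝ] ℝ)) (x : M) :
    EH →L[ℝ] (Fin k → ℝ) :=
  ContinuousLinearMap.pi fun j => -((α j x : EM →L[ℝ] ℝ).comp
    (mfderiv 𝓘(ℝ, EH) 𝓘(ℝ, EM) (fun h : H => h • x) 1 : EH →L[ℝ] EM))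

theorem coe_momentCLM (α : Fin k → (x : M) → (TangentSpace 𝓘(ℝ, EM) x →L[ℝ] ℝ)) (x : M) :
    (momentCLM H α x : EH → (Fin k → ℝ)) = momentMap H α x := rfl

variable {E : (x : M) → Submodule ℝ (TangentSpace 𝓘(ℝ, EM) x)}
  {o : (x : M) → Orientation ℝ (conormal E x) (Fin k)}

theorem IsPositive.eq_zero_of_sum {x : M} {b : Fin k → (TangentSpace 𝓘(ℝ, EM) x →L[ℝ] ℝ)}
    (hb : IsPositive o x b) (g : Fin k → ℝ) (hg : ∑ j, g j • b j = 0) (j : Fin k) : g j = 0 := by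
  obtain ⟨β, hβ, -⟩ := hb
  exact Submodule.eq_zero_of_sum_basis (V := TangentSpace 𝓘(ℝ, EM) x →L[ℝ] ℝ) β hβ g hg j
theorem IsPositive.mem_conormal {x : M} {b : Fin k → (TangentSpace 𝓘(ℝ, EM) x →L[ℝ] ℝ)}
    (hb : IsPositive o x b) (j : Fin k) : b j ∈ conormal E x := by
  obtain ⟨β, hβ, -⟩ := hb
  rw [← hβ j]
  exact (β j).2

/-- A nonzero functional vanishing on the range would give a combination of the `α_j` vanishing on
all orbit directions. The combination also vanishes on `E`, so it is zero by transversality, against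
the linear independence of the frame. -/
theorem momentCLM_surjective (htrans : IsTransverse EH H E)
    {α : Fin k → (x : M) → (TangentSpace 𝓘(ℝ, EM) x →L[ℝ] ℝ)} {x : M}
    (hα : IsPositive o x (fun j => α j x)) : Function.Surjective (momentCLM (EH := EH) H α x) := by
  by_contra hns
  have hlt : LinearMap.range (momentCLM (EH := EH) H α x : EH →ₗ[ℝ] (Fin k → ℝ)) < ⊤ := by
    rw [lt_top_iff_ne_top]
    exact fun h => hns (LinearMap.range_eq_top.1 h)
  obtain ⟨f, hf, hker⟩ := Submodule.exists_le_ker_of_lt_top _ hlt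
  have hfs : ∀ u, f u = ∑ j, f (Pi.single j 1) * u j := by
    intro u
    conv_lhs => rw [← Finset.univ_sum_single u, map_sum]
    refine Finset.sum_congr rfl fun j _ => ?_
    rw [show (Pi.single j (u j) : Fin k → ℝ) = u j • Pi.single j 1 by
      rw [← Pi.single_smul]; simp, map_smul, smul_eq_mul, mul_comm]
  have hz : ∑ j, f (Pi.single j 1) • α j x = 0 := by
    ext v
    obtain ⟨e, he, X, hv⟩ := htrans x v
    have h1 : f (momentCLM H α x X) = 0 := hker ⟨X, rfl⟩
    rw [hfs] at h1
    have h2 : ∀ j, α j x v = -(momentCLM H α x X j) := by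
      intro j
      rw [coe_momentCLM, hv, map_add, hα.mem_conormal j e he, zero_add]
      exact (neg_neg _).symm
    rw [sum_apply, zero_apply, ← neg_eq_zero,
      ← Finset.sum_neg_distrib, ← h1]
    refine Finset.sum_congr rfl fun j _ => ?_
    rw [smul_apply, h2 j, smul_eq_mul]
    ring
  have := hα.eq_zero_of_sum _ hz
  refine hf (LinearMap.ext fun u => ?_)
  rw [hfs]
  simp [this]

variable [IsManifold 𝓘(ℝ, EM) ∞ M] [LieGroup 𝓘(ℝ, EH) ∞ H] [FiniteDimensional ℝ EH]

theorem exists_contDiffAt_momentCLM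
    (hact : ContMDiff (𝓘(ℝ, EH).prod 𝓘(ℝ, EM)) 𝓘(ℝ, EM) ∞ (fun p : H × M => p.1 • p.2))
    {U : Set M} {α : Fin k → (x : M) → (TangentSpace 𝓘(ℝ, EM) x →L[ℝ] ℝ)}
    (hα : IsOrientedFrame o U α) (x₀ : M) {y : EM} (hy : y ∈ (extChartAt 𝓘(ℝ, EM) x₀).target)
    (hyU : (extChartAt 𝓘(ℝ, EM) x₀).symm y ∈ U) :
    ∃ L : EM → EH →L[ℝ] (Fin k → ℝ), ContDiffAt ℝ ∞ L y ∧
      ∀ᶠ z in 𝓝 y, L z = momentCLM H α ((extChartAt 𝓘(ℝ, EM) x₀).symm z) := by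
  obtain ⟨V, hV, hVe⟩ := exists_contDiffAt_fundamentalField hact x₀ hy
  refine ⟨fun z => ContinuousLinearMap.pi fun j => -((coordForm (α j) x₀ z).comp (V z)), ?_, ?_⟩
  · let Λ : (Fin k → EH →L[ℝ] ℝ) →ₗ[ℝ] (EH →L[ℝ] (Fin k → ℝ)) :=
      { toFun := ContinuousLinearMap.pi
        map_add' := fun _ _ => rfl
        map_smul' := fun _ _ => rfl }
    refine (LinearMap.toContinuousLinearMap Λ).contDiff.contDiffAt.comp y
      (contDiffAt_pi.2 fun j => ContDiffAt.neg ?_)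
    exact (contDiffAt_coordForm hα.isOpen (hα.smooth j) x₀ hy hyU).clm_comp hV
  · filter_upwards [hVe] with z hz
    ext X j
    have := hz X
    simp only [coordForm, ModelWithCorners.range_eq_univ, mfderivWithin_univ]
    exact congrArg (fun w => -(α j ((extChartAt 𝓘(ℝ, EM) x₀).symm z) w)) this

end Moment

/-! ### The local forms and their smoothness. -/

section LocalForm

open GradedForm

variable {EM : Type*} [NormedAddCommGroup EM] [NormedSpace ℝ EM]
  {M : Type*} [TopologicalSpace M] [ChartedSpace EM M]
  {EH : Type*} [NormedAddCommGroup EH] [NormedSpace ℝ EH] [MeasurableSpace EH]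
  (H : Type*) [TopologicalSpace H] [ChartedSpace EH H] [Group H] [MulAction H M] {k : ℕ}
  (μ : Measure EH)

theorem localForm_eq (α : Fin k → (x : M) → (TangentSpace 𝓘(ℝ, EM) x →L[ℝ] ℝ)) (φ : EH → ℂ)
    (x : M) : localForm H μ α φ x =
      (List.ofFn fun j : Fin k => homog 1 (covectorForm (α j.rev x))).prod *
      ∑ m ∈ Finset.range (Module.finrank ℝ EM + 1),
        ∑ i ∈ Finset.piAntidiag (Finset.univ : Finset (Fin k)) m,
        (diracPullback μ (momentMap H α x) i φ / ((∏ j, (i j).factorial : ℕ) : ℂ)) •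
        (List.ofFn fun j => homog 2
            (mextDeriv 𝓘(ℝ, EM) (fun y => covectorForm (α j y)) x) ^ (i j)).prod := by
  simp only [localForm, diracForm, pow_eq, listProd_eq, mul_eq]

theorem pullback_localForm {W : Type*} [AddCommGroup W] [Module ℝ W] [TopologicalSpace W]
    (α : Fin k → (x : M) → (TangentSpace 𝓘(ℝ, EM) x →L[ℝ] ℝ)) (φ : EH → ℂ)
    (x : M) (T : W →L[ℝ] TangentSpace 𝓘(ℝ, EM) x) : pullback T (localForm H μ α φ x) =
      (List.ofFn fun j : Fin k => homog 1 (covectorForm ((α j.rev x).comp T))).prod *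
      ∑ m ∈ Finset.range (Module.finrank ℝ EM + 1),
        ∑ i ∈ Finset.piAntidiag (Finset.univ : Finset (Fin k)) m,
        (diracPullback μ (momentMap H α x) i φ / ((∏ j, (i j).factorial : ℕ) : ℂ)) •
        (List.ofFn fun j => homog 2
            ((mextDeriv 𝓘(ℝ, EM) (fun y => covectorForm (α j y)) x).compContinuousLinearMap T)
              ^ (i j)).prod := by
  rw [localForm_eq, map_mul, map_list_prod, List.map_ofFn, map_sum]
  simp only [map_sum, map_smul, map_list_prod, List.map_ofFn, Function.comp_def, map_pow,
    pullback_homog]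
  rfl

end LocalForm

section LocalFormSmooth

open GradedForm

variable {EM : Type*} [NormedAddCommGroup EM] [NormedSpace ℝ EM] [FiniteDimensional ℝ EM]
  {M : Type*} [TopologicalSpace M] [ChartedSpace EM M] [IsManifold 𝓘(ℝ, EM) ∞ M]
  {EH : Type*} [NormedAddCommGroup EH] [NormedSpace ℝ EH] [FiniteDimensional ℝ EH]
  [MeasurableSpace EH] [BorelSpace EH] (μ : Measure EH) [μ.IsAddHaarMeasure]
  (H : Type*) [TopologicalSpace H] [ChartedSpace EH H] [Group H] [LieGroup 𝓘(ℝ, EH) ∞ H]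
  [MulAction H M] {k : ℕ} {E : (x : M) → Submodule ℝ (TangentSpace 𝓘(ℝ, EM) x)}
  {o : (x : M) → Orientation ℝ (conormal E x) (Fin k)} {U : Set M}
  {α : Fin k → (x : M) → (TangentSpace 𝓘(ℝ, EM) x →L[ℝ] ℝ)}

theorem IsOrientedFrame.differentiableAt_formInChart (hα : IsOrientedFrame o U α) (j : Fin k)
    {x : M} (hx : x ∈ U) : DifferentiableAt ℝ
      (formInChart 𝓘(ℝ, EM) (fun y => covectorForm (α j y)) x) (extChartAt 𝓘(ℝ, EM) x x) :=
  (contDiffAt_coordForm hα.isOpen (hα.smooth j) x (mem_extChartAt_target x)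
    (by rwa [extChartAt_to_inv])).covectorForm.differentiableAt (by simp)

/-- In a chart, the local form is built by sums and products from the coordinate covectors, their
exterior derivatives, and the coefficients `diracPullback`, which depend smoothly on the point
through the surjective moment map. -/
theorem IsOrientedFrame.contDiffAt_localForm
    (hact : ContMDiff (𝓘(ℝ, EH).prod 𝓘(ℝ, EM)) 𝓘(ℝ, EM) ∞ (fun p : H × M => p.1 • p.2))
    (htrans : IsTransverse EH H E) (hα : IsOrientedFrame o U α) {φ : EH → ℂ}
    (hφ : ContDiff ℝ ∞ φ) (hc : HasCompactSupport φ)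
    (x₀ : M) {y : EM} (hy : y ∈ (extChartAt 𝓘(ℝ, EM) x₀).target)
    (hyU : (extChartAt 𝓘(ℝ, EM) x₀).symm y ∈ U) (n : ℕ) :
    ContDiffAt ℝ ∞ (formInChart 𝓘(ℝ, EM) (fun x => localForm H μ α φ x n) x₀) y := by
  have hcoord : ∀ j, ContDiffAt ℝ ∞ (coordForm (α j) x₀) y := fun j =>
    contDiffAt_coordForm hα.isOpen (hα.smooth j) x₀ hy hyU
  obtain ⟨L, hL, hLe⟩ := exists_contDiffAt_momentCLM (EH := EH) H hact hα x₀ hy hyU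
  have key : ContDiffAtForm (fun z =>
      (List.ofFn fun j : Fin k => homog 1 (covectorForm (coordForm (α j.rev) x₀ z))).prod *
      ∑ m ∈ Finset.range (Module.finrank ℝ EM + 1),
        ∑ i ∈ Finset.piAntidiag (Finset.univ : Finset (Fin k)) m,
        (diracPullback μ (L z) i φ / ((∏ j, (i j).factorial : ℕ) : ℂ)) •
        (List.ofFn fun j => homog 2
            (extDeriv (fun y => covectorForm (coordForm (α j) x₀ y)) z) ^ (i j)).prod) y := by
    refine (ContDiffAtForm.prod_ofFn fun j => .homog (hcoord _).covectorForm).mul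
      (.sum fun m _ => .sum fun i _ => .smul ?_ (.prod_ofFn fun j =>
        (ContDiffAtForm.homog (hcoord j).covectorForm.extDeriv).pow _))
    refine ContDiffAt.div_const ?_ _
    have hs : Function.Surjective (L y) := by
      rw [hLe.self_of_nhds]
      exact momentCLM_surjective H htrans (hα.positive _ hyU)
    exact ContDiffAt.comp (g := fun L : EH →L[ℝ] (Fin k → ℝ) => diracPullback μ L i φ) y
      (contDiffAt_diracPullback μ hs i hφ hc) hL
  refine (contDiffAt_alternating_of_apply (key n)).congr_of_eventuallyEq ?_
  have hU : ∀ᶠ z in 𝓝 y, (extChartAt 𝓘(ℝ, EM) x₀).symm z ∈ U :=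
    (continuousAt_extChartAt_symm'' hy).preimage_mem_nhds (hα.isOpen.mem_nhds hyU)
  filter_upwards [hLe, (isOpen_extChartAt_target x₀).mem_nhds hy, hU] with z hz hzt hzU
  have h1 : formInChart 𝓘(ℝ, EM) (fun x => localForm H μ α φ x n) x₀ z =
      pullback (mfderivWithin 𝓘(ℝ, EM) 𝓘(ℝ, EM) (extChartAt 𝓘(ℝ, EM) x₀).symm
        (range 𝓘(ℝ, EM)) z) (localForm H μ α φ ((extChartAt 𝓘(ℝ, EM) x₀).symm z)) n := rfl
  have h2 : ∀ j, extDeriv (fun y => covectorForm (coordForm (α j) x₀ y)) z =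
      (mextDeriv 𝓘(ℝ, EM) (fun y => covectorForm (α j y))
        ((extChartAt 𝓘(ℝ, EM) x₀).symm z)).compContinuousLinearMap
        (mfderivWithin 𝓘(ℝ, EM) 𝓘(ℝ, EM) (extChartAt 𝓘(ℝ, EM) x₀).symm
          (range 𝓘(ℝ, EM)) z) := fun j =>
    (formInChart_mextDeriv _ x₀ hzt (hα.differentiableAt_formInChart j hzU)).symm
  rw [h1, pullback_localForm]
  simp only [h2, hz]
  rfl

end LocalFormSmooth

/-! ### Frames pulled back by the group action. -/

section Chain

variable {F₁ F₂ F₃ : Type*} [NormedAddCommGroup F₁] [NormedSpace ℝ F₁] [NormedAddCommGroup F₂]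
  [NormedSpace ℝ F₂] [NormedAddCommGroup F₃] [NormedSpace ℝ F₃] {B₁ B₂ B₃ : Type*}
  [TopologicalSpace B₁] [TopologicalSpace B₂] [TopologicalSpace B₃]
  {I₁ : ModelWithCorners ℝ F₁ B₁} {I₂ : ModelWithCorners ℝ F₂ B₂} {I₃ : ModelWithCorners ℝ F₃ B₃}
  {N₁ N₂ N₃ : Type*}
  [TopologicalSpace N₁] [ChartedSpace B₁ N₁] [TopologicalSpace N₂] [ChartedSpace B₂ N₂]
  [TopologicalSpace N₃] [ChartedSpace B₃ N₃]

/-- The chain rule, for a composition given by an equation, with the derivatives considered as maps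
between the model spaces. -/
theorem mfderiv_of_comp_eq {f : N₁ → N₂} {g : N₂ → N₃} {φ : N₁ → N₃} {x : N₁} {y : N₂}
    (hφ : ∀ z, φ z = g (f z)) (hy : f x = y) (hg : MDifferentiableAt I₂ I₃ g y)
    (hf : MDifferentiableAt I₁ I₂ f x) :
    (mfderiv I₁ I₃ φ x : F₁ →L[ℝ] F₃) =
      (mfderiv I₂ I₃ g y : F₂ →L[ℝ] F₃).comp (mfderiv I₁ I₂ f x : F₁ →L[ℝ] F₂) := by
  obtain rfl : φ = g ∘ f := funext hφ
  subst hy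
  exact mfderiv_comp x hg hf

end Chain

section PullbackFrame

variable {EM : Type*} [NormedAddCommGroup EM] [NormedSpace ℝ EM]
  {M : Type*} [TopologicalSpace M] [ChartedSpace EM M] [IsManifold 𝓘(ℝ, EM) ∞ M]
  {G : Type*} [NormedAddCommGroup G] [NormedSpace ℝ G]

theorem contMDiffAt_of_coordForm {α : (x : M) → (TangentSpace 𝓘(ℝ, EM) x →L[ℝ] ℝ)} {x₀ : M}
    (hα : ContDiffAt ℝ ∞ (coordForm α x₀) (extChartAt 𝓘(ℝ, EM) x₀ x₀)) :
    ContMDiffAt 𝓘(ℝ, EM) (cotModel EM) ∞ (fun x => (⟨x, α x⟩ : Cotangent EM M)) x₀ := by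
  rw [Bundle.Trivialization.contMDiffAt_section_iff
    (trivializationAt (EM →L[ℝ] ℝ) (fun x : M => TangentSpace 𝓘(ℝ, EM) x →L[ℝ] ℝ) x₀)
    (FiberBundle.mem_baseSet_trivializationAt' x₀)]
  have h1 : ContMDiffAt 𝓘(ℝ, EM) 𝓘(ℝ, EM →L[ℝ] ℝ) ∞
      (coordForm α x₀ ∘ extChartAt 𝓘(ℝ, EM) x₀) x₀ :=
    ContMDiffAt.comp x₀ hα.contMDiffAt contMDiffAt_extChartAt
  refine h1.congr_of_eventuallyEq ?_
  filter_upwards [(chartAt EM x₀).open_source.mem_nhds (mem_chart_source EM x₀)] with x hx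
  rw [cotangent_trivializationAt_snd x₀ _ hx]
  have hl : (extChartAt 𝓘(ℝ, EM) x₀).symm (extChartAt 𝓘(ℝ, EM) x₀ x) = x :=
    (extChartAt 𝓘(ℝ, EM) x₀).left_inv (by simpa using hx)
  have : ∀ x', x' = x → (α x' : EM →L[ℝ] ℝ) = α x := by rintro _ rfl; rfl
  exact congrArg (fun a : EM →L[ℝ] ℝ => a.comp (mfderivWithin 𝓘(ℝ, EM) 𝓘(ℝ, EM)
    (extChartAt 𝓘(ℝ, EM) x₀).symm (range 𝓘(ℝ, EM)) (extChartAt 𝓘(ℝ, EM) x₀ x) : EM →L[ℝ] EM))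
    (this _ hl).symm

theorem mfderiv_eq_symm_comp_fderiv {Ψ : G → M} {z : G} (x₁ : M)
    (hz : MDifferentiableAt 𝓘(ℝ, G) 𝓘(ℝ, EM) Ψ z) (hzs : Ψ z ∈ (extChartAt 𝓘(ℝ, EM) x₁).source) :
    (mfderiv 𝓘(ℝ, G) 𝓘(ℝ, EM) Ψ z : G →L[ℝ] EM) =
      ((mfderiv 𝓘(ℝ, EM) 𝓘(ℝ, EM) (extChartAt 𝓘(ℝ, EM) x₁).symm
        (extChartAt 𝓘(ℝ, EM) x₁ (Ψ z)) : EM →L[ℝ] EM)).comp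
        (fderiv ℝ (fun z => extChartAt 𝓘(ℝ, EM) x₁ (Ψ z)) z) := by
  have h1 : fderiv ℝ (fun z => extChartAt 𝓘(ℝ, EM) x₁ (Ψ z)) z =
      ((mfderiv 𝓘(ℝ, EM) 𝓘(ℝ, EM) (extChartAt 𝓘(ℝ, EM) x₁) (Ψ z)).comp
        (mfderiv 𝓘(ℝ, G) 𝓘(ℝ, EM) Ψ z) : G →L[ℝ] EM) := by
    rw [← mfderiv_eq_fderiv]
    exact mfderiv_comp z (mdifferentiableAt_extChartAt (by simpa using hzs)) hz
  have e2 := mfderivWithin_extChartAt_symm_comp_mfderiv_extChartAt' (I := 𝓘(ℝ, EM)) hzs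
  simp only [ModelWithCorners.range_eq_univ, mfderivWithin_univ] at e2
  ext v
  refine (DFunLike.congr_fun e2 (mfderiv 𝓘(ℝ, G) 𝓘(ℝ, EM) Ψ z v)).symm.trans ?_
  exact congrArg (mfderiv 𝓘(ℝ, EM) 𝓘(ℝ, EM) (extChartAt 𝓘(ℝ, EM) x₁).symm
    (extChartAt 𝓘(ℝ, EM) x₁ (Ψ z)) : EM →L[ℝ] EM) (DFunLike.congr_fun h1 v).symm

omit [IsManifold 𝓘(ℝ, EM) ∞ M] in
theorem covector_comp_congr (α : (x : M) → (TangentSpace 𝓘(ℝ, EM) x →L[ℝ] ℝ)) {x x' : M}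
    (h : x = x') {L L' : G →L[ℝ] EM} (hL : L = L') :
    (α x : EM →L[ℝ] ℝ).comp L = (α x' : EM →L[ℝ] ℝ).comp L' := by
  subst h hL; rfl

variable {EH : Type*} [NormedAddCommGroup EH] [NormedSpace ℝ EH]
  {H : Type*} [TopologicalSpace H] [ChartedSpace EH H] [Group H]
  [MulAction H M] {k : ℕ} {E : (x : M) → Submodule ℝ (TangentSpace 𝓘(ℝ, EM) x)}
  {o : (x : M) → Orientation ℝ (conormal E x) (Fin k)}

/-- The pull-back of a family of covector fields by the action of `h`. -/
def pullbackFrame (h : H) (α : Fin k → (x : M) → (TangentSpace 𝓘(ℝ, EM) x →L[ℝ] ℝ))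
    (j : Fin k) (x : M) : TangentSpace 𝓘(ℝ, EM) x →L[ℝ] ℝ :=
  (α j (h • x)).comp (actionDeriv H h x)

theorem mfderiv_act_comp_symm
    (hact : ContMDiff (𝓘(ℝ, EH).prod 𝓘(ℝ, EM)) 𝓘(ℝ, EM) ∞ (fun p : H × M => p.1 • p.2))
    (h : H) (x₀ : M) {z : EM} (hz : z ∈ (extChartAt 𝓘(ℝ, EM) x₀).target) :
    (mfderiv 𝓘(ℝ, EM) 𝓘(ℝ, EM) (fun z => h • (extChartAt 𝓘(ℝ, EM) x₀).symm z) z : EM →L[ℝ] EM) =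
      (actionDeriv H h ((extChartAt 𝓘(ℝ, EM) x₀).symm z) : EM →L[ℝ] EM).comp
        (mfderivWithin 𝓘(ℝ, EM) 𝓘(ℝ, EM) (extChartAt 𝓘(ℝ, EM) x₀).symm (range 𝓘(ℝ, EM)) z) := by
  have h2 : ContMDiffAt 𝓘(ℝ, EM) 𝓘(ℝ, EM) ∞ (extChartAt 𝓘(ℝ, EM) x₀).symm z :=
    (contMDiffOn_extChartAt_symm x₀).contMDiffAt ((isOpen_extChartAt_target x₀).mem_nhds hz)
  simp only [ModelWithCorners.range_eq_univ, mfderivWithin_univ]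
  exact mfderiv_comp z
    ((contMDiff_const_act hact h).contMDiffAt.mdifferentiableAt (by simp))
    (h2.mdifferentiableAt (by simp))

theorem contMDiffAt_act_comp_symm
    (hact : ContMDiff (𝓘(ℝ, EH).prod 𝓘(ℝ, EM)) 𝓘(ℝ, EM) ∞ (fun p : H × M => p.1 • p.2))
    (h : H) (x₀ : M) {z : EM} (hz : z ∈ (extChartAt 𝓘(ℝ, EM) x₀).target) :
    ContMDiffAt 𝓘(ℝ, EM) 𝓘(ℝ, EM) ∞ (fun z => h • (extChartAt 𝓘(ℝ, EM) x₀).symm z) z :=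
  (contMDiff_const_act hact h).contMDiffAt.comp z
    ((contMDiffOn_extChartAt_symm x₀).contMDiffAt ((isOpen_extChartAt_target x₀).mem_nhds hz))

theorem IsOrientedFrame.isOrientedFrame_pullbackFrame
    (hact : ContMDiff (𝓘(ℝ, EH).prod 𝓘(ℝ, EM)) 𝓘(ℝ, EM) ∞ (fun p : H × M => p.1 • p.2))
    (hHo : PreservesOrientation H o) {U : Set M}
    {α : Fin k → (x : M) → (TangentSpace 𝓘(ℝ, EM) x →L[ℝ] ℝ)} (hα : IsOrientedFrame o U α) (h : H) :
    IsOrientedFrame o ((fun x : M => h • x) ⁻¹' U) (pullbackFrame h α) where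
  isOpen := hα.isOpen.preimage (contMDiff_const_act hact h).continuous
  positive x hx := hHo h x _ (hα.positive (h • x) hx)
  smooth j x₀ hx₀ := by
    refine (contMDiffAt_of_coordForm ?_).contMDiffWithinAt
    set y := extChartAt 𝓘(ℝ, EM) x₀ x₀ with hy
    have hyt : y ∈ (extChartAt 𝓘(ℝ, EM) x₀).target := mem_extChartAt_target x₀
    set Ψ : EM → M := fun z => h • (extChartAt 𝓘(ℝ, EM) x₀).symm z with hΨ
    have hΨy : Ψ y = h • x₀ := by simp [hΨ, hy]
    set f : EM → EM := fun z => extChartAt 𝓘(ℝ, EM) (h • x₀) (Ψ z) with hf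
    have hΨs : ContMDiffAt 𝓘(ℝ, EM) 𝓘(ℝ, EM) ∞ Ψ y := contMDiffAt_act_comp_symm hact h x₀ hyt
    have hfs : ContDiffAt ℝ ∞ f y :=
      ((contMDiffAt_extChartAt' (by rw [hΨy]; exact mem_chart_source EM _)).comp y hΨs).contDiffAt
    have hfy : f y = extChartAt 𝓘(ℝ, EM) (h • x₀) (h • x₀) := by rw [hf]; simp only [hΨy]
    -- The pulled-back frame in the chart at `x₀` is the coordinate frame at `h • x₀` pulled back
    -- along the chart reading `f` of the action, visibly smooth.
    have h1 : ContDiffAt ℝ ∞ (fun z => (coordForm (α j) (h • x₀) (f z)).comp (fderiv ℝ f z)) y := by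
      refine ContDiffAt.clm_comp ?_ (hfs.fderiv_right (m := ∞) (by simp))
      refine ContDiffAt.comp (g := coordForm (α j) (h • x₀)) y ?_ hfs
      rw [hfy]
      exact contDiffAt_coordForm hα.isOpen (hα.smooth j) _ (mem_extChartAt_target _)
        (by rw [extChartAt_to_inv]; exact hx₀)
    refine h1.congr_of_eventuallyEq ?_
    filter_upwards [(isOpen_extChartAt_target x₀).mem_nhds hyt,
      hΨs.continuousAt.preimage_mem_nhds ((isOpen_extChartAt_source (I := 𝓘(ℝ, EM)) (h • x₀)).mem_nhds
        (by rw [hΨy]; exact mem_extChartAt_source _))] with z hzt hzs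
    have e1 : (extChartAt 𝓘(ℝ, EM) (h • x₀)).symm (f z) = Ψ z :=
      (extChartAt 𝓘(ℝ, EM) (h • x₀)).left_inv hzs
    have e2 := mfderiv_eq_symm_comp_fderiv (h • x₀)
      ((contMDiffAt_act_comp_symm hact h x₀ hzt).mdifferentiableAt (by simp)) hzs
    rw [mfderiv_act_comp_symm hact h x₀ hzt] at e2
    have e3 := covector_comp_congr (G := EM) (α j) e1.symm e2
    simp only [coordForm, ModelWithCorners.range_eq_univ, mfderivWithin_univ] at e3 ⊢
    exact e3

/-- Naturality for the map `z ↦ h • chart⁻¹ z`, defined on the model space; the derivative of the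
inverse chart then cancels against that of the chart. -/
theorem mextDeriv_pullbackFrame
    (hact : ContMDiff (𝓘(ℝ, EH).prod 𝓘(ℝ, EM)) 𝓘(ℝ, EM) ∞ (fun p : H × M => p.1 • p.2))
    (h : H) {α : Fin k → (x : M) → (TangentSpace 𝓘(ℝ, EM) x →L[ℝ] ℝ)} (j : Fin k) (x : M)
    (hα : DifferentiableAt ℝ (formInChart 𝓘(ℝ, EM) (fun y => covectorForm (α j y)) (h • x))
      (extChartAt 𝓘(ℝ, EM) (h • x) (h • x))) :
    mextDeriv 𝓘(ℝ, EM) (fun y => covectorForm (pullbackFrame h α j y)) x =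
      (mextDeriv 𝓘(ℝ, EM) (fun y => covectorForm (α j y)) (h • x)).compContinuousLinearMap
        (actionDeriv H h x) := by
  set y := extChartAt 𝓘(ℝ, EM) x x with hy
  have hyt : y ∈ (extChartAt 𝓘(ℝ, EM) x).target := mem_extChartAt_target x
  set Ψ : EM → M := fun z => h • (extChartAt 𝓘(ℝ, EM) x).symm z with hΨ
  have hΨy : Ψ y = h • x := by simp [hΨ, hy]
  have h1 := extDeriv_pullback_manifold (fun y => covectorForm (α j y))
    (contMDiffAt_act_comp_symm hact h x hyt) (by
      change DifferentiableAt ℝ (formInChart 𝓘(ℝ, EM) _ (Ψ y)) (extChartAt 𝓘(ℝ, EM) (Ψ y) (Ψ y))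
      rw [hΨy]; exact hα)
  have h2 : formInChart 𝓘(ℝ, EM) (fun y => covectorForm (pullbackFrame h α j y)) x =ᶠ[𝓝 y]
      fun z => (covectorForm (α j (Ψ z))).compContinuousLinearMap
        (mfderiv 𝓘(ℝ, EM) 𝓘(ℝ, EM) Ψ z) := by
    filter_upwards [(isOpen_extChartAt_target x).mem_nhds hyt] with z hzt
    rw [mfderiv_act_comp_symm hact h x hzt]
    rfl
  have h3 : mextDeriv 𝓘(ℝ, EM) (fun y => covectorForm (pullbackFrame h α j y)) x =
      (extDeriv (formInChart 𝓘(ℝ, EM) (fun y => covectorForm (pullbackFrame h α j y)) x)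
        y).compContinuousLinearMap (mfderiv 𝓘(ℝ, EM) 𝓘(ℝ, EM) (extChartAt 𝓘(ℝ, EM) x) x) := by
    unfold mextDeriv
    simp only [ModelWithCorners.range_eq_univ, extDerivWithin_univ]
    rfl
  rw [h3, h2.extDeriv_eq, h1, mfderiv_act_comp_symm hact h x hyt]
  have e2 := mfderivWithin_extChartAt_symm_comp_mfderiv_extChartAt' (I := 𝓘(ℝ, EM))
    (mem_extChartAt_source (I := 𝓘(ℝ, EM)) x)
  have hx : ∀ x', x' = x → (actionDeriv H h x' : EM →L[ℝ] EM) = actionDeriv H h x := by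
    rintro _ rfl; rfl
  refine FormField.comp_congr (G := EM) (mextDeriv 𝓘(ℝ, EM) (fun y => covectorForm (α j y))) hΨy
    (L := ((actionDeriv H h ((extChartAt 𝓘(ℝ, EM) x).symm y) : EM →L[ℝ] EM).comp
        (mfderivWithin 𝓘(ℝ, EM) 𝓘(ℝ, EM) (extChartAt 𝓘(ℝ, EM) x).symm (range 𝓘(ℝ, EM)) y)).comp
        (mfderiv 𝓘(ℝ, EM) 𝓘(ℝ, EM) (extChartAt 𝓘(ℝ, EM) x) x : EM →L[ℝ] EM)) ?_
  rw [hx _ (extChartAt_to_inv x)]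
  ext v
  exact congrArg (actionDeriv H h x) (DFunLike.congr_fun e2 v)

end PullbackFrame

/-! ### The adjoint action and equivariance of the local forms. -/

section Adjoint

variable {EM : Type*} [NormedAddCommGroup EM] [NormedSpace ℝ EM]
  {M : Type*} [TopologicalSpace M] [ChartedSpace EM M]
  {EH : Type*} [NormedAddCommGroup EH] [NormedSpace ℝ EH]
  {H : Type*} [TopologicalSpace H] [ChartedSpace EH H] [Group H] [LieGroup 𝓘(ℝ, EH) ∞ H]
  [MulAction H M]

theorem contMDiff_conj (h : H) : ContMDiff 𝓘(ℝ, EH) 𝓘(ℝ, EH) ∞ (fun g : H => h * g * h⁻¹) :=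
  (contMDiff_mul_right (I := 𝓘(ℝ, EH)) (a := h⁻¹)).comp contMDiff_mul_left

theorem adjointAction_comp_inv (h : H) :
    (adjointAction H h : EH →L[ℝ] EH).comp (adjointAction H h⁻¹) = ContinuousLinearMap.id ℝ EH := by
  have h0 : (h⁻¹ * (1 : H) * h⁻¹⁻¹) = 1 := by group
  have h1 : MDifferentiableAt 𝓘(ℝ, EH) 𝓘(ℝ, EH) (fun g : H => h⁻¹ * g * h⁻¹⁻¹) 1 :=
    (contMDiff_conj h⁻¹).contMDiffAt.mdifferentiableAt (by simp)
  have h2 : MDifferentiableAt 𝓘(ℝ, EH) 𝓘(ℝ, EH) (fun g : H => h * g * h⁻¹) 1 :=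
    (contMDiff_conj h).contMDiffAt.mdifferentiableAt (by simp)
  have h3 := mfderiv_of_comp_eq (φ := id)
    (f := fun g : H => h⁻¹ * g * h⁻¹⁻¹) (g := fun g : H => h * g * h⁻¹) (fun g => by change g = _; group) h0 h2 h1
  exact h3.symm.trans mfderiv_id

theorem det_adjointAction_ne_zero (h : H) : (adjointAction H h : EH →L[ℝ] EH).det ≠ 0 := by
  intro h0
  have h1 : LinearMap.det (((adjointAction H h : EH →L[ℝ] EH) : EH →ₗ[ℝ] EH) ∘ₗ
      ((adjointAction H h⁻¹ : EH →L[ℝ] EH) : EH →ₗ[ℝ] EH)) = 1 :=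
    (congrArg (fun A : EH →L[ℝ] EH => LinearMap.det (A : EH →ₗ[ℝ] EH))
      (adjointAction_comp_inv h)).trans LinearMap.det_id
  rw [LinearMap.det_comp] at h1
  rw [show LinearMap.det ((adjointAction H h : EH →L[ℝ] EH) : EH →ₗ[ℝ] EH) = 0 from h0,
    zero_mul] at h1
  exact zero_ne_one h1

/-- Differentiate `(h g h⁻¹) • (h • x) = h • (g • x)` at `g = 1`. -/
theorem fundamentalField_adjointAction
    (hact : ContMDiff (𝓘(ℝ, EH).prod 𝓘(ℝ, EM)) 𝓘(ℝ, EM) ∞ (fun p : H × M => p.1 • p.2))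
    (h : H) (X : EH) (x : M) :
    fundamentalField 𝓘(ℝ, EM) (fun (h : H) (y : M) => h • y) (adjointAction H h X) (h • x) =
      actionDeriv H h x
        (fundamentalField 𝓘(ℝ, EM) (fun (h : H) (y : M) => h • y) X x) := by
  have d1 : MDifferentiableAt 𝓘(ℝ, EH) 𝓘(ℝ, EM) (fun g : H => g • (h • x)) 1 :=
    (contMDiff_act_const hact (h • x)).contMDiffAt.mdifferentiableAt (by simp)
  have d2 : MDifferentiableAt 𝓘(ℝ, EH) 𝓘(ℝ, EH) (fun g : H => h * g * h⁻¹) 1 :=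
    (contMDiff_conj h).contMDiffAt.mdifferentiableAt (by simp)
  have d3 : MDifferentiableAt 𝓘(ℝ, EM) 𝓘(ℝ, EM) (fun y : M => h • y) x :=
    (contMDiff_const_act hact h).contMDiffAt.mdifferentiableAt (by simp)
  have d4 : MDifferentiableAt 𝓘(ℝ, EH) 𝓘(ℝ, EM) (fun g : H => g • x) 1 :=
    (contMDiff_act_const hact x).contMDiffAt.mdifferentiableAt (by simp)
  have h1 := mfderiv_of_comp_eq (φ := fun g : H => h • (g • x)) (fun g => by simp [mul_smul])
    (by group) d1 d2
  have h2 := mfderiv_of_comp_eq (φ := fun g : H => h • (g • x)) (fun g => rfl) (one_smul _ _) d3 d4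
  exact DFunLike.congr_fun (h1.symm.trans h2) X

end Adjoint

section EquivariantLocalForm

open GradedForm

variable {EM : Type*} [NormedAddCommGroup EM] [NormedSpace ℝ EM] [FiniteDimensional ℝ EM]
  {M : Type*} [TopologicalSpace M] [ChartedSpace EM M] [IsManifold 𝓘(ℝ, EM) ∞ M]
  {EH : Type*} [NormedAddCommGroup EH] [NormedSpace ℝ EH] [FiniteDimensional ℝ EH]
  [MeasurableSpace EH] [BorelSpace EH] (μ : Measure EH) [μ.IsAddHaarMeasure]
  {H : Type*} [TopologicalSpace H] [ChartedSpace EH H] [Group H] [LieGroup 𝓘(ℝ, EH) ∞ H]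
  [MulAction H M] {k : ℕ} {E : (x : M) → Submodule ℝ (TangentSpace 𝓘(ℝ, EM) x)}
  {o : (x : M) → Orientation ℝ (conormal E x) (Fin k)} {U : Set M}
  {α : Fin k → (x : M) → (TangentSpace 𝓘(ℝ, EM) x →L[ℝ] ℝ)}

/-- The moment map at `h • x` composed with `Ad(h)` is that of the pulled-back frame at `x`, so the
Dirac coefficients change by the Jacobian alone, while the frame and its exterior derivative pull
back naturally. The pulled-back frame can afterwards be exchanged for any other, by independence of
the frame. -/
theorem IsOrientedFrame.localForm_act
    (hact : ContMDiff (𝓘(ℝ, EH).prod 𝓘(ℝ, EM)) 𝓘(ℝ, EM) ∞ (fun p : H × M => p.1 • p.2))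
    (hHo : PreservesOrientation H o) (htrans : IsTransverse EH H E) (hα : IsOrientedFrame o U α)
    {φ ψ : EH → ℂ} (hφ : ContDiff ℝ ∞ φ) (hc : HasCompactSupport φ) (h : H)
    (hψ : ∀ X : EH, ψ (adjointAction H h X) = φ X) {x : M} (hx : h • x ∈ U) :
    pullback (actionDeriv H h x) (localForm H μ α ψ (h • x)) =
      ((|(adjointAction H h : EH →L[ℝ] EH).det| : ℝ) : ℂ) •
        localForm H μ (pullbackFrame h α) φ x := by
  have hL' : Function.Surjective (momentCLM (EH := EH) H (pullbackFrame h α) x) :=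
    momentCLM_surjective H htrans (hHo h x _ (hα.positive _ hx))
  have hcomp : (momentCLM H α (h • x)).comp (adjointAction H h : EH →L[ℝ] EH) =
      momentCLM H (pullbackFrame h α) x := by
    ext X j
    exact congrArg (fun w => -(α j (h • x) w)) (fundamentalField_adjointAction hact h X x)
  have hd : ∀ i, diracPullback μ (momentMap H α (h • x)) i ψ =
      ((|(adjointAction H h : EH →L[ℝ] EH).det| : ℝ) : ℂ) *
        diracPullback μ (momentMap H (pullbackFrame h α) x) i φ := fun i =>
    diracPullback_comp hL' (det_adjointAction_ne_zero h) hcomp i hφ hc hψ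
  have hm : ∀ j, (mextDeriv 𝓘(ℝ, EM) (fun y => covectorForm (α j y))
      (h • x)).compContinuousLinearMap (actionDeriv H h x) =
      mextDeriv 𝓘(ℝ, EM) (fun y => covectorForm (pullbackFrame h α j y)) x := fun j =>
    (mextDeriv_pullbackFrame hact h j x (hα.differentiableAt_formInChart j hx)).symm
  rw [pullback_localForm, localForm_eq]
  simp only [hd, hm, ← mul_smul_comm, Finset.smul_sum, smul_smul, mul_div_assoc]
  rfl

end EquivariantLocalForm

/-! ### The cotangent bundle in charts and the canonical form. -/

theorem extDeriv_covectorForm_apply {V : Type*} [NormedAddCommGroup V] [NormedSpace ℝ V]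
    [FiniteDimensional ℝ V] {A : V → V →L[ℝ] ℝ} {A' : V →L[ℝ] V →L[ℝ] ℝ} {x : V}
    (hA : HasFDerivAt A A' x) (w : Fin 2 → V) :
    extDeriv (fun y => covectorForm (A y)) x w = ((A' (w 0) (w 1) - A' (w 1) (w 0) : ℝ) : ℂ) := by
  let Λ : (V →L[ℝ] ℝ) →ₗ[ℝ] V [⋀^Fin 1]→L[ℝ] ℂ :=
    { toFun := covectorForm
      map_add' := fun a b => by ext v; exact Complex.ofReal_add _ _
      map_smul' := fun c a => by ext v; exact Complex.ofReal_mul _ _ }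
  have hd : DifferentiableAt ℝ (fun y => covectorForm (A y)) x :=
    (LinearMap.toContinuousLinearMap Λ).differentiableAt.comp x hA.differentiableAt
  rw [extDeriv_apply hd]
  have h1 : ∀ u v : V, fderiv ℝ (fun y => covectorForm (A y) (fun _ => u)) x v = (A' v u : ℂ) := by
    intro u v
    have h2 : HasFDerivAt (fun y => A y u) (A'.flip u) x := by
      simpa using! hA.clm_apply (hasFDerivAt_const u x)
    have h3 : HasFDerivAt (fun y => covectorForm (A y) (fun _ => u))
        (Complex.ofRealCLM.comp (A'.flip u)) x := Complex.ofRealCLM.hasFDerivAt.comp x h2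
    rw [h3.fderiv]
    rfl
  have h0 : Fin.removeNth 0 w = fun _ => w 1 := by ext i; fin_cases i; rfl
  have h1' : Fin.removeNth 1 w = fun _ => w 0 := by ext i; fin_cases i; rfl
  rw [Fin.sum_univ_two, h0, h1', h1, h1]
  push_cast
  simp [sub_eq_add_neg]

section CotangentChart

variable {EM : Type*} [NormedAddCommGroup EM] [NormedSpace ℝ EM]
  {M : Type*} [TopologicalSpace M] [ChartedSpace EM M] [IsManifold 𝓘(ℝ, EM) ∞ M]

theorem cotangent_extChartAt_apply (p q : Cotangent EM M) (hq : q.1 ∈ (chartAt EM p.1).source) :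
    extChartAt (cotModel EM) p q = ((extChartAt 𝓘(ℝ, EM) p.1 q.1,
      q.2.comp (mfderivWithin 𝓘(ℝ, EM) 𝓘(ℝ, EM) (extChartAt 𝓘(ℝ, EM) p.1).symm (range 𝓘(ℝ, EM))
        (extChartAt 𝓘(ℝ, EM) p.1 q.1))) : EM × (EM →L[ℝ] ℝ)) := by
  rw [FiberBundle.extChartAt]
  refine Prod.ext ?_ (cotangent_trivializationAt_snd p.1 q hq)
  have : ((trivializationAt (EM →L[ℝ] ℝ) (fun x : M => TangentSpace 𝓘(ℝ, EM) x →L[ℝ] ℝ) p.1) q).1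
      = q.1 := by
    refine Trivialization.coe_fst' _ ?_
    simpa [hom_trivializationAt_baseSet] using! hq
  exact congrArg (extChartAt 𝓘(ℝ, EM) p.1) this

theorem cotangent_extChartAt_symm_fst (p : Cotangent EM M) {w : EM × (EM →L[ℝ] ℝ)}
    (hw : w ∈ (extChartAt (cotModel EM) p).target) :
    ((extChartAt (cotModel EM) p).symm w).1 = (extChartAt 𝓘(ℝ, EM) p.1).symm w.1 ∧
      w.1 ∈ (extChartAt 𝓘(ℝ, EM) p.1).target ∧
      ((extChartAt (cotModel EM) p).symm w).1 ∈ (chartAt EM p.1).source := by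
  have hs := (extChartAt (cotModel EM) p).map_target hw
  have h1 : ((extChartAt (cotModel EM) p).symm w).1 ∈ (chartAt EM p.1).source := by
    rw [extChartAt_source, FiberBundle.chartedSpace_chartAt] at hs
    have := (Trivialization.mem_source _).1 hs.1
    simpa [hom_trivializationAt_baseSet] using! this
  have h2 := cotangent_extChartAt_apply p _ h1
  rw [(extChartAt (cotModel EM) p).right_inv hw] at h2
  have h3 : w.1 = extChartAt 𝓘(ℝ, EM) p.1 ((extChartAt (cotModel EM) p).symm w).1 :=
    congrArg Prod.fst h2
  have h4 : ((extChartAt (cotModel EM) p).symm w).1 ∈ (extChartAt 𝓘(ℝ, EM) p.1).source := by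
    simpa using h1
  refine ⟨?_, ?_, h1⟩
  · rw [h3, (extChartAt 𝓘(ℝ, EM) p.1).left_inv h4]
  · rw [h3]
    exact (extChartAt 𝓘(ℝ, EM) p.1).map_source h4

/-- The tangent space at `x` is the model space read in the preferred chart at `x`, so the chart has
identity derivative there. Stating this between model spaces makes it usable in compositions. -/
theorem mfderiv_extChartAt_base (x : M) :
    (mfderiv 𝓘(ℝ, EM) 𝓘(ℝ, EM) (extChartAt 𝓘(ℝ, EM) x) x : EM →L[ℝ] EM) =
      ContinuousLinearMap.id ℝ EM := mfderiv_extChartAt_self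

theorem mfderiv_extChartAt_symm_base (x : M) :
    (mfderivWithin 𝓘(ℝ, EM) 𝓘(ℝ, EM) (extChartAt 𝓘(ℝ, EM) x).symm (range 𝓘(ℝ, EM))
      (extChartAt 𝓘(ℝ, EM) x x) : EM →L[ℝ] EM) = ContinuousLinearMap.id ℝ EM :=
  mfderivWithin_range_extChartAt_symm

theorem mfderiv_cotangent_extChartAt_base (p : Cotangent EM M) :
    (mfderiv (cotModel EM) 𝓘(ℝ, EM × (EM →L[ℝ] ℝ)) (extChartAt (cotModel EM) p) p :
      EM × (EM →L[ℝ] ℝ) →L[ℝ] EM × (EM →L[ℝ] ℝ)) = ContinuousLinearMap.id ℝ _ :=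
  mfderiv_extChartAt_self

/-- Near `p`, the base chart after the projection is the first coordinate of the bundle chart, and
both charts have identity derivative at their centre. -/
theorem mfderiv_cotangent_proj (p : Cotangent EM M) :
    (mfderiv (cotModel EM) 𝓘(ℝ, EM) (fun q : Cotangent EM M => q.1) p :
      EM × (EM →L[ℝ] ℝ) →L[ℝ] EM) = ContinuousLinearMap.fst ℝ EM (EM →L[ℝ] ℝ) := by
  have h1 : MDifferentiableAt (cotModel EM) 𝓘(ℝ, EM) (fun q : Cotangent EM M => q.1) p :=
    (Bundle.contMDiff_proj (n := ∞) (IB := 𝓘(ℝ, EM))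
      (fun x : M => TangentSpace 𝓘(ℝ, EM) x →L[ℝ] ℝ)).contMDiffAt.mdifferentiableAt (by simp)
  have h2 : MDifferentiableAt 𝓘(ℝ, EM) 𝓘(ℝ, EM) (extChartAt 𝓘(ℝ, EM) p.1) p.1 :=
    mdifferentiableAt_extChartAt (mem_chart_source EM p.1)
  have h3 : MDifferentiableAt (cotModel EM) 𝓘(ℝ, EM × (EM →L[ℝ] ℝ)) (extChartAt (cotModel EM) p) p :=
    mdifferentiableAt_extChartAt (mem_chart_source _ p)
  have h4 : MDifferentiableAt 𝓘(ℝ, EM × (EM →L[ℝ] ℝ)) 𝓘(ℝ, EM) (Prod.fst : EM × (EM →L[ℝ] ℝ) → EM)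
      (extChartAt (cotModel EM) p p) := differentiableAt_fst.mdifferentiableAt
  have h5 := mfderiv_of_comp_eq (φ := fun q : Cotangent EM M => extChartAt 𝓘(ℝ, EM) p.1 q.1)
    (fun _ => rfl) rfl h2 h1
  have h6 := mfderiv_of_comp_eq
    (φ := fun q : Cotangent EM M => (extChartAt (cotModel EM) p q : EM × (EM →L[ℝ] ℝ)).1)
    (fun _ => rfl) rfl h4 h3
  have h7 : (fun q : Cotangent EM M => extChartAt 𝓘(ℝ, EM) p.1 q.1) =ᶠ[𝓝 p]
      fun q => (extChartAt (cotModel EM) p q).1 := by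
    have : ContinuousAt (fun q : Cotangent EM M => q.1) p := h1.continuousAt
    filter_upwards [this.preimage_mem_nhds ((chartAt EM p.1).open_source.mem_nhds
      (mem_chart_source EM p.1))] with q hq
    rw [cotangent_extChartAt_apply p q hq]
  replace h5 := h5.trans ((congrArg (fun L : EM →L[ℝ] EM => L.comp
    (mfderiv (cotModel EM) 𝓘(ℝ, EM) (fun q : Cotangent EM M => q.1) p :
      EM × (EM →L[ℝ] ℝ) →L[ℝ] EM)) (mfderiv_extChartAt_base p.1)).trans
    (ContinuousLinearMap.id_comp _))
  replace h6 := h6.trans ((congrArg (fun L : EM × (EM →L[ℝ] ℝ) →L[ℝ] EM × (EM →L[ℝ] ℝ) =>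
    (mfderiv 𝓘(ℝ, EM × (EM →L[ℝ] ℝ)) 𝓘(ℝ, EM) (Prod.fst : EM × (EM →L[ℝ] ℝ) → EM)
      (extChartAt (cotModel EM) p p) : EM × (EM →L[ℝ] ℝ) →L[ℝ] EM).comp L)
      (mfderiv_cotangent_extChartAt_base p)).trans (ContinuousLinearMap.comp_id _))
  have h8 : (mfderiv (cotModel EM) 𝓘(ℝ, EM)
      (fun q : Cotangent EM M => extChartAt 𝓘(ℝ, EM) p.1 q.1) p :
      EM × (EM →L[ℝ] ℝ) →L[ℝ] EM) = mfderiv (cotModel EM) 𝓘(ℝ, EM)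
        (fun q : Cotangent EM M => (extChartAt (cotModel EM) p q).1) p := h7.mfderiv_eq
  refine h5.symm.trans (h8.trans (h6.trans ?_))
  rw [mfderiv_eq_fderiv]
  exact fderiv_fst

/-- The velocity of a curve in the cotangent bundle, in the chart. -/
theorem mfderiv_cotangent_curve {γ : ℝ → Cotangent EM M} {p : Cotangent EM M} (h0 : γ 0 = p)
    (hγ : MDifferentiableAt 𝓘(ℝ, ℝ) (cotModel EM) γ 0) :
    (mfderiv 𝓘(ℝ, ℝ) (cotModel EM) γ 0 : ℝ →L[ℝ] EM × (EM →L[ℝ] ℝ)) =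
      fderiv ℝ (fun t => (extChartAt (cotModel EM) p (γ t) : EM × (EM →L[ℝ] ℝ))) 0 := by
  subst h0
  have h3 : MDifferentiableAt (cotModel EM) 𝓘(ℝ, EM × (EM →L[ℝ] ℝ))
      (extChartAt (cotModel EM) (γ 0)) (γ 0) :=
    mdifferentiableAt_extChartAt (mem_chart_source _ (γ 0))
  have h6 := mfderiv_of_comp_eq
    (φ := fun t => (extChartAt (cotModel EM) (γ 0) (γ t) : EM × (EM →L[ℝ] ℝ)))
    (fun _ => rfl) rfl h3 hγ
  replace h6 := h6.trans ((congrArg (fun L : EM × (EM →L[ℝ] ℝ) →L[ℝ] EM × (EM →L[ℝ] ℝ) => L.comp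
    (mfderiv 𝓘(ℝ, ℝ) (cotModel EM) γ 0 : ℝ →L[ℝ] EM × (EM →L[ℝ] ℝ)))
    (mfderiv_cotangent_extChartAt_base (γ 0))).trans (ContinuousLinearMap.id_comp _))
  rw [mfderiv_eq_fderiv] at h6
  exact h6.symm

/-- The fibre coordinate of a covector in the preferred chart around `x₀`. -/
def cotCoord (x₀ : M) (q : Cotangent EM M) : EM →L[ℝ] ℝ :=
  q.2.comp (mfderivWithin 𝓘(ℝ, EM) 𝓘(ℝ, EM) (extChartAt 𝓘(ℝ, EM) x₀).symm (range 𝓘(ℝ, EM))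
    (extChartAt 𝓘(ℝ, EM) x₀ q.1))

theorem cotCoord_base (x : M) (q : EM →L[ℝ] ℝ) : cotCoord x (⟨x, q⟩ : Cotangent EM M) = q :=
  (congrArg (fun L : EM →L[ℝ] EM => q.comp L)
    (mfderiv_extChartAt_symm_base x)).trans (ContinuousLinearMap.comp_id _)

theorem contMDiffAt_cotangent_iff {F : Type*} [NormedAddCommGroup F] [NormedSpace ℝ F]
    {B N : Type*} [TopologicalSpace B] [TopologicalSpace N] [ChartedSpace B N]
    {I : ModelWithCorners ℝ F B} {γ : N → Cotangent EM M} {z : N} (x₀ : M)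
    (h0 : (γ z).1 ∈ (chartAt EM x₀).source) :
    ContMDiffAt I (cotModel EM) ∞ γ z ↔ ContMDiffAt I 𝓘(ℝ, EM) ∞ (fun t => (γ t).1) z ∧
      ContMDiffAt I 𝓘(ℝ, EM →L[ℝ] ℝ) ∞ (fun t => cotCoord x₀ (γ t)) z := by
  rw [Bundle.Trivialization.contMDiffAt_iff
    (e := trivializationAt (EM →L[ℝ] ℝ) (fun x : M => TangentSpace 𝓘(ℝ, EM) x →L[ℝ] ℝ) x₀)]
  · refine and_congr_right fun h => Filter.EventuallyEq.contMDiffAt_iff ?_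
    filter_upwards [h.continuousAt.preimage_mem_nhds ((chartAt EM x₀).open_source.mem_nhds h0)]
      with t ht
    exact cotangent_trivializationAt_snd x₀ (γ t) ht
  · rw [Trivialization.mem_source]
    simpa [hom_trivializationAt_baseSet] using! h0

theorem verticalVector_eq (p : Cotangent EM M) (b : TangentSpace 𝓘(ℝ, EM) p.1 →L[ℝ] ℝ) :
    (verticalVector p b : EM × (EM →L[ℝ] ℝ)) = (0, b) := by
  obtain ⟨x, q⟩ := p
  change EM →L[ℝ] ℝ at q b
  let γ : ℝ → Cotangent EM M := fun t => ⟨x, q + t • b⟩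
  have hc : (fun t : ℝ => (extChartAt (cotModel EM) (⟨x, q⟩ : Cotangent EM M) (γ t) :
      EM × (EM →L[ℝ] ℝ))) = fun t => ((extChartAt 𝓘(ℝ, EM) x x, q + t • b) :
      EM × (EM →L[ℝ] ℝ)) := by
    ext1 t
    refine (cotangent_extChartAt_apply ⟨x, q⟩ (γ t) (mem_chart_source EM x)).trans ?_
    exact Prod.ext rfl (cotCoord_base x _)
  have hd : HasDerivAt (fun t : ℝ => ((extChartAt 𝓘(ℝ, EM) x x, q + t • b) :
      EM × (EM →L[ℝ] ℝ))) ((0, b) : EM × (EM →L[ℝ] ℝ)) 0 := by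
    have h1 : HasDerivAt (fun t : ℝ => q + t • b) b 0 := by
      simpa using! ((hasDerivAt_id (0 : ℝ)).smul_const b).const_add q
    exact (hasDerivAt_const (0 : ℝ) _).prodMk h1
  have hγ : ContMDiffAt 𝓘(ℝ, ℝ) (cotModel EM) ∞ γ 0 := by
    refine (contMDiffAt_cotangent_iff x (mem_chart_source EM x)).2 ⟨contMDiffAt_const, ?_⟩
    have h3 : ContDiffAt ℝ ∞ (fun t : ℝ => q + t • b) 0 := by fun_prop
    refine h3.contMDiffAt.congr_of_eventuallyEq (Eventually.of_forall fun t => ?_)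
    exact cotCoord_base x _
  have h4 := mfderiv_cotangent_curve (γ := γ) (p := ⟨x, q⟩)
    (by simp only [γ]; rw [zero_smul, add_zero]) (hγ.mdifferentiableAt (by simp))
  rw [hc] at h4
  exact (DFunLike.congr_fun h4 1).trans hd.deriv

theorem cotangent_symm_coord (p : Cotangent EM M) {w : EM × (EM →L[ℝ] ℝ)}
    (hw : w ∈ (extChartAt (cotModel EM) p).target) :
    extChartAt 𝓘(ℝ, EM) p.1 ((extChartAt (cotModel EM) p).symm w).1 = w.1 ∧
      cotCoord p.1 ((extChartAt (cotModel EM) p).symm w) = w.2 := by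
  obtain ⟨-, -, h1⟩ := cotangent_extChartAt_symm_fst p hw
  have h2 := cotangent_extChartAt_apply p _ h1
  rw [(extChartAt (cotModel EM) p).right_inv hw] at h2
  exact ⟨(congrArg Prod.fst h2).symm, (congrArg Prod.snd h2).symm⟩

/-- This is `-∑ p_j dq^j` in canonical coordinates: the projection reads as the first coordinate,
and the derivative of the inverse chart it leaves behind is the one absorbed in the fibre coordinate
`cotCoord`. -/
theorem formInChart_canonicalForm (p : Cotangent EM M) {w : EM × (EM →L[ℝ] ℝ)}
    (hw : w ∈ (extChartAt (cotModel EM) p).target) :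
    formInChart (cotModel EM) (fun q : Cotangent EM M => canonicalForm q 1) p w =
      covectorForm (-(w.2.comp (ContinuousLinearMap.fst ℝ EM (EM →L[ℝ] ℝ)))) := by
  set q := (extChartAt (cotModel EM) p).symm w with hq
  obtain ⟨h1, h2, h3⟩ := cotangent_extChartAt_symm_fst p hw
  obtain ⟨h4, h5⟩ := cotangent_symm_coord p hw
  have hd1 : MDifferentiableAt (cotModel EM) 𝓘(ℝ, EM) (fun q : Cotangent EM M => q.1) q :=
    (Bundle.contMDiff_proj (n := ∞) (IB := 𝓘(ℝ, EM))
      (fun x : M => TangentSpace 𝓘(ℝ, EM) x →L[ℝ] ℝ)).contMDiffAt.mdifferentiableAt (by simp)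
  have hd2 : MDifferentiableAt 𝓘(ℝ, EM × (EM →L[ℝ] ℝ)) (cotModel EM)
      (extChartAt (cotModel EM) p).symm w :=
    ((contMDiffOn_extChartAt_symm (n := ∞) p).contMDiffAt
      ((isOpen_extChartAt_target p).mem_nhds hw)).mdifferentiableAt (by simp)
  have hd3 : MDifferentiableAt 𝓘(ℝ, EM) 𝓘(ℝ, EM) (extChartAt 𝓘(ℝ, EM) p.1).symm w.1 :=
    ((contMDiffOn_extChartAt_symm (n := ∞) p.1).contMDiffAt
      ((isOpen_extChartAt_target p.1).mem_nhds h2)).mdifferentiableAt (by simp)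
  have hd4 : MDifferentiableAt 𝓘(ℝ, EM × (EM →L[ℝ] ℝ)) 𝓘(ℝ, EM)
      (Prod.fst : EM × (EM →L[ℝ] ℝ) → EM) w := differentiableAt_fst.mdifferentiableAt
  have e1 := mfderiv_of_comp_eq
    (φ := fun w => ((extChartAt (cotModel EM) p).symm w).1) (fun _ => rfl) rfl hd1 hd2
  have e2 := mfderiv_of_comp_eq (φ := fun w : EM × (EM →L[ℝ] ℝ) =>
    (extChartAt 𝓘(ℝ, EM) p.1).symm w.1) (fun _ => rfl) rfl hd3 hd4
  have e3 : (fun w => ((extChartAt (cotModel EM) p).symm w).1) =ᶠ[𝓝 w]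
      fun w : EM × (EM →L[ℝ] ℝ) => (extChartAt 𝓘(ℝ, EM) p.1).symm w.1 := by
    filter_upwards [(isOpen_extChartAt_target p).mem_nhds hw] with w' hw'
    exact (cotangent_extChartAt_symm_fst p hw').1
  have e4 : (mfderiv 𝓘(ℝ, EM × (EM →L[ℝ] ℝ)) 𝓘(ℝ, EM)
      (fun w => ((extChartAt (cotModel EM) p).symm w).1) w : EM × (EM →L[ℝ] ℝ) →L[ℝ] EM) =
      mfderiv 𝓘(ℝ, EM × (EM →L[ℝ] ℝ)) 𝓘(ℝ, EM) (fun w : EM × (EM →L[ℝ] ℝ) =>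
        (extChartAt 𝓘(ℝ, EM) p.1).symm w.1) w := e3.mfderiv_eq
  have e5 : (mfderiv 𝓘(ℝ, EM × (EM →L[ℝ] ℝ)) 𝓘(ℝ, EM)
      (Prod.fst : EM × (EM →L[ℝ] ℝ) → EM) w : EM × (EM →L[ℝ] ℝ) →L[ℝ] EM) =
      ContinuousLinearMap.fst ℝ EM (EM →L[ℝ] ℝ) := by
    rw [mfderiv_eq_fderiv]; exact fderiv_fst
  have e6 : ∀ z, z = w.1 → ∀ v : EM, (mfderivWithin 𝓘(ℝ, EM) 𝓘(ℝ, EM) (extChartAt 𝓘(ℝ, EM) p.1).symm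
      (range 𝓘(ℝ, EM)) z : EM →L[ℝ] EM) v =
      (mfderiv 𝓘(ℝ, EM) 𝓘(ℝ, EM) (extChartAt 𝓘(ℝ, EM) p.1).symm w.1 : EM →L[ℝ] EM) v := by
    rintro _ rfl v
    rw [ModelWithCorners.range_eq_univ, mfderivWithin_univ]
  have key : ∀ v : EM × (EM →L[ℝ] ℝ), (q.2 : EM →L[ℝ] ℝ)
      ((mfderiv (cotModel EM) 𝓘(ℝ, EM) (fun q : Cotangent EM M => q.1) q :
        EM × (EM →L[ℝ] ℝ) →L[ℝ] EM) ((mfderiv 𝓘(ℝ, EM × (EM →L[ℝ] ℝ)) (cotModel EM)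
        (extChartAt (cotModel EM) p).symm w : EM × (EM →L[ℝ] ℝ) →L[ℝ] EM × (EM →L[ℝ] ℝ)) v)) =
      w.2 v.1 := by
    intro v
    have e7 := DFunLike.congr_fun (e1.symm.trans (e4.trans (e2.trans (congrArg
      (fun L : EM × (EM →L[ℝ] ℝ) →L[ℝ] EM => (mfderiv 𝓘(ℝ, EM) 𝓘(ℝ, EM)
        (extChartAt 𝓘(ℝ, EM) p.1).symm w.1 : EM →L[ℝ] EM).comp L) e5)))) v
    rw [← h5]
    exact congrArg (q.2 : EM →L[ℝ] ℝ) (e7.trans (e6 _ h4 v.1).symm)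
  ext v
  unfold formInChart
  simp only [ModelWithCorners.range_eq_univ, mfderivWithin_univ, canonicalForm, GradedForm.homog_self]
  exact congrArg (fun r : ℝ => ((-r : ℝ) : ℂ)) (key (v 0))

theorem mextDeriv_eq_extDeriv {F : Type*} [NormedAddCommGroup F] [NormedSpace ℝ F] {B : Type*}
    [TopologicalSpace B] {I : ModelWithCorners ℝ F B} [I.Boundaryless] {N : Type*} [TopologicalSpace N]
    [ChartedSpace B N] [IsManifold I 1 N] {n : ℕ} (η : FormField I N n) (x : N) :
    (mextDeriv I η x : F [⋀^Fin (n + 1)]→L[ℝ] ℂ) =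
      extDeriv (formInChart I η x) (extChartAt I x x) := by
  unfold mextDeriv
  simp only [ModelWithCorners.range_eq_univ, extDerivWithin_univ]
  ext v
  exact congrArg (fun L : F →L[ℝ] F => extDeriv (formInChart I η x) (extChartAt I x x)
    (fun i => L (v i))) mfderiv_extChartAt_self

theorem mextDeriv_covectorForm_apply [FiniteDimensional ℝ EM]
    {α : (x : M) → (TangentSpace 𝓘(ℝ, EM) x →L[ℝ] ℝ)} {x : M}
    (hα : DifferentiableAt ℝ (coordForm α x) (extChartAt 𝓘(ℝ, EM) x x)) (w : Fin 2 → EM) :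
    (mextDeriv 𝓘(ℝ, EM) (fun y => covectorForm (α y)) x : EM [⋀^Fin 2]→L[ℝ] ℂ) w =
      ((fderiv ℝ (coordForm α x) (extChartAt 𝓘(ℝ, EM) x x) (w 0) (w 1) -
        fderiv ℝ (coordForm α x) (extChartAt 𝓘(ℝ, EM) x x) (w 1) (w 0) : ℝ) : ℂ) := by
  rw [mextDeriv_eq_extDeriv, formInChart_covectorForm]
  exact extDeriv_covectorForm_apply hα.hasFDerivAt w

set_option synthInstance.maxHeartbeats 200000 in
/-- The exterior derivative of the canonical `1`-form. -/
theorem mextDeriv_canonicalForm_apply [FiniteDimensional ℝ EM] (p : Cotangent EM M)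
    (w : Fin 2 → EM × (EM →L[ℝ] ℝ)) :
    (mextDeriv (cotModel EM) (fun q : Cotangent EM M => canonicalForm q 1) p :
      (EM × (EM →L[ℝ] ℝ)) [⋀^Fin 2]→L[ℝ] ℂ) w =
      (((w 1).2 (w 0).1 - (w 0).2 (w 1).1 : ℝ) : ℂ) := by
  rw [mextDeriv_eq_extDeriv]
  -- In canonical coordinates the form depends linearly on the point, so it is its own derivative.
  let A : (EM × (EM →L[ℝ] ℝ)) →ₗ[ℝ] (EM × (EM →L[ℝ] ℝ)) →L[ℝ] ℝ :=
    { toFun := fun w => -(w.2.comp (ContinuousLinearMap.fst ℝ EM (EM →L[ℝ] ℝ)))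
      map_add' := fun a b => ContinuousLinearMap.ext fun v => neg_add (a.2 v.1) (b.2 v.1)
      map_smul' := fun c a => ContinuousLinearMap.ext fun v => (mul_neg c (a.2 v.1)).symm }
  have h1 : formInChart (cotModel EM) (fun q : Cotangent EM M => canonicalForm q 1) p
      =ᶠ[𝓝 (extChartAt (cotModel EM) p p)] fun w => covectorForm (A w) := by
    filter_upwards [(isOpen_extChartAt_target p).mem_nhds (mem_extChartAt_target p)] with w hw
    exact formInChart_canonicalForm p hw
  rw [h1.extDeriv_eq]
  have h2 := extDeriv_covectorForm_apply
    ((LinearMap.toContinuousLinearMap A).hasFDerivAt (x := extChartAt (cotModel EM) p p)) w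
  refine h2.trans (congrArg _ ?_)
  change -((w 0).2 (w 1).1) - -((w 1).2 (w 0).1) = (w 1).2 (w 0).1 - (w 0).2 (w 1).1
  ring

end CotangentChart

/-! ### Tangent vectors to the conormal bundle. -/

theorem Submodule.exists_eq_sum_basis {k : ℕ} {V : Type*} [AddCommGroup V] [Module ℝ V]
    {S : Submodule ℝ V} (β : Module.Basis (Fin k) ℝ S) {b : Fin k → V} (hb : ∀ j, (β j : V) = b j)
    {q : V} (hq : q ∈ S) : ∃ c : Fin k → ℝ, q = ∑ j, c j • b j := by
  refine ⟨fun j => β.repr ⟨q, hq⟩ j, ?_⟩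
  have h := congrArg (Subtype.val) (β.sum_repr ⟨q, hq⟩)
  rw [AddSubmonoidClass.coe_finsetSum] at h
  exact h.symm.trans (Finset.sum_congr rfl fun j _ => by rw [← hb j]; rfl)

section Conormal

variable {EM : Type*} [NormedAddCommGroup EM] [NormedSpace ℝ EM]
  {M : Type*} [TopologicalSpace M] [ChartedSpace EM M] {k : ℕ}
  {E : (x : M) → Submodule ℝ (TangentSpace 𝓘(ℝ, EM) x)}
  {o : (x : M) → Orientation ℝ (conormal E x) (Fin k)}

theorem IsPositive.exists_eq_sum {x : M} {b : Fin k → (TangentSpace 𝓘(ℝ, EM) x →L[ℝ] ℝ)}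
    (hb : IsPositive o x b) {q : TangentSpace 𝓘(ℝ, EM) x →L[ℝ] ℝ} (hq : q ∈ conormal E x) :
    ∃ c : Fin k → ℝ, q = ∑ j, c j • b j := by
  obtain ⟨β, hβ, -⟩ := hb
  exact Submodule.exists_eq_sum_basis (V := TangentSpace 𝓘(ℝ, EM) x →L[ℝ] ℝ) β hβ hq

variable [IsManifold 𝓘(ℝ, EM) ∞ M]

theorem exists_coordVec {V : (x : M) → TangentSpace 𝓘(ℝ, EM) x} {U : Set M} (hU : IsOpen U)
    (hV : ContMDiffOn 𝓘(ℝ, EM) 𝓘(ℝ, EM).tangent ∞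
      (fun x => (⟨x, V x⟩ : TangentBundle 𝓘(ℝ, EM) M)) U) {x : M} (hx : x ∈ U) :
    ∃ W : EM → EM, ContDiffAt ℝ ∞ W (extChartAt 𝓘(ℝ, EM) x x) ∧
      ∀ z ∈ (extChartAt 𝓘(ℝ, EM) x).target,
        (mfderivWithin 𝓘(ℝ, EM) 𝓘(ℝ, EM) (extChartAt 𝓘(ℝ, EM) x).symm (range 𝓘(ℝ, EM)) z :
          EM →L[ℝ] EM) (W z) = V ((extChartAt 𝓘(ℝ, EM) x).symm z) := by
  refine ⟨fun z => (trivializationAt EM (TangentSpace 𝓘(ℝ, EM)) x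
    ⟨(extChartAt 𝓘(ℝ, EM) x).symm z, V ((extChartAt 𝓘(ℝ, EM) x).symm z)⟩).2, ?_, ?_⟩
  · have h1 := hV.contMDiffAt (hU.mem_nhds hx)
    rw [Bundle.Trivialization.contMDiffAt_section_iff
      (trivializationAt EM (TangentSpace 𝓘(ℝ, EM)) x)
      (FiberBundle.mem_baseSet_trivializationAt' x)] at h1
    have h2 : ContMDiffAt 𝓘(ℝ, EM) 𝓘(ℝ, EM) ∞ (extChartAt 𝓘(ℝ, EM) x).symm
        (extChartAt 𝓘(ℝ, EM) x x) :=
      (contMDiffOn_extChartAt_symm x).contMDiffAt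
        ((isOpen_extChartAt_target x).mem_nhds (mem_extChartAt_target x))
    have h3 := h1.comp_of_eq h2 (extChartAt_to_inv x)
    exact h3.contDiffAt
  · intro z hz
    have hs : (extChartAt 𝓘(ℝ, EM) x).symm z ∈ (chartAt EM x).source := by
      simpa using (extChartAt 𝓘(ℝ, EM) x).map_target hz
    have e1 := mfderivWithin_extChartAt_symm_comp_mfderiv_extChartAt (I := 𝓘(ℝ, EM)) hz
    have e2 := TangentBundle.continuousLinearMapAt_trivializationAt (I := 𝓘(ℝ, EM)) hs
    have e3 := (congrFun (Trivialization.continuousLinearMapAt_apply ℝ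
      (trivializationAt EM (TangentSpace 𝓘(ℝ, EM)) x) ((extChartAt 𝓘(ℝ, EM) x).symm z))
      (V ((extChartAt 𝓘(ℝ, EM) x).symm z))).trans
      (congrFun (Trivialization.coe_linearMapAt_of_mem (R := ℝ)
        (trivializationAt EM (TangentSpace 𝓘(ℝ, EM)) x) (by simpa using hs)) _)
    have e4 := e3.symm.trans (DFunLike.congr_fun e2 (V ((extChartAt 𝓘(ℝ, EM) x).symm z)))
    exact (congrArg (mfderivWithin 𝓘(ℝ, EM) 𝓘(ℝ, EM) (extChartAt 𝓘(ℝ, EM) x).symm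
      (range 𝓘(ℝ, EM)) z : EM →L[ℝ] EM) e4).trans (DFunLike.congr_fun e1 _)

/-- The fibre component of a vector tangent to the conormal bundle. -/
theorem IsTangentToConormal.exists_snd_eq {r : ℕ} (hE : IsSmoothDistribution E r) {U : Set M}
    {α : Fin k → (x : M) → (TangentSpace 𝓘(ℝ, EM) x →L[ℝ] ℝ)} (hα : IsOrientedFrame o U α)
    {x : M} (hx : x ∈ U) {ξ : Fin k → ℝ} {q : EM →L[ℝ] ℝ} (hq : q = ∑ j, ξ j • α j x)
    {w : EM × (EM →L[ℝ] ℝ)} (hw : IsTangentToConormal E (⟨x, q⟩ : Cotangent EM M) w) :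
    ∃ c : Fin k → ℝ, w.2 = (∑ j, c j • (show EM →L[ℝ] ℝ from α j x)) +
      ∑ j, ξ j • fderiv ℝ (coordForm (α j) x) (extChartAt 𝓘(ℝ, EM) x x) w.1 := by
  obtain ⟨γ, h0, hγ, hcon, hv⟩ := hw
  set e := extChartAt 𝓘(ℝ, EM) x with he
  have h0x : (γ 0).1 = x := by rw [h0]
  have h0s : (γ 0).1 ∈ (chartAt EM x).source := by rw [h0x]; exact mem_chart_source EM x
  obtain ⟨hγ1, hγ2⟩ := (contMDiffAt_cotangent_iff x h0s).1 hγ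
  have hsrc : ∀ᶠ t in 𝓝 (0 : ℝ), (γ t).1 ∈ (chartAt EM x).source :=
    hγ1.continuousAt.preimage_mem_nhds ((chartAt EM x).open_source.mem_nhds h0s)
  set y : ℝ → EM := fun t => e (γ t).1 with hy
  set η : ℝ → EM →L[ℝ] ℝ := fun t => cotCoord x (γ t) with hη
  have hyd : ContDiffAt ℝ ∞ y 0 := ((contMDiffAt_extChartAt' h0s).comp (0 : ℝ) hγ1).contDiffAt
  have hηd : ContDiffAt ℝ ∞ η 0 := hγ2.contDiffAt
  have hy0 : y 0 = e x := by rw [hy]; simp only [h0x]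
  have hη0 : η 0 = q := by
    rw [hη]; simp only [h0]; exact cotCoord_base x q
  have hpair : (fun t => (extChartAt (cotModel EM) (⟨x, q⟩ : Cotangent EM M) (γ t) :
      EM × (EM →L[ℝ] ℝ))) =ᶠ[𝓝 0] fun t => (y t, η t) := by
    filter_upwards [hsrc] with t ht
    exact cotangent_extChartAt_apply ⟨x, q⟩ (γ t) ht
  have hderiv : HasDerivAt (fun t => (y t, η t)) w 0 := by
    have h1 : DifferentiableAt ℝ (fun t => (y t, η t)) 0 :=
      (hyd.differentiableAt (by simp)).prodMk (hηd.differentiableAt (by simp))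
    have h2 := mfderiv_cotangent_curve h0 (hγ.mdifferentiableAt (by simp))
    rw [hpair.fderiv_eq] at h2
    have h3 : deriv (fun t => (y t, η t)) 0 = w := (DFunLike.congr_fun h2 1).symm.trans hv
    rw [← h3]
    exact h1.hasDerivAt
  have hyv : HasDerivAt y w.1 0 := hderiv.fst
  have hηv : HasDerivAt η w.2 0 := hderiv.snd
  obtain ⟨U', hU', hxU', V, hV, hVE⟩ := hE x
  set P : Fin k → EM → EM →L[ℝ] ℝ := fun j => coordForm (α j) x with hP
  have hPd : ∀ j, DifferentiableAt ℝ (P j) (e x) := fun j =>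
    (contDiffAt_coordForm hα.isOpen (hα.smooth j) x (mem_extChartAt_target x)
      (by rw [extChartAt_to_inv]; exact hx)).differentiableAt (by simp)
  have hcs : ContinuousAt e.symm (e x) := continuousAt_extChartAt_symm x
  have hnear : ∀ᶠ z in 𝓝 (e x), z ∈ e.target ∧ e.symm z ∈ U ∧ e.symm z ∈ U' := by
    have h1 : e.symm (e x) = x := extChartAt_to_inv x
    have h2 : ∀ᶠ z in 𝓝 (e x), z ∈ e.target :=
      (isOpen_extChartAt_target x).mem_nhds (mem_extChartAt_target x)
    have h3 : ∀ᶠ z in 𝓝 (e x), e.symm z ∈ U :=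
      hcs.preimage_mem_nhds (by rw [h1]; exact hα.isOpen.mem_nhds hx)
    have h4 : ∀ᶠ z in 𝓝 (e x), e.symm z ∈ U' :=
      hcs.preimage_mem_nhds (by rw [h1]; exact hU'.mem_nhds hxU')
    exact h2.and (h3.and h4)
  -- The fibre component minus its expected value annihilates `E`, hence is a combination of the
  -- frame. It is tested on the fields `V i` spanning `E`, extended off `x` so that the relations
  -- can be differentiated.
  have hρ : (w.2 - ∑ j, ξ j • fderiv ℝ (P j) (e x) w.1 : EM →L[ℝ] ℝ) ∈ conormal E x := by
    have hmain : ∀ i, (w.2 - ∑ j, ξ j • fderiv ℝ (P j) (e x) w.1 : EM →L[ℝ] ℝ) (V i x) = 0 := by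
      intro i
      obtain ⟨W, hW, hWV⟩ := exists_coordVec hU' (hV i) hxU'
      have hVEi : ∀ z ∈ U', V i z ∈ E z := fun z hz => by
        rw [← (hVE z hz).2]; exact Submodule.subset_span ⟨i, rfl⟩
      have hW0 : W (e x) = V i x := by
        have h1 := hWV (e x) (mem_extChartAt_target x)
        have h2 : ∀ z, z = x → (V i z : EM) = V i x := by rintro _ rfl; rfl
        exact ((DFunLike.congr_fun (mfderiv_extChartAt_symm_base x) (W (e x))).symm.trans h1).trans
          (h2 _ (extChartAt_to_inv x))
      have hWd : HasFDerivAt W (fderiv ℝ W (e x)) (e x) :=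
        (hW.differentiableAt (by simp)).hasFDerivAt
      -- Differentiating `α_j(V_i) = 0` in the base direction `w.1`.
      have hA : ∀ j, fderiv ℝ (P j) (e x) w.1 (W (e x)) +
          P j (e x) (fderiv ℝ W (e x) w.1) = 0 := by
        intro j
        have h1 : HasFDerivAt (fun z => P j z (W z)) _ (e x) := (hPd j).hasFDerivAt.clm_apply hWd
        have h2 : (fun z => P j z (W z)) =ᶠ[𝓝 (e x)] fun _ => (0 : ℝ) := by
          filter_upwards [hnear] with z hz'
          obtain ⟨hz, hzU, hzU'⟩ := hz'
          have := (hα.positive _ hzU).mem_conormal j _ (hVEi _ hzU')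
          rw [← this]
          exact congrArg (α j (e.symm z)) (hWV z hz)
        have h3 := (h1.congr_of_eventuallyEq h2.symm).unique (hasFDerivAt_const (0 : ℝ) (e x))
        have h4 := DFunLike.congr_fun h3 w.1
        simpa [add_comm] using! h4
      -- Differentiating `γ(t)(V_i) = 0` along the curve.
      have hB : w.2 (W (e x)) + q (fderiv ℝ W (e x) w.1) = 0 := by
        have hWy : HasDerivAt (fun t => W (y t)) (fderiv ℝ W (e x) w.1) 0 := by
          rw [← hy0] at hWd ⊢
          exact hWd.comp_hasDerivAt 0 hyv
        have h1 := hηv.clm_apply hWy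
        have h2 : (fun t => η t (W (y t))) =ᶠ[𝓝 0] fun _ => (0 : ℝ) := by
          have h3 : ∀ᶠ t in 𝓝 (0 : ℝ), y t ∈ e.target ∧ e.symm (y t) ∈ U ∧ e.symm (y t) ∈ U' := by
            have h4 : Tendsto y (𝓝 0) (𝓝 (e x)) := hy0 ▸ hyd.continuousAt
            exact h4.eventually hnear
          filter_upwards [h3, hsrc, hcon] with t ht' hts htc
          obtain ⟨ht, -, htU'⟩ := ht'
          have hl : e.symm (y t) = (γ t).1 := e.left_inv (by simpa [he] using hts)
          rw [hl] at htU'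
          have := htc _ (hVEi _ htU')
          rw [← this]
          have h5 : ∀ z, z = (γ t).1 → (V i z : EM) = V i (γ t).1 := by rintro _ rfl; rfl
          exact congrArg (γ t).2 ((hWV (y t) ht).trans (h5 _ hl))
        have h3 := (h1.congr_of_eventuallyEq h2.symm).unique (hasDerivAt_const (0 : ℝ) (0 : ℝ))
        rw [hy0, hη0] at h3
        exact h3
      have hPx : ∀ j, P j (e x) = (α j x : EM →L[ℝ] ℝ) := by
        intro j
        have h2 : ∀ z, z = x → (α j z : EM →L[ℝ] ℝ) = α j x := by rintro _ rfl; rfl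
        exact ((congrArg (fun L : EM →L[ℝ] EM => (α j (e.symm (e x)) : EM →L[ℝ] ℝ).comp L)
          (mfderiv_extChartAt_symm_base x)).trans (ContinuousLinearMap.comp_id _)).trans
          (h2 _ (extChartAt_to_inv x))
      have hqe : q (fderiv ℝ W (e x) w.1) = ∑ j, ξ j * P j (e x) (fderiv ℝ W (e x) w.1) := by
        have hq' : q = ∑ j, ξ j • P j (e x) := by simp only [hPx]; exact hq
        rw [hq']
        simp
      rw [← hW0]
      have hs : (w.2 - ∑ j, ξ j • fderiv ℝ (P j) (e x) w.1 : EM →L[ℝ] ℝ) (W (e x)) =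
          w.2 (W (e x)) - ∑ j, ξ j * fderiv ℝ (P j) (e x) w.1 (W (e x)) := by
        simp
      rw [hs, eq_neg_of_add_eq_zero_left hB, hqe, ← Finset.sum_neg_distrib, ← Finset.sum_sub_distrib]
      refine Finset.sum_eq_zero fun j _ => ?_
      rw [eq_neg_of_add_eq_zero_left (hA j)]
      ring
    intro v hv'
    rw [← (hVE x hxU').2] at hv'
    induction hv' using Submodule.span_induction with
    | mem u hu => obtain ⟨i, rfl⟩ := hu; exact hmain i
    | zero => exact map_zero (_ : EM →L[ℝ] ℝ)
    | add a b _ _ ha hb =>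
      exact (map_add (_ : EM →L[ℝ] ℝ) a b).trans ((congrArg₂ (· + ·) ha hb).trans (add_zero 0))
    | smul c a _ ha =>
      exact (map_smul (_ : EM →L[ℝ] ℝ) c a).trans ((congrArg (c • ·) ha).trans (smul_zero c))
  obtain ⟨c, hc⟩ := (hα.positive x hx).exists_eq_sum hρ
  exact ⟨c, sub_eq_iff_eq_add.1 hc⟩

end Conormal

/-! ### Existence of lifts. -/

section Lift

variable {EM : Type*} [NormedAddCommGroup EM] [NormedSpace ℝ EM]
  {M : Type*} [TopologicalSpace M] [ChartedSpace EM M] {k : ℕ}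
  {E : (x : M) → Submodule ℝ (TangentSpace 𝓘(ℝ, EM) x)}
  {o : (x : M) → Orientation ℝ (conormal E x) (Fin k)}
  [IsManifold 𝓘(ℝ, EM) ∞ M]

/-- The section `∑ ξ_j α_j` with constant coefficients, along a straight line in the chart, is a
curve in the conormal bundle with the prescribed base velocity. Such lifts make the fibre integral,
defined by quantifying over all lifts, non-vacuous. -/
theorem exists_isTangentToConormal {U : Set M}
    {α : Fin k → (x : M) → (TangentSpace 𝓘(ℝ, EM) x →L[ℝ] ℝ)} (hα : IsOrientedFrame o U α)
    {x : M} (hx : x ∈ U) {q : TangentSpace 𝓘(ℝ, EM) x →L[ℝ] ℝ} (hq : q ∈ conormal E x)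
    (v : EM) :
    ∃ w : TangentSpace (cotModel EM) (⟨x, q⟩ : Cotangent EM M),
      IsTangentToConormal E (⟨x, q⟩ : Cotangent EM M) w ∧
      mfderiv (cotModel EM) 𝓘(ℝ, EM) (fun p : Cotangent EM M => p.1) _ w = v := by
  obtain ⟨ξ, rfl⟩ := (hα.positive x hx).exists_eq_sum hq
  set e := extChartAt 𝓘(ℝ, EM) x with he
  have hex : e.symm (e x) = x := extChartAt_to_inv x
  let σ : M → Cotangent EM M := fun y => ⟨y, ∑ j, ξ j • α j y⟩
  have hσ : ContMDiffAt 𝓘(ℝ, EM) (cotModel EM) ∞ σ x := by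
    refine contMDiffAt_of_coordForm ?_
    have h1 : ∀ j, ContDiffAt ℝ ∞ (coordForm (α j) x) (e x) := fun j =>
      contDiffAt_coordForm hα.isOpen (hα.smooth j) x (mem_extChartAt_target x)
        (by rw [extChartAt_to_inv]; exact hx)
    have h2 : ContDiffAt ℝ ∞ (fun y => ∑ j, ξ j • coordForm (α j) x y) (e x) :=
      ContDiffAt.sum fun j _ => (h1 j).const_smul (ξ j)
    refine h2.congr_of_eventuallyEq (Eventually.of_forall fun y => ?_)
    have h3 : ∀ (A : Fin k → EM →L[ℝ] ℝ) (L : EM →L[ℝ] EM),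
        (∑ j, ξ j • A j).comp L = ∑ j, ξ j • (A j).comp L := fun A L => by ext u; simp
    exact h3 (fun j => α j (e.symm y)) _
  let c : ℝ → M := fun t => e.symm (e x + t • v)
  have hc0 : c 0 = x := by
    change e.symm (e x + (0 : ℝ) • v) = x
    rw [zero_smul, add_zero, hex]
  have hsymm : ContMDiffAt 𝓘(ℝ, EM) 𝓘(ℝ, EM) ∞ e.symm (e x) :=
    (contMDiffOn_extChartAt_symm x).contMDiffAt
      ((isOpen_extChartAt_target x).mem_nhds (mem_extChartAt_target x))
  have hlin : HasDerivAt (fun t : ℝ => e x + t • v) v 0 := by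
    simpa using! ((hasDerivAt_id (0 : ℝ)).smul_const v).const_add (e x)
  have hlin' : ContMDiffAt 𝓘(ℝ, ℝ) 𝓘(ℝ, EM) ∞ (fun t : ℝ => e x + t • v) 0 :=
    ContDiffAt.contMDiffAt (by fun_prop)
  have hy0 : e x + (0 : ℝ) • v = e x := by rw [zero_smul, add_zero]
  have hc : ContMDiffAt 𝓘(ℝ, ℝ) 𝓘(ℝ, EM) ∞ c 0 := hsymm.comp_of_eq hlin' hy0
  have hγ : ContMDiffAt 𝓘(ℝ, ℝ) (cotModel EM) ∞ (fun t => σ (c t)) 0 := hσ.comp_of_eq hc hc0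
  have hmem : ∀ y ∈ U, (σ y).2 ∈ conormal E y := fun y hy =>
    Submodule.sum_mem _ fun j _ => Submodule.smul_mem _ _ ((hα.positive y hy).mem_conormal j)
  refine ⟨(mfderiv 𝓘(ℝ, ℝ) (cotModel EM) (fun t => σ (c t)) 0 : ℝ →L[ℝ] EM × (EM →L[ℝ] ℝ)) 1,
    ⟨fun t => σ (c t), ?_, hγ, ?_, rfl⟩, ?_⟩
  · change σ (c 0) = σ x
    rw [hc0]
  · filter_upwards [hc.continuousAt.preimage_mem_nhds (hα.isOpen.mem_nhds (hc0.symm ▸ hx))]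
      with t ht
    exact hmem _ ht
  · have e1 := mfderiv_of_comp_eq (φ := c)
      (f := fun t => σ (c t)) (g := fun p : Cotangent EM M => p.1) (fun _ => rfl) rfl
      ((Bundle.contMDiff_proj (n := ∞) (IB := 𝓘(ℝ, EM))
        (fun x : M => TangentSpace 𝓘(ℝ, EM) x →L[ℝ] ℝ)).contMDiffAt.mdifferentiableAt (by simp))
      (hγ.mdifferentiableAt (by simp))
    have e2 := mfderiv_of_comp_eq (φ := c) (f := fun t : ℝ => e x + t • v) (g := e.symm)
      (fun _ => rfl) hy0 (hsymm.mdifferentiableAt (by simp)) (hlin'.mdifferentiableAt (by simp))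
    have e3 := mfderiv_extChartAt_symm_base (EM := EM) x
    rw [ModelWithCorners.range_eq_univ, mfderivWithin_univ] at e3
    have e4 : (mfderiv 𝓘(ℝ, ℝ) 𝓘(ℝ, EM) (fun t : ℝ => e x + t • v) 0 : ℝ →L[ℝ] EM) 1 = v := by
      rw [mfderiv_eq_fderiv]
      exact hlin.deriv
    have e5 : ∀ p p' : Cotangent EM M,
        (mfderiv (cotModel EM) 𝓘(ℝ, EM) (fun q : Cotangent EM M => q.1) p :
          EM × (EM →L[ℝ] ℝ) →L[ℝ] EM) =
        mfderiv (cotModel EM) 𝓘(ℝ, EM) (fun q : Cotangent EM M => q.1) p' := fun p p' =>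
      (mfderiv_cotangent_proj p).trans (mfderiv_cotangent_proj p').symm
    refine (DFunLike.congr_fun (e5 ⟨x, _⟩ (σ (c 0))) _).trans
      ((DFunLike.congr_fun (e1.symm.trans e2) 1).trans ?_)
    exact (DFunLike.congr_fun e3 _).trans e4

end Lift

/-! ### The lifted action on the cotangent bundle. -/

section CotangentAction

variable {EM : Type*} [NormedAddCommGroup EM] [NormedSpace ℝ EM]
  {M : Type*} [TopologicalSpace M] [ChartedSpace EM M] [IsManifold 𝓘(ℝ, EM) ∞ M]
  {EH : Type*} [NormedAddCommGroup EH] [NormedSpace ℝ EH]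
  {H : Type*} [TopologicalSpace H] [ChartedSpace EH H] [Group H] [MulAction H M]

omit [IsManifold 𝓘(ℝ, EM) ∞ M] in
theorem actionDeriv_inverse
    (hact : ContMDiff (𝓘(ℝ, EH).prod 𝓘(ℝ, EM)) 𝓘(ℝ, EM) ∞ (fun p : H × M => p.1 • p.2))
    (h : H) (x : M) :
    ((actionDeriv H h x).inverse : EM →L[ℝ] EM) = actionDeriv H h⁻¹ (h • x) := by
  have hd : ∀ (h : H) (y : M), MDifferentiableAt 𝓘(ℝ, EM) 𝓘(ℝ, EM) (fun y : M => h • y) y :=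
    fun h y => (contMDiff_const_act hact h).contMDiffAt.mdifferentiableAt (by simp)
  have e1 := mfderiv_of_comp_eq (φ := fun y : M => y) (f := fun y : M => h • y)
    (g := fun y : M => h⁻¹ • y) (x := x) (fun z => (inv_smul_smul h z).symm) rfl (hd _ _) (hd _ _)
  have e2 := mfderiv_of_comp_eq (φ := fun y : M => y) (f := fun y : M => h⁻¹ • y)
    (g := fun y : M => h • y) (x := h • x) (y := x) (fun z => (smul_inv_smul h z).symm)
    (inv_smul_smul h x) (hd _ _) (hd _ _)
  have e3 : ∀ y : M, (mfderiv 𝓘(ℝ, EM) 𝓘(ℝ, EM) (fun y : M => y) y : EM →L[ℝ] EM) =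
    ContinuousLinearMap.id ℝ EM := fun y => mfderiv_id
  exact ContinuousLinearMap.inverse_eq (M := EM) (M₂ := EM) (e2.symm.trans (e3 _)) (e1.symm.trans (e3 _))

variable [LieGroup 𝓘(ℝ, EH) ∞ H]

/-- The fibre coordinate of `h · p` is the covector composed with the derivative, at a moving point,
of the chart reading of `h⁻¹`, and this derivative depends smoothly on `h`. Differentiability at `1`
is what permits the chain rule for the fundamental fields of the lift; otherwise `mfderiv` would be
the default `0`. -/
theorem contMDiffAt_cotangentAction
    (hact : ContMDiff (𝓘(ℝ, EH).prod 𝓘(ℝ, EM)) 𝓘(ℝ, EM) ∞ (fun p : H × M => p.1 • p.2))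
    (p : Cotangent EM M) :
    ContMDiffAt 𝓘(ℝ, EH) (cotModel EM) ∞ (fun h : H => cotangentAction H h p) 1 := by
  obtain ⟨x, q⟩ := p
  change EM →L[ℝ] ℝ at q
  set e := extChartAt 𝓘(ℝ, EM) x with he
  have h1x : (1 : H) • x ∈ (chartAt EM x).source := by
    rw [one_smul]; exact mem_chart_source EM x
  refine (contMDiffAt_cotangent_iff x h1x).2 ⟨(contMDiff_act_const hact x).contMDiffAt, ?_⟩
  let f : H → EM → EM := fun h z => e (h⁻¹ • e.symm z)
  let g : H → EM := fun h => e (h • x)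
  have hg : ContMDiffAt 𝓘(ℝ, EH) 𝓘(ℝ, EM) ∞ g 1 :=
    (contMDiffAt_extChartAt' h1x).comp (1 : H) (contMDiff_act_const hact x).contMDiffAt
  have hg1 : g 1 = e x := by simp only [g, one_smul]
  have hsymm : ∀ z ∈ e.target, ContMDiffAt 𝓘(ℝ, EM) 𝓘(ℝ, EM) ∞ e.symm z := fun z hz =>
    (contMDiffOn_extChartAt_symm x).contMDiffAt ((isOpen_extChartAt_target x).mem_nhds hz)
  have hf : ContMDiffAt (𝓘(ℝ, EH).prod 𝓘(ℝ, EM)) 𝓘(ℝ, EM) ∞ (Function.uncurry f) (1, g 1) := by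
    have h2 : ContMDiffAt (𝓘(ℝ, EH).prod 𝓘(ℝ, EM)) 𝓘(ℝ, EM) ∞
        (fun p : H × EM => (p.1⁻¹ • e.symm p.2 : M)) (1, g 1) := by
      have h3 : ContMDiffAt (𝓘(ℝ, EH).prod 𝓘(ℝ, EM)) 𝓘(ℝ, EM) ∞
          (fun p : H × EM => e.symm p.2) (1, g 1) :=
        (hsymm (g 1) (by rw [hg1]; exact mem_extChartAt_target x)).comp ((1 : H), g 1)
          contMDiffAt_snd
      have h4 : ContMDiffAt (𝓘(ℝ, EH).prod 𝓘(ℝ, EM)) 𝓘(ℝ, EH) ∞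
          (fun p : H × EM => p.1⁻¹) (1, g 1) :=
        (contMDiff_inv 𝓘(ℝ, EH) ∞).contMDiffAt.comp ((1 : H), g 1) contMDiffAt_fst
      exact hact.contMDiffAt.comp ((1 : H), g 1) (h4.prodMk h3)
    refine (contMDiffAt_extChartAt' (x := x) ?_).comp ((1 : H), g 1) h2
    rw [hg1, inv_one, one_smul, he, extChartAt_to_inv]
    exact mem_chart_source EM x
  have h5 := ContMDiffAt.mfderiv f g hf hg (m := ∞) (by simp)
  let D : H → EM →L[ℝ] EM := fun h => mfderiv 𝓘(ℝ, EM) 𝓘(ℝ, EM) (f h) (g h)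
  have h5' : ContMDiffAt 𝓘(ℝ, EH) 𝓘(ℝ, EM →L[ℝ] EM) ∞ D 1 :=
    h5.congr_of_eventuallyEq (Eventually.of_forall fun h =>
      (congrFun (inTangentCoordinates_model_space (I := 𝓘(ℝ, EM)) (I' := 𝓘(ℝ, EM)) g
        (fun h => f h (g h)) (fun h => (mfderiv 𝓘(ℝ, EM) 𝓘(ℝ, EM) (f h) (g h) : EM →L[ℝ] EM))
        (1 : H)) h).symm)
  have h6 : ContMDiffAt 𝓘(ℝ, EH) 𝓘(ℝ, EM →L[ℝ] ℝ) ∞ (fun h : H => q.comp (D h)) 1 :=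
    (ContinuousLinearMap.compL ℝ EM EM ℝ q).contDiff.contMDiff.contMDiffAt.comp (1 : H) h5'
  refine h6.congr_of_eventuallyEq ?_
  have hcont : ContinuousAt (fun h : H => h • x) 1 :=
    (contMDiff_act_const hact x).continuous.continuousAt
  filter_upwards [hcont.preimage_mem_nhds ((chartAt EM x).open_source.mem_nhds h1x)] with h hh
  have hhe : h • x ∈ e.source := by simpa [he] using hh
  have hge : e.symm (g h) = h • x := e.left_inv hhe
  have hgt : g h ∈ e.target := e.map_source hhe
  have hd : MDifferentiableAt 𝓘(ℝ, EM) 𝓘(ℝ, EM) (fun y : M => h⁻¹ • y) (h • x) :=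
    (contMDiff_const_act hact h⁻¹).contMDiffAt.mdifferentiableAt (by simp)
  have hds := (hsymm _ hgt).mdifferentiableAt (by simp)
  have e1 := mfderiv_of_comp_eq (φ := fun z => (h⁻¹ • e.symm z : M)) (fun _ => rfl) hge hd hds
  have e2 := mfderiv_of_comp_eq (φ := f h) (x := g h) (y := x) (f := fun z => (h⁻¹ • e.symm z : M))
    (fun _ => rfl) (by rw [hge, inv_smul_smul])
    (mdifferentiableAt_extChartAt (mem_chart_source EM x))
    (((contMDiff_const_act hact h⁻¹).contMDiffAt.comp _ (hsymm _ hgt)).mdifferentiableAt (by simp))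
  have e3 : (mfderiv 𝓘(ℝ, EM) 𝓘(ℝ, EM) (f h) (g h) : EM →L[ℝ] EM) =
      (actionDeriv H h x).inverse.comp (mfderiv 𝓘(ℝ, EM) 𝓘(ℝ, EM) e.symm (g h) : EM →L[ℝ] EM) :=
    (e2.trans ((congrArg (fun L : EM →L[ℝ] EM => L.comp (mfderiv 𝓘(ℝ, EM) 𝓘(ℝ, EM)
      (fun z => (h⁻¹ • e.symm z : M)) (g h) : EM →L[ℝ] EM)) (mfderiv_extChartAt_base x)).trans
      (ContinuousLinearMap.id_comp _))).trans (e1.trans (congrArg (fun L : EM →L[ℝ] EM =>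
      L.comp (mfderiv 𝓘(ℝ, EM) 𝓘(ℝ, EM) e.symm (g h) : EM →L[ℝ] EM))
      (actionDeriv_inverse hact h x).symm))
  refine Eq.trans ?_ (congrArg (fun L : EM →L[ℝ] EM => q.comp L) e3).symm
  unfold cotCoord
  rw [ModelWithCorners.range_eq_univ, mfderivWithin_univ]
  rfl

/-- The fundamental vector fields of the lifted action project to those of the action. -/
theorem fundamentalField_cotangentAction_fst
    (hact : ContMDiff (𝓘(ℝ, EH).prod 𝓘(ℝ, EM)) 𝓘(ℝ, EM) ∞ (fun p : H × M => p.1 • p.2))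
    (p : Cotangent EM M) (X : EH) :
    (fundamentalField (cotModel EM) (cotangentAction H) X p : EM × (EM →L[ℝ] ℝ)).1 =
      fundamentalField 𝓘(ℝ, EM) (fun (h : H) (y : M) => h • y) X p.1 := by
  have e1 := mfderiv_of_comp_eq (φ := fun h : H => h • p.1)
    (f := fun h => cotangentAction H h p) (g := fun p : Cotangent EM M => p.1) (x := (1 : H))
    (fun _ => rfl) rfl
    ((Bundle.contMDiff_proj (n := ∞) (IB := 𝓘(ℝ, EM))
      (fun x : M => TangentSpace 𝓘(ℝ, EM) x →L[ℝ] ℝ)).contMDiffAt.mdifferentiableAt (by simp))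
    ((contMDiffAt_cotangentAction hact p).mdifferentiableAt (by simp))
  exact ((DFunLike.congr_fun e1 X).trans (DFunLike.congr_fun (mfderiv_cotangent_proj _) _)).symm

end CotangentAction

/-! ### The exponential of the canonical two-form on vectors tangent to a conormal bundle. -/

namespace GradedForm

section OneForms

variable {V : Type*} [AddCommGroup V] [Module ℝ V] [TopologicalSpace V]

theorem contractRight_homog_succ {m : ℕ} (X : V) (a : V [⋀^Fin (m + 1)]→L[ℝ] ℂ) (n : ℕ)
    (v : Fin n → V) : contractRight X (homog (m + 1) a) n v =
      homog (m + 1) a (n + 1) (Fin.snoc v X : Fin (n + 1) → V) := contractRight_apply X _ n v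

theorem contractRight_homog_one (X : V) (a : V [⋀^Fin 1]→L[ℝ] ℂ) :
    contractRight X (homog 1 a) = a (fun _ => X) • (1 : GradedForm V) := by
  refine ext_apply fun n v => ?_
  rw [contractRight_homog_succ]
  change _ = a (fun _ => X) * (one : GradedForm V) n v
  cases n with
  | zero =>
    rw [one, homog_self, homog_self]
    change _ = _ * (1 : ℂ)
    rw [mul_one]
    congr 1
  | succ n =>
    rw [one, homog_of_ne (by omega), homog_of_ne (by omega)]
    exact (mul_zero _).symm

theorem homog_one_mul_homog_one_apply_two (b c : V [⋀^Fin 1]→L[ℝ] ℂ) (v : Fin 2 → V) :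
    (homog 1 b * homog 1 c) 2 v =
      b (fun _ => v 0) * c (fun _ => v 1) - b (fun _ => v 1) * c (fun _ => v 0) := by
  have hv : v = (Fin.snoc (fun _ : Fin 1 => v 0) (v 1) : Fin 2 → V) := by
    ext i; fin_cases i <;> rfl
  conv_lhs => rw [hv]
  rw [← contractRight_apply, contractRight_mul, contractRight_homog_one, contractRight_homog_one,
    involute_homog_odd odd_one, smul_mul_assoc, one_mul, mul_smul_comm, mul_one]
  change b (fun _ => v 1) * -(homog 1 c 1 fun _ => v 0) + c (fun _ => v 1) * (homog 1 b 1 fun _ => v 0) = _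
  rw [homog_self, homog_self]
  ring

theorem homog_one_mul_homog_one_of_ne (b c : V [⋀^Fin 1]→L[ℝ] ℂ) {n : ℕ} (hn : n ≠ 2) :
    (homog 1 b * homog 1 c) n = 0 := by
  ext v
  cases n with
  | zero =>
    rw [← mul_eq, mul_zero_apply, homog_of_ne (by omega)]
    exact zero_mul _
  | succ n =>
    have hv : v = (Fin.snoc (fun i => v (Fin.castSucc i)) (v (Fin.last n)) : Fin (n + 1) → V) :=
      (Fin.snoc_init_self v).symm
    conv_lhs => rw [hv]
    rw [← contractRight_apply, contractRight_mul, contractRight_homog_one, contractRight_homog_one,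
      involute_homog_odd odd_one, smul_mul_assoc, one_mul, mul_smul_comm, mul_one]
    change b (fun _ => v (Fin.last n)) * -(homog 1 c n _) +
      c (fun _ => v (Fin.last n)) * (homog 1 b n _) = _
    rw [homog_of_ne (by omega), homog_of_ne (by omega)]
    change _ * -(0 : ℂ) + _ * (0 : ℂ) = 0
    ring

end OneForms

section Symplectic

variable {F : Type*} [NormedAddCommGroup F] [NormedSpace ℝ F] [FiniteDimensional ℝ F] {k n : ℕ}

/-- The fibre components of the exponential of the canonical `2`-form, on vectors tangent to a
conormal bundle. -/
theorem expTrunc_canonical_append {Ω : (F × (F →L[ℝ] ℝ)) [⋀^Fin 2]→L[ℝ] ℂ}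
    (hΩ : ∀ w, Ω w = (((w 1).2 (w 0).1 - (w 0).2 (w 1).1 : ℝ) : ℂ)) (A : Fin k → F →L[ℝ] ℝ)
    (P : Fin k → F →L[ℝ] F →L[ℝ] ℝ) {D : Fin k → F [⋀^Fin 2]→L[ℝ] ℂ}
    (hD : ∀ j v, D j v = ((P j (v 0) (v 1) - P j (v 1) (v 0) : ℝ) : ℂ)) (ξ : Fin k → ℝ)
    (w : Fin n → F × (F →L[ℝ] ℝ)) (c : Fin n → Fin k → ℝ)
    (hw : ∀ a, (w a).2 = ∑ j, c a j • A j + ∑ j, ξ j • P j (w a).1)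
    {N : ℕ} (hN : Module.finrank ℝ F ≤ N) :
    expTrunc (N + k) (homog 2 (Complex.I • Ω)) (n + k)
        (Fin.append w fun j => ((0, A j) : F × (F →L[ℝ] ℝ))) =
      Complex.I ^ k * ((List.ofFn fun j : Fin k => homog 1 (covectorForm (A j.rev))).prod *
        ∑ m ∈ Finset.range (Module.finrank ℝ F + 1),
          ∑ i ∈ Finset.piAntidiag (Finset.univ : Finset (Fin k)) m,
          ((∏ j, (-Complex.I * ξ j) ^ i j) / ((∏ j, (i j).factorial : ℕ) : ℂ)) •
            (List.ofFn fun j => homog 2 (D j) ^ i j).prod) n (fun a => (w a).1) := by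
  -- The `n` lifts are encoded as a linear map from `ℝ^n`. `S` is its base part, and `γ j` collects
  -- the undetermined coefficients `c`, playing the role of `dξ_j`.
  let T : (Fin n → ℝ) →L[ℝ] F × (F →L[ℝ] ℝ) :=
    ∑ a, (ContinuousLinearMap.proj (R := ℝ) (φ := fun _ : Fin n => ℝ) a).smulRight (w a)
  let S : (Fin n → ℝ) →L[ℝ] F := (ContinuousLinearMap.fst ℝ F (F →L[ℝ] ℝ)).comp T
  let γ : Fin k → (Fin n → ℝ) →L[ℝ] ℝ := fun j =>
    ∑ a, c a j • ContinuousLinearMap.proj (R := ℝ) (φ := fun _ : Fin n => ℝ) a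
  have hTu : ∀ u, T u = ∑ a, u a • w a := fun u => by simp [T]
  have hTe : ∀ a, T (Pi.single a 1) = w a := fun a => by
    rw [hTu, Finset.sum_eq_single a]
    · simp
    · intro b _ hb; simp [hb]
    · simp
  have hT2 : ∀ u, (T u).2 = ∑ j, γ j u • A j + ∑ j, ξ j • P j (S u) := by
    intro u
    have h1 : ∀ j, γ j u = ∑ a, u a * c a j := fun j => by
      simp only [γ, sum_apply]
      exact Finset.sum_congr rfl fun a _ => mul_comm _ _
    have h2 : S u = ∑ a, u a • (w a).1 := by
      change (T u).1 = _
      rw [hTu, Prod.fst_sum]; rfl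
    rw [hTu, Prod.snd_sum, h2]
    simp only [h1, map_sum, map_smul, Finset.smul_sum, Finset.sum_smul, Prod.smul_snd, hw, smul_add,
      Finset.sum_add_distrib, smul_smul]
    congr 1
    · exact Finset.sum_comm
    · rw [Finset.sum_comm]
      exact Finset.sum_congr rfl fun _ _ => Finset.sum_congr rfl fun _ _ => by rw [mul_comm]
  -- Contracting the two-form with the vertical vector `(0, b)` gives the covector `b` pulled back
  -- from the base.
  have hcr : ∀ (b : F →L[ℝ] ℝ), contractRight ((0, b) : F × (F →L[ℝ] ℝ)) (homog 2 (Complex.I • Ω)) =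
      Complex.I • homog 1 ((covectorForm b).compContinuousLinearMap
        (ContinuousLinearMap.fst ℝ F (F →L[ℝ] ℝ))) := by
    intro b
    refine ext_apply fun m v => ?_
    rw [contractRight_homog_succ]
    change _ = Complex.I * homog 1 _ m v
    by_cases hm : m = 1
    · subst hm
      rw [homog_self, homog_self]
      change Complex.I * Ω _ = Complex.I * ((b (v 0).1 : ℝ) : ℂ)
      rw [hΩ]
      congr 2
      change b (v 0).1 - (v 0).2 0 = b (v 0).1
      rw [map_zero, sub_zero]
    · rw [homog_of_ne (by omega), homog_of_ne hm]
      exact (mul_zero _).symm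
  -- On the lifts, `iΩ` decomposes as `-i ∑ ξ_j D_j - i ∑ γ_j ∧ A_j`, the shape required by
  -- `expTrunc_append` with `z j = -i ξ_j`; each vertical contraction contributes one factor `i`.
  have key := expTrunc_append (a := homog 2 (Complex.I • Ω)) (involute_homog_even even_two _)
    (fun j => ((0, A j) : F × (F →L[ℝ] ℝ)))
    (fun i j => by
      rw [hcr, map_smul, contractRight_homog_one]
      have : ((covectorForm (A j)).compContinuousLinearMap
        (ContinuousLinearMap.fst ℝ F (F →L[ℝ] ℝ))) (fun _ => ((0, A i) : F × (F →L[ℝ] ℝ))) = 0 := by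
        change ((A j 0 : ℝ) : ℂ) = 0
        rw [map_zero, Complex.ofReal_zero]
      rw [this, zero_smul, smul_zero])
    T S (fun j => covectorForm (A j)) D
    (fun j => (-Complex.I) • homog 1 (covectorForm (γ j)))
    (fun j => by
      change involuteLinear ((-Complex.I) • homog 1 (covectorForm (γ j))) = _
      rw [map_smul]
      change _ • involute _ = _
      rw [involute_homog_odd odd_one, smul_neg])
    (fun j => -Complex.I * ξ j) Complex.I
    (fun j => by
      rw [hcr]
      exact ((pullback T).toLinearMap.map_smul _ _).trans (congrArg (Complex.I • ·)
        ((pullback_homog T 1 _).trans (pullback_homog S 1 (covectorForm (A j))).symm)))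
    (by
      refine ext_apply fun m v => ?_
      simp only [pullback_homog, smul_mul_assoc]
      have hs : ∀ (G G' : Fin k → GradedForm (Fin n → ℝ)), (∑ j, G j + ∑ j, G' j) m v =
          ∑ j, (G j m v + G' j m v) := fun G G' => by
        rw [Pi.add_apply, Finset.sum_apply, Finset.sum_apply, Finset.sum_add_distrib,
          ContinuousAlternatingMap.add_apply, ContinuousAlternatingMap.sum_apply,
          ContinuousAlternatingMap.sum_apply]
      rw [hs]
      by_cases hm : m = 2
      · subst hm
        have ht : ∀ j, ((-Complex.I * (ξ j : ℂ)) • homog 2 ((D j).compContinuousLinearMap S)) 2 v +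
            ((-Complex.I) • (homog 1 (covectorForm (γ j)) *
              homog 1 ((covectorForm (A j)).compContinuousLinearMap S))) 2 v =
            Complex.I * (((ξ j * (P j (S (v 1)) (S (v 0)) - P j (S (v 0)) (S (v 1))) +
              (γ j (v 1) * A j (S (v 0)) - γ j (v 0) * A j (S (v 1))) : ℝ)) : ℂ) := by
          intro j
          change (-Complex.I * (ξ j : ℂ)) * homog 2 ((D j).compContinuousLinearMap S) 2 v +
            (-Complex.I) * (homog 1 (covectorForm (γ j)) *
              homog 1 ((covectorForm (A j)).compContinuousLinearMap S)) 2 v = _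
          rw [homog_self, homog_one_mul_homog_one_apply_two]
          change (-Complex.I * (ξ j : ℂ)) * D j (S ∘ v) +
            (-Complex.I) * (((γ j (v 0) : ℝ) : ℂ) * ((A j (S (v 1)) : ℝ) : ℂ) -
              ((γ j (v 1) : ℝ) : ℂ) * ((A j (S (v 0)) : ℝ) : ℂ)) = _
          rw [hD]
          simp only [Function.comp_apply]
          push_cast
          ring
        simp only [ht]
        rw [homog_self, ← Finset.mul_sum]
        change Complex.I * Ω (T ∘ v) = _
        rw [hΩ]
        congr 1
        rw [← Complex.ofReal_sum]
        congr 1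
        change (T (v 1)).2 (S (v 0)) - (T (v 0)).2 (S (v 1)) = _
        rw [hT2, hT2]
        simp only [add_apply, sum_apply,
          smul_apply, smul_eq_mul, Finset.sum_add_distrib, mul_sub,
          Finset.sum_sub_distrib]
        ring
      · rw [homog_of_ne hm]
        refine Eq.trans (rfl : _ = (0 : ℂ)) (Finset.sum_eq_zero fun j _ => ?_).symm
        change (-Complex.I * (ξ j : ℂ)) * homog 2 ((D j).compContinuousLinearMap S) m v +
            (-Complex.I) * (homog 1 (covectorForm (γ j)) *
              homog 1 ((covectorForm (A j)).compContinuousLinearMap S)) m v = 0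
        rw [homog_of_ne hm, homog_one_mul_homog_one_of_ne _ _ hm]
        change _ * (0 : ℂ) + _ * (0 : ℂ) = 0
        ring)
    hN (fun a => Pi.single a 1)
  simp only [hTe] at key
  have hS : ∀ a, S (Pi.single a 1) = (w a).1 := fun a => congrArg Prod.fst (hTe a)
  simp only [hS] at key
  exact key

end Symplectic

end GradedForm

theorem GradedForm.exp_eq {V : Type*} [AddCommGroup V] [Module ℝ V] [TopologicalSpace V]
    (a : GradedForm V) : GradedForm.exp a = Complex.exp (a 0 (fun i => i.elim0)) •
      GradedForm.expTrunc (Module.finrank ℝ V) (Function.update a 0 0) := by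
  simp only [GradedForm.exp, GradedForm.expTrunc, GradedForm.pow_eq]

theorem mextDeriv_zero {F : Type*} [NormedAddCommGroup F] [NormedSpace ℝ F] {B : Type*}
    [TopologicalSpace B] (I : ModelWithCorners ℝ F B) {N : Type*} [TopologicalSpace N]
    [ChartedSpace B N] (n : ℕ) : mextDeriv I (0 : FormField I N n) = 0 := by
  let η₀ : F → F [⋀^Fin n]→L[ℝ] ℂ := fun _ => 0
  have h0 : (0 : ℝ) • η₀ = η₀ :=
    funext fun y => ContinuousAlternatingMap.ext fun v => smul_zero (0 : ℝ)
  funext x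
  have hx : UniqueDiffWithinAt ℝ (range I) (extChartAt I x x) :=
    I.uniqueDiffOn _ (mem_range_self _)
  have h : extDerivWithin η₀ (range I) (extChartAt I x x) = 0 := by
    have h1 := extDerivWithin_smul (0 : ℝ) η₀ hx
    rwa [h0, zero_smul] at h1
  exact congrArg (fun η : F [⋀^Fin (n + 1)]→L[ℝ] ℂ => η.compContinuousLinearMap
    (mfderiv I 𝓘(ℝ, F) (extChartAt I x) x)) h

theorem finrank_prod_dual (F : Type*) [NormedAddCommGroup F] [NormedSpace ℝ F]
    [FiniteDimensional ℝ F] :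
    Module.finrank ℝ (F × (F →L[ℝ] ℝ)) = Module.finrank ℝ F + Module.finrank ℝ F := by
  rw [Module.finrank_prod, ← (LinearMap.toContinuousLinearMap (𝕜 := ℝ) (E := F) (F' := ℝ)).finrank_eq]
  congr 1
  exact Subspace.dual_finrank_eq

/-! ### The oscillatory pairing as a Fourier transform. -/

section Pairing

variable {EM : Type*} [NormedAddCommGroup EM] [NormedSpace ℝ EM] [FiniteDimensional ℝ EM]
  {M : Type*} [TopologicalSpace M] [ChartedSpace EM M] [IsManifold 𝓘(ℝ, EM) ∞ M]
  {EH : Type*} [NormedAddCommGroup EH] [NormedSpace ℝ EH]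
  {H : Type*} [TopologicalSpace H] [ChartedSpace EH H] [Group H] [MulAction H M]
  [LieGroup 𝓘(ℝ, EH) ∞ H]

open GradedForm

omit [FiniteDimensional ℝ EM] in
theorem canonicalForm_of_ne (p : Cotangent EM M) {n : ℕ} (hn : n ≠ 1) : canonicalForm p n = 0 :=
  homog_of_ne hn _

-- The canonical form is concentrated in degree one, so `Dθ(X)` lives in degrees `0` and `2`, and
-- `X` enters only in degree `0`.
omit [FiniteDimensional ℝ EM] [LieGroup 𝓘(ℝ, EH) ∞ H] in
theorem update_equivariantD_canonicalForm (X : EH) (p : Cotangent EM M) :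
    (Function.update (Complex.I • equivariantD (cotModel EM) (cotangentAction H) canonicalForm X p)
      0 0 : GradedForm (TangentSpace (cotModel EM) p)) =
      homog 2 (Complex.I • mextDeriv (cotModel EM) (fun q : Cotangent EM M => canonicalForm q 1) p) := by
  funext n
  match n with
  | 0 => rw [Function.update_self, homog_of_ne (by omega)]
  | 1 =>
    rw [Function.update_of_ne (by omega), homog_of_ne (by omega)]
    have h1 : (fun q : Cotangent EM M => canonicalForm q 0) = 0 :=
      funext fun q => canonicalForm_of_ne q (by omega)
    ext v
    change Complex.I * (mextDeriv (cotModel EM) (fun q : Cotangent EM M => canonicalForm q 0) p v -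
      canonicalForm p 2 (Matrix.vecCons (fundamentalField (cotModel EM) (cotangentAction H) X p) v)) = 0
    rw [h1, mextDeriv_zero, canonicalForm_of_ne p (by omega)]
    change Complex.I * ((0 : ℂ) - 0) = 0
    ring
  | 2 =>
    rw [Function.update_of_ne (by omega), homog_self]
    ext v
    change Complex.I * (mextDeriv (cotModel EM) (fun q : Cotangent EM M => canonicalForm q 1) p v -
      canonicalForm p 3 (Matrix.vecCons (fundamentalField (cotModel EM) (cotangentAction H) X p) v)) = Complex.I * _
    rw [canonicalForm_of_ne p (by omega)]
    exact congrArg (Complex.I * ·) (sub_zero _)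
  | n + 3 =>
    rw [Function.update_of_ne (by omega), homog_of_ne (by omega)]
    have h1 : (fun q : Cotangent EM M => canonicalForm q (n + 2)) = 0 :=
      funext fun q => canonicalForm_of_ne q (by omega)
    ext v
    change Complex.I * (mextDeriv (cotModel EM) (fun q : Cotangent EM M => canonicalForm q (n + 2)) p v -
      canonicalForm p (n + 4)
      (Matrix.vecCons (fundamentalField (cotModel EM) (cotangentAction H) X p) v)) = 0
    rw [h1, mextDeriv_zero, canonicalForm_of_ne p (by omega)]
    change Complex.I * ((0 : ℂ) - 0) = 0
    ring

omit [FiniteDimensional ℝ EM] in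
theorem equivariantD_canonicalForm_zero
    (hact : ContMDiff (𝓘(ℝ, EH).prod 𝓘(ℝ, EM)) 𝓘(ℝ, EM) ∞ (fun p : H × M => p.1 • p.2))
    (X : EH) (p : Cotangent EM M) (v : Fin 0 → TangentSpace (cotModel EM) p) :
    equivariantD (cotModel EM) (cotangentAction H) canonicalForm X p 0 v =
      ((p.2 (fundamentalField 𝓘(ℝ, EM) (fun (h : H) (y : M) => h • y) X p.1) : ℝ) : ℂ) := by
  have h0 : (canonicalForm p 1 : TangentSpace (cotModel EM) p [⋀^Fin 1]→L[ℝ] ℂ) =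
      covectorForm (-(p.2.comp
        (mfderiv (cotModel EM) 𝓘(ℝ, EM) (fun q : Cotangent EM M => q.1) p))) := homog_self _
  change (0 : ℂ) - canonicalForm p 1
    (Matrix.vecCons (fundamentalField (cotModel EM) (cotangentAction H) X p) v) = _
  rw [h0, zero_sub]
  change -((-(p.2 (mfderiv (cotModel EM) 𝓘(ℝ, EM) (fun q : Cotangent EM M => q.1) p
    (fundamentalField (cotModel EM) (cotangentAction H) X p)) : ℝ) : ℝ) : ℂ) = _
  rw [← Complex.ofReal_neg, neg_neg]
  congr 2
  exact (DFunLike.congr_fun (mfderiv_cotangent_proj p) _).trans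
    (fundamentalField_cotangentAction_fst hact p X)

variable [MeasurableSpace EH] (μ : Measure EH)

/-- The nilpotent part of the exponent does not depend on `X`, so its exponential leaves the
integral; only the oscillating scalar `e^{i p(X_M)}` is integrated against `φ`. -/
theorem expPairing_eq
    (hact : ContMDiff (𝓘(ℝ, EH).prod 𝓘(ℝ, EM)) 𝓘(ℝ, EM) ∞ (fun p : H × M => p.1 • p.2))
    (φ : EH → ℂ) (p : Cotangent EM M) (n : ℕ) (w : Fin n → EM × (EM →L[ℝ] ℝ)) :
    expPairing H μ φ p n w =
      (∫ X, Complex.exp (Complex.I *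
        ((p.2 (fundamentalField 𝓘(ℝ, EM) (fun (h : H) (y : M) => h • y) X p.1) : ℝ) : ℂ)) * φ X ∂μ) *
      expTrunc (Module.finrank ℝ EM + Module.finrank ℝ EM) (homog 2 (Complex.I •
        (mextDeriv (cotModel EM) (fun q : Cotangent EM M => canonicalForm q 1) p :
          (EM × (EM →L[ℝ] ℝ)) [⋀^Fin 2]→L[ℝ] ℂ))) n w := by
  rw [← finrank_prod_dual EM, ← integral_mul_const]
  unfold expPairing
  refine integral_congr_ae (Eventually.of_forall fun X => ?_)
  have h1 := exp_eq (Complex.I • equivariantD (cotModel EM) (cotangentAction H) canonicalForm X p)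
  rw [update_equivariantD_canonicalForm] at h1
  have h2 := congrArg (fun a : GradedForm (TangentSpace (cotModel EM) p) => φ X * a n w) h1
  refine h2.trans ?_
  change φ X * (Complex.exp (Complex.I * equivariantD (cotModel EM) (cotangentAction H)
    canonicalForm X p 0 _) * _) = _
  rw [equivariantD_canonicalForm_zero hact]
  change φ X * (_ * expTrunc _ _ n w) = _ * φ X * expTrunc _ _ n w
  rw [mul_comm (Complex.exp _) (φ X), mul_assoc]
  rfl

variable {k : ℕ}
  {E : (x : M) → Submodule ℝ (TangentSpace 𝓘(ℝ, EM) x)}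
  {o : (x : M) → Orientation ℝ (conormal E x) (Fin k)}

/-- On the fibre coordinate `ξ` the phase `p(X_M)` equals `-⟨ξ, f(X)⟩`. By definition of the
push-forward, the scalar integral is the Fourier transform of `g` at `ξ`. The remaining factor is
the exponential of the canonical two-form on lifts and frame covectors. -/
theorem expPairing_append
    (hact : ContMDiff (𝓘(ℝ, EH).prod 𝓘(ℝ, EM)) 𝓘(ℝ, EM) ∞ (fun p : H × M => p.1 • p.2))
    {r : ℕ} (hrk : r + k = Module.finrank ℝ EM) (hE : IsSmoothDistribution E r) {U : Set M}
    {α : Fin k → (x : M) → (TangentSpace 𝓘(ℝ, EM) x →L[ℝ] ℝ)} (hα : IsOrientedFrame o U α)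
    {x : M} (hx : x ∈ U) {φ : EH → ℂ} {g : (Fin k → ℝ) → ℂ}
    (hg : IsPushforward μ (momentMap H α x) φ g) {ξ : Fin k → ℝ} {q : EM →L[ℝ] ℝ}
    (hq : q = ∑ j, ξ j • α j x) {n : ℕ} (w : Fin n → EM × (EM →L[ℝ] ℝ))
    (hw : ∀ i, IsTangentToConormal E (⟨x, q⟩ : Cotangent EM M) (w i)) :
    expPairing H μ φ (⟨x, q⟩ : Cotangent EM M) (n + k)
      (Fin.append w fun j => ((0, α j x) : EM × (EM →L[ℝ] ℝ))) =
      angularFourier g ξ * (Complex.I ^ k *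
        ((List.ofFn fun j : Fin k => homog 1 (covectorForm (α j.rev x))).prod *
        ∑ m ∈ Finset.range (Module.finrank ℝ EM + 1),
          ∑ i ∈ Finset.piAntidiag (Finset.univ : Finset (Fin k)) m,
          ((∏ j, (-Complex.I * ξ j) ^ i j) / ((∏ j, (i j).factorial : ℕ) : ℂ)) •
            (List.ofFn fun j => homog 2
              (mextDeriv 𝓘(ℝ, EM) (fun y => covectorForm (α j y)) x) ^ i j).prod) n
                (fun a => (w a).1)) := by
  have hd : ∀ j, DifferentiableAt ℝ (coordForm (α j) x) (extChartAt 𝓘(ℝ, EM) x x) := fun j =>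
    (contDiffAt_coordForm hα.isOpen (hα.smooth j) x (mem_extChartAt_target x)
      (by rw [extChartAt_to_inv]; exact hx)).differentiableAt (by simp)
  choose c hc using fun a => (hw a).exists_snd_eq hE hα hx hq
  refine (expPairing_eq μ hact φ (⟨x, q⟩ : Cotangent EM M) (n + k) _).trans ?_
  -- The truncation order `2 dim M` is split so that `k` of it is spent on the fibre vectors; what
  -- remains, `dim M + r`, still exceeds every nonzero power on the base.
  have hN : Module.finrank ℝ EM + Module.finrank ℝ EM = (Module.finrank ℝ EM + r) + k := by omega
  rw [hN]
  refine congrArg₂ (· * ·) ?_ (expTrunc_canonical_append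
    (fun w => mextDeriv_canonicalForm_apply (⟨x, q⟩ : Cotangent EM M) w)
    (fun j => (α j x : EM →L[ℝ] ℝ))
    (fun j => fderiv ℝ (coordForm (α j) x) (extChartAt 𝓘(ℝ, EM) x x))
    (fun j v => mextDeriv_covectorForm_apply (hd j) v) ξ w c hc (by omega))
  rw [angularFourier, ← hg.integral_eq _ (by fun_prop)]
  refine integral_congr_ae (Eventually.of_forall fun X => ?_)
  change Complex.exp _ * φ X = Complex.exp _ * φ X
  congr 2
  have h1 : q (fundamentalField 𝓘(ℝ, EM) (fun (h : H) (y : M) => h • y) X x) =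
      -∑ j, ξ j * momentMap H α x X j := by
    have hs : ∀ (A : Fin k → EM →L[ℝ] ℝ) (v : EM), (∑ j, ξ j • A j) v =
        -∑ j, ξ j * -(A j v) := fun A v => by simp
    rw [hq]
    exact hs (fun j => α j x) _
  refine (congrArg (fun t : ℝ => Complex.I * (t : ℂ)) h1).trans ?_
  push_cast
  ring

end Pairing

/-! ### Change of oriented basis. -/

section LinearAlgebra

variable {V : Type*} [AddCommGroup V] [Module ℝ V] {n k : ℕ}

theorem Fin.append_update_right {α : Type*} (w : Fin n → α) (y : Fin k → α) (i : Fin k) (z : α) :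
    Fin.append w (Function.update y i z) =
      Function.update (Fin.append w y) (Fin.natAdd n i) z := by
  ext a
  refine Fin.addCases (fun a => ?_) (fun a => ?_) a
  · rw [Fin.append_left, Function.update_of_ne, Fin.append_left]
    intro h
    have := congrArg Fin.val h
    simp at this
    omega
  · rw [Fin.append_right]
    by_cases h : a = i
    · subst h; simp
    · rw [Function.update_of_ne h, Function.update_of_ne, Fin.append_right]
      intro h'
      exact h (by simpa using h')

/-- The effect of a change of basis in the last arguments of an alternating map. -/
theorem AlternatingMap.append_sum_smul (f : V [⋀^Fin (n + k)]→ₗ[ℝ] ℂ) (w : Fin n → V)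
    (u : Fin k → V) (A : Matrix (Fin k) (Fin k) ℝ) :
    f (Fin.append w fun j => ∑ l, A j l • u l) = (A.det : ℂ) * f (Fin.append w u) := by
  let g : V [⋀^Fin k]→ₗ[ℝ] ℂ :=
    { toFun := fun y => f (Fin.append w y)
      map_update_add' := fun {inst} y i a b => by
        rw [Subsingleton.elim inst (instDecidableEqFin k)]
        simp only [Fin.append_update_right, AlternatingMap.map_update_add]
      map_update_smul' := fun {inst} y i c a => by
        rw [Subsingleton.elim inst (instDecidableEqFin k)]
        simp only [Fin.append_update_right, AlternatingMap.map_update_smul]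
      map_eq_zero_of_eq' := fun y i j h hij =>
        f.map_eq_zero_of_eq _ (i := Fin.natAdd n i) (j := Fin.natAdd n j)
          (by rw [Fin.append_right, Fin.append_right, h]) (by simpa using hij) }
  let D : (Fin k → ℝ) [⋀^Fin k]→ₗ[ℝ] ℂ :=
    (LinearMap.toSpanSingleton ℝ ℂ (g u)).compAlternatingMap Matrix.detRowAlternating
  -- Both sides are alternating in the rows of the matrix, so they need only be compared on
  -- permutations of the standard basis.
  have h : g.compLinearMap (Fintype.linearCombination ℝ u) = D := by
    refine Module.Basis.ext_alternating (Pi.basisFun ℝ (Fin k)) fun v hv => ?_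
    obtain ⟨σ, rfl⟩ : ∃ σ : Equiv.Perm (Fin k), v = σ :=
      ⟨Equiv.ofBijective v (Finite.injective_iff_bijective.1 hv), rfl⟩
    have h1 := AlternatingMap.map_perm (g.compLinearMap (Fintype.linearCombination ℝ u))
      (Pi.basisFun ℝ (Fin k)) σ
    have h2 := AlternatingMap.map_perm D (Pi.basisFun ℝ (Fin k)) σ
    refine h1.trans (Eq.trans (congrArg _ ?_) h2.symm)
    have h3 : (⇑(Fintype.linearCombination ℝ u) ∘ (Pi.basisFun ℝ (Fin k))) = u := by
      ext j; simp [Fintype.linearCombination_apply]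
    have h4 : Matrix.of (⇑(Pi.basisFun ℝ (Fin k))) = (1 : Matrix (Fin k) (Fin k) ℝ) := by
      ext i j; simp [Matrix.one_apply, Pi.single_apply, eq_comm]
    refine (congrArg g h3).trans
      (((congrArg (fun B : Matrix (Fin k) (Fin k) ℝ => B.det • g u) h4).trans ?_).symm)
    rw [Matrix.det_one, one_smul]
  exact DFunLike.congr_fun h A

theorem Submodule.exists_matrix_of_orientation_eq {S : Submodule ℝ V}
    (β β' : Module.Basis (Fin k) ℝ S) (h : β.orientation = β'.orientation) {a b : Fin k → V}
    (ha : ∀ j, (β j : V) = a j) (hb : ∀ j, (β' j : V) = b j) :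
    ∃ A : Matrix (Fin k) (Fin k) ℝ, 0 < A.det ∧ ∀ j, b j = ∑ l, A j l • a l := by
  refine ⟨(β.toMatrix β').transpose, ?_, fun j => ?_⟩
  · rw [Matrix.det_transpose, ← Module.Basis.det_apply]
    exact (Module.Basis.orientation_eq_iff_det_pos β β').1 h
  · have h1 := congrArg Subtype.val (β.sum_repr (β' j))
    rw [AddSubmonoidClass.coe_finsetSum] at h1
    rw [← hb j]
    refine h1.symm.trans (Finset.sum_congr rfl fun l _ => ?_)
    rw [← ha l]
    rfl

theorem integrable_comp_of_det_ne_zero {G : Type*} [NormedAddCommGroup G] [NormedSpace ℝ G]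
    [FiniteDimensional ℝ G] [MeasurableSpace G] [BorelSpace G] (μ : Measure G)
    [μ.IsAddHaarMeasure] (A : G →L[ℝ] G) (hA : A.det ≠ 0) {F : G → ℂ} (hF : Integrable F μ) :
    Integrable (fun x => F (A x)) μ := by
  let e : G ≃L[ℝ] G := A.toContinuousLinearEquivOfDetNeZero hA
  refine (e.toHomeomorph.toMeasurableEquiv.measurableEmbedding.integrable_map_iff (g := F)).1 ?_
  change Integrable F (μ.map (A : G →ₗ[ℝ] G))
  rw [Measure.map_linearMap_addHaar_eq_smul_addHaar μ (f := (A : G →ₗ[ℝ] G)) hA]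
  exact hF.smul_measure ENNReal.ofReal_ne_top

end LinearAlgebra

/-! ### Termwise integration over the fibre. -/

section Moments

variable {V : Type*} [AddCommGroup V] [Module ℝ V] [TopologicalSpace V] {k : ℕ}

/-- The coefficient of an inhomogeneous form on given vectors. -/
def GradedForm.evalLinear (n : ℕ) (v : Fin n → V) : GradedForm V →ₗ[ℂ] ℂ where
  toFun a := a n v
  map_add' _ _ := rfl
  map_smul' _ _ := rfl

theorem GradedForm.mul_sum_smul_apply (P : GradedForm V) (X : (Fin k → ℕ) → GradedForm V)
    (κ : (Fin k → ℕ) → ℂ) (s : Finset ℕ) (n : ℕ) (v : Fin n → V) :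
    (P * ∑ m ∈ s, ∑ i ∈ Finset.piAntidiag (Finset.univ : Finset (Fin k)) m,
      (κ i / ((∏ j, (i j).factorial : ℕ) : ℂ)) • X i) n v =
    ∑ m ∈ s, ∑ i ∈ Finset.piAntidiag (Finset.univ : Finset (Fin k)) m,
      (P * X i) n v / ((∏ j, (i j).factorial : ℕ) : ℂ) * κ i := by
  change GradedForm.evalLinear n v _ = _
  simp only [Finset.mul_sum, mul_smul_comm, map_sum, map_smul]
  refine Finset.sum_congr rfl fun m _ => Finset.sum_congr rfl fun i _ => ?_
  change _ * (P * X i) n v = _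
  ring

/-- The form is a polynomial in `ξ`, so each monomial is integrated by
`integral_moment_angularFourier`; `i^k` and `(2π)^k` combine to `(2πi)^k`. -/
theorem integral_angularFourier_mul_form {g : (Fin k → ℝ) → ℂ} (hg : ContDiff ℝ ∞ g)
    (hc : HasCompactSupport g) (P : GradedForm V) (X : (Fin k → ℕ) → GradedForm V) (s : Finset ℕ)
    (n : ℕ) (v : Fin n → V) :
    Integrable (fun ξ : Fin k → ℝ => angularFourier g ξ * (Complex.I ^ k *
      (P * ∑ m ∈ s, ∑ i ∈ Finset.piAntidiag (Finset.univ : Finset (Fin k)) m,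
      ((∏ j, (-Complex.I * ξ j) ^ i j) / ((∏ j, (i j).factorial : ℕ) : ℂ)) • X i) n v)) ∧
    ∫ ξ : Fin k → ℝ, angularFourier g ξ * (Complex.I ^ k *
      (P * ∑ m ∈ s, ∑ i ∈ Finset.piAntidiag (Finset.univ : Finset (Fin k)) m,
      ((∏ j, (-Complex.I * ξ j) ^ i j) / ((∏ j, (i j).factorial : ℕ) : ℂ)) • X i) n v) =
    (2 * Real.pi * Complex.I) ^ k *
      (P * ∑ m ∈ s, ∑ i ∈ Finset.piAntidiag (Finset.univ : Finset (Fin k)) m,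
      (((-1) ^ (∑ j, i j) * mixedPartial i g 0) / ((∏ j, (i j).factorial : ℕ) : ℂ)) • X i) n v := by
  have h1 : ∀ ξ : Fin k → ℝ, angularFourier g ξ * (Complex.I ^ k *
      (P * ∑ m ∈ s, ∑ i ∈ Finset.piAntidiag (Finset.univ : Finset (Fin k)) m,
      ((∏ j, (-Complex.I * ξ j) ^ i j) / ((∏ j, (i j).factorial : ℕ) : ℂ)) • X i) n v) =
      ∑ m ∈ s, ∑ i ∈ Finset.piAntidiag (Finset.univ : Finset (Fin k)) m,
        (Complex.I ^ k * ((P * X i) n v / ((∏ j, (i j).factorial : ℕ) : ℂ))) *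
          ((∏ j, (-Complex.I * ξ j) ^ i j) * angularFourier g ξ) := by
    intro ξ
    rw [GradedForm.mul_sum_smul_apply P X fun i => ∏ j, (-Complex.I * ξ j) ^ i j]
    simp only [Finset.mul_sum]
    refine Finset.sum_congr rfl fun m _ => Finset.sum_congr rfl fun i _ => ?_
    ring
  have h2 : ∀ i : Fin k → ℕ, Integrable fun ξ : Fin k → ℝ =>
      (Complex.I ^ k * ((P * X i) n v / ((∏ j, (i j).factorial : ℕ) : ℂ))) *
          ((∏ j, (-Complex.I * ξ j) ^ i j) * angularFourier g ξ) := fun i =>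
    (integral_moment_angularFourier hg hc i).1.const_mul _
  simp only [h1]
  refine ⟨integrable_finsetSum _ fun m _ => integrable_finsetSum _ fun i _ => h2 i, ?_⟩
  rw [integral_finsetSum _ fun m _ => integrable_finsetSum _ fun i _ => h2 i,
    GradedForm.mul_sum_smul_apply P X fun i => (-1) ^ (∑ j, i j) * mixedPartial i g 0]
  rw [Finset.mul_sum]
  refine Finset.sum_congr rfl fun m _ => ?_
  rw [integral_finsetSum _ fun i _ => h2 i, Finset.mul_sum]
  refine Finset.sum_congr rfl fun i _ => ?_
  rw [integral_const_mul, (integral_moment_angularFourier hg hc i).2, mul_pow]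
  ring

end Moments

/-! ### The fibre integral equals the local form. -/

section FibreIntegral

variable {EM : Type*} [NormedAddCommGroup EM] [NormedSpace ℝ EM]
  {M : Type*} [TopologicalSpace M] [ChartedSpace EM M] {k : ℕ}
  {E : (x : M) → Submodule ℝ (TangentSpace 𝓘(ℝ, EM) x)}
  {o : (x : M) → Orientation ℝ (conormal E x) (Fin k)}

theorem IsPositive.exists_matrix {x : M} {a b : Fin k → (TangentSpace 𝓘(ℝ, EM) x →L[ℝ] ℝ)}
    (ha : IsPositive o x a) (hb : IsPositive o x b) :
    ∃ A : Matrix (Fin k) (Fin k) ℝ, 0 < A.det ∧ ∀ j, b j = ∑ l, A j l • a l := by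
  obtain ⟨β, hβ, hβo⟩ := ha
  obtain ⟨β', hβ', hβo'⟩ := hb
  exact Submodule.exists_matrix_of_orientation_eq (V := TangentSpace 𝓘(ℝ, EM) x →L[ℝ] ℝ)
    β β' (hβo.trans hβo'.symm) hβ hβ'

variable [FiniteDimensional ℝ EM] [IsManifold 𝓘(ℝ, EM) ∞ M]
  {EH : Type*} [NormedAddCommGroup EH] [NormedSpace ℝ EH] [FiniteDimensional ℝ EH]
  {H : Type*} [TopologicalSpace H] [ChartedSpace EH H] [Group H] [MulAction H M]
  [LieGroup 𝓘(ℝ, EH) ∞ H] [MeasurableSpace EH] [BorelSpace EH] (μ : Measure EH)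

omit [FiniteDimensional ℝ EH] [BorelSpace EH] in
theorem expPairing_append_sum_smul
    (hact : ContMDiff (𝓘(ℝ, EH).prod 𝓘(ℝ, EM)) 𝓘(ℝ, EM) ∞ (fun p : H × M => p.1 • p.2))
    (φ : EH → ℂ) (p : Cotangent EM M) {n : ℕ} (w : Fin n → EM × (EM →L[ℝ] ℝ))
    (u : Fin k → EM × (EM →L[ℝ] ℝ)) (A : Matrix (Fin k) (Fin k) ℝ) :
    expPairing H μ φ p (n + k) (Fin.append w fun j => ∑ l, A j l • u l) =
      (A.det : ℂ) * expPairing H μ φ p (n + k) (Fin.append w u) := by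
  refine (expPairing_eq μ hact φ p (n + k) _).trans
    (Eq.trans ?_ (congrArg ((A.det : ℂ) * ·) (expPairing_eq μ hact φ p (n + k) _)).symm)
  refine (congrArg (_ * ·) (AlternatingMap.append_sum_smul
    (ContinuousAlternatingMap.toAlternatingMap _) w u A)).trans ?_
  exact mul_left_comm _ _ _

variable [μ.IsAddHaarMeasure]

/-- The fibre integral, in terms of an oriented frame. -/
theorem IsOrientedFrame.isFibreIntegral
    (hact : ContMDiff (𝓘(ℝ, EH).prod 𝓘(ℝ, EM)) 𝓘(ℝ, EM) ∞ (fun p : H × M => p.1 • p.2))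
    {r : ℕ} (hrk : r + k = Module.finrank ℝ EM) (hE : IsSmoothDistribution E r)
    (htrans : IsTransverse EH H E) {U : Set M}
    {α : Fin k → (x : M) → (TangentSpace 𝓘(ℝ, EM) x →L[ℝ] ℝ)} (hα : IsOrientedFrame o U α)
    {x : M} (hx : x ∈ U) {φ : EH → ℂ} (hφ : ContDiff ℝ ∞ φ) (hc : HasCompactSupport φ) (n : ℕ)
    (v : Fin n → TangentSpace 𝓘(ℝ, EM) x) :
    IsFibreIntegral o (expPairing H μ φ) x n v
      ((2 * Real.pi * Complex.I) ^ k * localForm H μ α φ x n v) := by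
  intro b hb lift hlift
  obtain ⟨A, hA, hbA⟩ := (hα.positive x hx).exists_matrix hb
  obtain ⟨g, hg⟩ := exists_isPushforward μ (momentCLM_surjective H htrans (hα.positive x hx)) hφ hc
  rw [coe_momentCLM] at hg
  -- The transpose of `A` converts fibre coordinates for the basis `b` into coordinates for the
  -- frame: `∑ ξ_j b_j = ∑ (L ξ)_l α_l`.
  let L : (Fin k → ℝ) →L[ℝ] (Fin k → ℝ) := LinearMap.toContinuousLinearMap (Matrix.toLin' A.transpose)
  have hLdet : L.det = A.det := by
    change LinearMap.det (Matrix.toLin' A.transpose) = A.det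
    rw [LinearMap.det_toLin', Matrix.det_transpose]
  have hLξ : ∀ ξ l, L ξ l = ∑ j, ξ j * A j l := fun ξ l => by
    change Matrix.toLin' A.transpose ξ l = _
    simp [Matrix.toLin'_apply, Matrix.mulVec, dotProduct, mul_comm]
  let P : GradedForm (TangentSpace 𝓘(ℝ, EM) x) :=
    (List.ofFn fun j : Fin k => GradedForm.homog 1 (covectorForm (α j.rev x))).prod
  let X : (Fin k → ℕ) → GradedForm (TangentSpace 𝓘(ℝ, EM) x) := fun i =>
    (List.ofFn fun j => GradedForm.homog 2
      (mextDeriv 𝓘(ℝ, EM) (fun y => covectorForm (α j y)) x) ^ i j).prod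
  obtain ⟨hF1, hF2⟩ := integral_angularFourier_mul_form hg.contDiff hg.hasCompactSupport P X
    (Finset.range (Module.finrank ℝ EM + 1)) n v
  have hloc : localForm H μ α φ x n v = (P * ∑ m ∈ Finset.range (Module.finrank ℝ EM + 1),
      ∑ i ∈ Finset.piAntidiag (Finset.univ : Finset (Fin k)) m,
      (((-1) ^ (∑ j, i j) * mixedPartial i g 0) / ((∏ j, (i j).factorial : ℕ) : ℂ)) • X i) n v := by
    rw [localForm_eq]
    simp only [hg.diracPullback_eq]
    rfl
  set F : (Fin k → ℝ) → ℂ := fun ξ => angularFourier g ξ * (Complex.I ^ k *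
      (P * ∑ m ∈ Finset.range (Module.finrank ℝ EM + 1),
        ∑ i ∈ Finset.piAntidiag (Finset.univ : Finset (Fin k)) m,
      ((∏ j, (-Complex.I * ξ j) ^ i j) / ((∏ j, (i j).factorial : ℕ) : ℂ)) • X i) n v) with hF
  -- Replacing the vertical vectors of `b` by those of the frame produces the factor `det A`.
  have key : (fun ξ => expPairing H μ φ (⟨x, ∑ j, ξ j • b j⟩ : Cotangent EM M) (n + k)
      (Fin.append (lift ξ) fun j => verticalVector _ (b j))) = fun ξ => (A.det : ℂ) * F (L ξ) := by
    funext ξ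
    have h1 : (fun j => (verticalVector (⟨x, ∑ j, ξ j • b j⟩ : Cotangent EM M) (b j) :
        EM × (EM →L[ℝ] ℝ))) = fun j => ∑ l, A j l • ((0, α l x) : EM × (EM →L[ℝ] ℝ)) := by
      funext j
      refine (verticalVector_eq (⟨x, ∑ j, ξ j • b j⟩ : Cotangent EM M) (b j)).trans ?_
      have h2 : ∀ a : Fin k → EM →L[ℝ] ℝ, ∑ l, A j l • ((0, a l) : EM × (EM →L[ℝ] ℝ)) =
          (0, ∑ l, A j l • a l) := fun a => by
        refine Prod.ext ?_ ?_
        · simp [Prod.fst_sum]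
        · simp [Prod.snd_sum]
      refine Eq.trans ?_ (h2 fun l => α l x).symm
      exact congrArg (fun c : EM →L[ℝ] ℝ => ((0, c) : EM × (EM →L[ℝ] ℝ))) (hbA j)
    have hq : (∑ j, ξ j • b j : TangentSpace 𝓘(ℝ, EM) x →L[ℝ] ℝ) = ∑ l, L ξ l • α l x := by
      have h3 : ∀ a b : Fin k → EM →L[ℝ] ℝ, (∀ j, b j = ∑ l, A j l • a l) →
          ∑ j, ξ j • b j = ∑ l, L ξ l • a l := fun a b h => by
        simp only [h, hLξ, Finset.smul_sum, Finset.sum_smul, smul_smul]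
        exact Finset.sum_comm
      exact h3 (fun l => α l x) b hbA
    have h4 := expPairing_append μ hact hrk hE hα hx hg hq (lift ξ) fun i => (hlift ξ i).1
    have h5 : (fun a => (lift ξ a : EM × (EM →L[ℝ] ℝ)).1) = v := by
      funext a
      exact (DFunLike.congr_fun (mfderiv_cotangent_proj (EM := EM) (M := M)
        ⟨x, ∑ j, ξ j • b j⟩) (lift ξ a)).symm.trans (hlift ξ a).2
    rw [h5] at h4
    refine (congrArg (fun u : Fin k → EM × (EM →L[ℝ] ℝ) => expPairing H μ φ
      (⟨x, ∑ j, ξ j • b j⟩ : Cotangent EM M) (n + k) (Fin.append (lift ξ) u)) h1).trans ?_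
    refine (expPairing_append_sum_smul μ hact φ (⟨x, ∑ j, ξ j • b j⟩ : Cotangent EM M) (lift ξ)
      (fun l => ((0, α l x) : EM × (EM →L[ℝ] ℝ))) A).trans ?_
    exact congrArg ((A.det : ℂ) * ·) h4
  have hLne : L.det ≠ 0 := by rw [hLdet]; exact hA.ne'
  have hA' : (A.det : ℂ) ≠ 0 := Complex.ofReal_ne_zero.2 hA.ne'
  constructor
  · have h6 := (integrable_comp_of_det_ne_zero volume L hLne hF1).const_mul (A.det : ℂ)
    exact key ▸ h6
  · refine (congrArg (fun G : (Fin k → ℝ) → ℂ => ∫ ξ, G ξ) key).trans ?_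
    -- The Jacobian `|det L|⁻¹` cancels the factor `det A`, and it is positivity of the orientations
    -- that removes the absolute value.
    rw [integral_const_mul, integral_comp_of_det_ne_zero volume L hLne F, hLdet, abs_of_pos hA,
      Complex.real_smul, ← mul_assoc, Complex.ofReal_inv, mul_inv_cancel₀ hA', one_mul, hloc]
    exact hF2

end FibreIntegral

/-! ### Independence of the frame and the global form. -/

section Existence

variable {EM : Type*} [NormedAddCommGroup EM] [NormedSpace ℝ EM]
  {M : Type*} [TopologicalSpace M] [ChartedSpace EM M] {k : ℕ}
  {E : (x : M) → Submodule ℝ (TangentSpace 𝓘(ℝ, EM) x)}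
  {o : (x : M) → Orientation ℝ (conormal E x) (Fin k)}
  [FiniteDimensional ℝ EM] [IsManifold 𝓘(ℝ, EM) ∞ M]
  {EH : Type*} [NormedAddCommGroup EH] [NormedSpace ℝ EH] [FiniteDimensional ℝ EH]
  {H : Type*} [TopologicalSpace H] [ChartedSpace EH H] [Group H] [MulAction H M]
  [LieGroup 𝓘(ℝ, EH) ∞ H] [MeasurableSpace EH] [BorelSpace EH] (μ : Measure EH)

-- The defining condition quantifies over all oriented bases and lifts; evaluating it on the frame
-- and on one existing family of lifts fixes the value.
omit [FiniteDimensional ℝ EM] in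
theorem IsFibreIntegral.unique {U : Set M}
    {α : Fin k → (x : M) → (TangentSpace 𝓘(ℝ, EM) x →L[ℝ] ℝ)} (hα : IsOrientedFrame o U α)
    {x : M} (hx : x ∈ U)
    {η : (p : Cotangent EM M) → (m : ℕ) → (Fin m → TangentSpace (cotModel EM) p) → ℂ} {n : ℕ}
    {v : Fin n → TangentSpace 𝓘(ℝ, EM) x} {c c' : ℂ} (h : IsFibreIntegral o η x n v c)
    (h' : IsFibreIntegral o η x n v c') : c = c' := by
  have hmem : ∀ ξ : Fin k → ℝ, ∑ j, ξ j • α j x ∈ conormal E x := fun ξ =>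
    Submodule.sum_mem _ fun j _ => Submodule.smul_mem _ _ ((hα.positive x hx).mem_conormal j)
  choose lift hl using fun (ξ : Fin k → ℝ) (i : Fin n) =>
    exists_isTangentToConormal hα hx (hmem ξ) (v i)
  exact (h _ (hα.positive x hx) lift hl).2.symm.trans (h' _ (hα.positive x hx) lift hl).2

theorem two_pi_I_pow_ne_zero (k : ℕ) : (2 * Real.pi * Complex.I : ℂ) ^ k ≠ 0 :=
  pow_ne_zero _ Complex.two_pi_I_ne_zero

section LocalForm

variable [μ.IsAddHaarMeasure]

/-- No transformation rule for the local expressions is needed: after multiplication by `(2πi)^k`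
both are values of the same fibre integral, whose definition involves no frame and which has at most
one value. -/
theorem IsOrientedFrame.localForm_eq_localForm
    (hact : ContMDiff (𝓘(ℝ, EH).prod 𝓘(ℝ, EM)) 𝓘(ℝ, EM) ∞ (fun p : H × M => p.1 • p.2))
    {r : ℕ} (hrk : r + k = Module.finrank ℝ EM) (hE : IsSmoothDistribution E r)
    (htrans : IsTransverse EH H E) {U U' : Set M}
    {α α' : Fin k → (x : M) → (TangentSpace 𝓘(ℝ, EM) x →L[ℝ] ℝ)} (hα : IsOrientedFrame o U α)
    (hα' : IsOrientedFrame o U' α') {x : M} (hx : x ∈ U) (hx' : x ∈ U') {φ : EH → ℂ}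
    (hφ : ContDiff ℝ ∞ φ) (hc : HasCompactSupport φ) :
    localForm H μ α φ x = localForm H μ α' φ x :=
  GradedForm.ext_apply fun n v => mul_left_cancel₀ (two_pi_I_pow_ne_zero k)
    ((hα.isFibreIntegral μ hact hrk hE htrans hx hφ hc n v).unique hα hx
      (hα'.isFibreIntegral μ hact hrk hE htrans hx' hφ hc n v))

omit [FiniteDimensional ℝ EM] [IsManifold 𝓘(ℝ, EM) ∞ M] [LieGroup 𝓘(ℝ, EH) ∞ H] in
theorem localForm_add (htrans : IsTransverse EH H E)
    {α : Fin k → (x : M) → (TangentSpace 𝓘(ℝ, EM) x →L[ℝ] ℝ)} {x : M}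
    (hα : IsPositive o x fun j => α j x) {φ ψ : EH → ℂ} (hφ : ContDiff ℝ ∞ φ)
    (hc : HasCompactSupport φ) (hψ : ContDiff ℝ ∞ ψ) (hc' : HasCompactSupport ψ) :
    localForm H μ α (φ + ψ) x = localForm H μ α φ x + localForm H μ α ψ x := by
  have hL := momentCLM_surjective (EH := EH) H htrans hα
  have h : ∀ i, diracPullback μ (momentMap H α x) i (φ + ψ) =
      diracPullback μ (momentMap H α x) i φ + diracPullback μ (momentMap H α x) i ψ := fun i =>
    diracPullback_add hL i hφ hc hψ hc'
  simp only [localForm_eq, h, add_div, add_smul, Finset.sum_add_distrib, mul_add]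

omit [FiniteDimensional ℝ EM] [IsManifold 𝓘(ℝ, EM) ∞ M] [LieGroup 𝓘(ℝ, EH) ∞ H] in
theorem localForm_smul (htrans : IsTransverse EH H E)
    {α : Fin k → (x : M) → (TangentSpace 𝓘(ℝ, EM) x →L[ℝ] ℝ)} {x : M}
    (hα : IsPositive o x fun j => α j x) (c : ℂ) {φ : EH → ℂ} (hφ : ContDiff ℝ ∞ φ)
    (hc : HasCompactSupport φ) :
    localForm H μ α (c • φ) x = c • localForm H μ α φ x := by
  have hL := momentCLM_surjective (EH := EH) H htrans hα
  have h : ∀ i, diracPullback μ (momentMap H α x) i (c • φ) =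
      c * diracPullback μ (momentMap H α x) i φ := fun i => diracPullback_smul hL i c hφ hc
  simp only [localForm_eq, h, mul_div_assoc, mul_smul, ← Finset.smul_sum, mul_smul_comm]

omit [FiniteDimensional ℝ EM] [IsManifold 𝓘(ℝ, EM) ∞ M] [LieGroup 𝓘(ℝ, EH) ∞ H] in
theorem continuous_localForm (htrans : IsTransverse EH H E)
    {α : Fin k → (x : M) → (TangentSpace 𝓘(ℝ, EM) x →L[ℝ] ℝ)} {x : M}
    (hα : IsPositive o x fun j => α j x) (n : ℕ) (v : Fin n → TangentSpace 𝓘(ℝ, EM) x) :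
    Continuous fun φ : 𝓓((⊤ : TopologicalSpace.Opens EH), ℂ) => localForm H μ α φ x n v := by
  simp only [localForm_eq]
  simp only [fun φ : 𝓓((⊤ : TopologicalSpace.Opens EH), ℂ) =>
    GradedForm.mul_sum_smul_apply (V := TangentSpace 𝓘(ℝ, EM) x)
      (List.ofFn fun j : Fin k => GradedForm.homog 1 (covectorForm (α j.rev x))).prod
      (fun i => (List.ofFn fun j => GradedForm.homog 2
        (mextDeriv 𝓘(ℝ, EM) (fun y => covectorForm (α j y)) x) ^ (i j)).prod)
      (fun i => diracPullback μ (momentMap H α x) i φ)]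
  exact continuous_finsetSum _ fun m _ => continuous_finsetSum _ fun i _ =>
    continuous_const.mul (continuous_diracPullback μ (momentCLM_surjective (EH := EH) H htrans hα) i)

end LocalForm

end Existence

theorem mainTheorem5
    {EM : Type*} [NormedAddCommGroup EM] [NormedSpace ℝ EM] [FiniteDimensional ℝ EM]
    {M : Type*} [TopologicalSpace M] [T2Space M] [SecondCountableTopology M]
    [ChartedSpace EM M] [IsManifold 𝓘(ℝ, EM) ∞ M]
    {EH : Type*} [NormedAddCommGroup EH] [NormedSpace ℝ EH] [FiniteDimensional ℝ EH]
    [MeasurableSpace EH] [BorelSpace EH] (μ : Measure EH) [μ.IsAddHaarMeasure]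
    {H : Type*} [TopologicalSpace H] [T2Space H] [SecondCountableTopology H]
    [ChartedSpace EH H] [Group H] [LieGroup 𝓘(ℝ, EH) ∞ H]
    [MulAction H M]
    (hact : ContMDiff (𝓘(ℝ, EH).prod 𝓘(ℝ, EM)) 𝓘(ℝ, EM) ∞ (fun p : H × M => p.1 • p.2))
    {r k : ℕ} (hrk : r + k = Module.finrank ℝ EM)
    (E : (x : M) → Submodule ℝ (TangentSpace 𝓘(ℝ, EM) x))
    (hE : IsSmoothDistribution E r)
    (o : (x : M) → Orientation ℝ (conormal E x) (Fin k))
    (ho : IsBundleOrientation o)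
    (hHE : PreservesDistribution H E)
    (hHo : PreservesOrientation H o)
    (htrans : IsTransverse EH H E) :
    -- the compositions `δ₀^{(I)} ∘ f_α(x)` are well defined
    (∀ (U : Set M) (α : Fin k → (x : M) → (TangentSpace 𝓘(ℝ, EM) x →L[ℝ] ℝ)),
      IsOrientedFrame o U α → ∀ x ∈ U, ∀ φ : 𝓓((⊤ : TopologicalSpace.Opens EH), ℂ),
        ∃! g, IsPushforward μ (momentMap H α x) φ g) ∧
    -- the local forms glue to a unique global form
    (∃! Jt : 𝓓((⊤ : TopologicalSpace.Opens EH), ℂ) →ₗ[ℂ] DiffForm 𝓘(ℝ, EM) M,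
      IsGeneralizedForm H Jt ∧ RestrictsToLocalForms H μ o Jt) ∧
    -- the oscillatory fibre integral is a well defined form
    (∃! J : 𝓓((⊤ : TopologicalSpace.Opens EH), ℂ) →ₗ[ℂ] DiffForm 𝓘(ℝ, EM) M,
      IsGeneralizedForm H J ∧ IsOscillatoryFibreIntegral H μ o J) ∧
    -- the two forms coincide
    (∀ Jt J : 𝓓((⊤ : TopologicalSpace.Opens EH), ℂ) →ₗ[ℂ] DiffForm 𝓘(ℝ, EM) M,
      RestrictsToLocalForms H μ o Jt → IsOscillatoryFibreIntegral H μ o J → Jt = J) := by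
  have hs : ∀ φ : 𝓓((⊤ : TopologicalSpace.Opens EH), ℂ), ContDiff ℝ ∞ φ := fun φ => φ.contDiff
  have hk : ∀ φ : 𝓓((⊤ : TopologicalSpace.Opens EH), ℂ), HasCompactSupport φ := fun φ =>
    φ.hasCompactSupport
  have hindep : ∀ {U U' : Set M} {α α' : Fin k → (x : M) → (TangentSpace 𝓘(ℝ, EM) x →L[ℝ] ℝ)},
      IsOrientedFrame o U α → IsOrientedFrame o U' α' → ∀ {x : M}, x ∈ U → x ∈ U' →
      ∀ φ : 𝓓((⊤ : TopologicalSpace.Opens EH), ℂ), localForm H μ α φ x = localForm H μ α' φ x :=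
    fun hα hα' _ hx hx' φ =>
      hα.localForm_eq_localForm μ hact hrk hE htrans hα' hx hx' (hs φ) (hk φ)
  choose V β hxV hβ using ho
  -- At each point the global form uses the frame chosen around that point; independence of the
  -- frame makes these values fit together.
  let J₀ : 𝓓((⊤ : TopologicalSpace.Opens EH), ℂ) →ₗ[ℂ] DiffForm 𝓘(ℝ, EM) M :=
    { toFun := fun φ x => localForm H μ (β x) φ x
      map_add' := fun φ ψ => funext fun x =>
        localForm_add μ htrans ((hβ x).positive x (hxV x)) (hs φ) (hk φ) (hs ψ) (hk ψ)
      map_smul' := fun c φ => funext fun x =>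
        localForm_smul μ htrans ((hβ x).positive x (hxV x)) c (hs φ) (hk φ) }
  have hloc : RestrictsToLocalForms H μ o J₀ := fun U α hα φ x hx =>
    hindep (hβ x) hα (hxV x) hx φ
  have hgen : IsGeneralizedForm H J₀ := by
    refine ⟨fun φ n x₀ y hy => ?_, fun x n v =>
      continuous_localForm μ htrans ((hβ x).positive x (hxV x)) n v, fun h φ ψ hψ x n => ?_⟩
    · set x₁ := (extChartAt 𝓘(ℝ, EM) x₀).symm y with hx₁
      have h1 := (hβ x₁).contDiffAt_localForm μ H hact htrans (hs φ) (hk φ) x₀ hy (hxV x₁) n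
      refine (h1.congr_of_eventuallyEq ?_).contDiffWithinAt
      have h2 : ContinuousAt (extChartAt 𝓘(ℝ, EM) x₀).symm y :=
        continuousAt_extChartAt_symm'' hy
      -- Neighbouring points carry other chosen frames, but `hloc` replaces them all by the single
      -- frame chosen at `x₁`, whose local form is smooth.
      filter_upwards [h2.preimage_mem_nhds ((hβ x₁).isOpen.mem_nhds (hxV x₁))] with z hz
      exact congrArg (fun a : GradedForm (TangentSpace 𝓘(ℝ, EM) _) =>
        (a n).compContinuousLinearMap (mfderivWithin 𝓘(ℝ, EM) 𝓘(ℝ, EM)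
          (extChartAt 𝓘(ℝ, EM) x₀).symm (range 𝓘(ℝ, EM)) z)) (hloc _ _ (hβ x₁) φ _ hz)
    · have h1 := (hβ (h • x)).localForm_act μ hact hHo htrans (hs φ) (hk φ) h hψ (hxV (h • x))
      -- The frame pulled back from `h • x` is exchanged for the frame chosen at `x`, closing the
      -- equivariance identity.
      have h2 := hindep ((hβ (h • x)).isOrientedFrame_pullbackFrame hact hHo h) (hβ x)
        (hxV (h • x)) (hxV x) φ
      rw [h2] at h1
      exact congrFun h1 n
  have hosc : IsOscillatoryFibreIntegral H μ o J₀ := fun φ x n v =>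
    ⟨_, (hβ x).isFibreIntegral μ hact hrk hE htrans (hxV x) (hs φ) (hk φ) n v,
      (inv_mul_cancel_left₀ (two_pi_I_pow_ne_zero k) _).symm⟩
  have hlocu : ∀ T, RestrictsToLocalForms H μ o T → T = J₀ := fun T hT =>
    LinearMap.ext fun φ => funext fun x => hT _ _ (hβ x) φ x (hxV x)
  have hoscu : ∀ T, IsOscillatoryFibreIntegral H μ o T → T = J₀ := fun T hT =>
    LinearMap.ext fun φ => funext fun x => GradedForm.ext_apply fun n v => by
      obtain ⟨c, hc, hTc⟩ := hT φ x n v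
      obtain ⟨c', hc', hJc⟩ := hosc φ x n v
      rw [hTc, hJc, hc.unique (hβ x) (hxV x) hc']
  refine ⟨fun U α hα x hx φ => ?_, ⟨J₀, ⟨hgen, hloc⟩, fun T hT => hlocu T hT.2⟩,
    ⟨J₀, ⟨hgen, hosc⟩, fun T hT => hoscu T hT.2⟩, fun Jt J hJt hJ => (hlocu _ hJt).trans (hoscu _ hJ).symm⟩
  obtain ⟨g, hg⟩ := exists_isPushforward μ
    (momentCLM_surjective (EH := EH) H htrans (hα.positive x hx)) (hs φ) (hk φ)
  exact ⟨g, hg, fun g' hg' => IsPushforward.unique hg' hg⟩
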